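/- Fix integers $d,b,s\ge 1$ and $p\ge 0$, a constant symmetric positive semidefinite matrix $S\in\mathbb R^{b\times b}$, and real numbers $g_0>0$, $\Lambda$, $\sigma$, $0\le c<c_{\max}$. There are constants $\tau_0\in(0,1]$ and $C\ge 0$, depending only on these data (in particular not on the mesh size $h$), such that the following holds. *Problem.* Let $\mathcal T$ be a finite conforming simplicial mesh in $\mathbb R^d$ of a closed domain $\overline\Omega$, with shape regularity constant $\sigma$: every element $K$ contains a ball of some radius $r>0$ with $\operatorname{diam}K\le\sigma r$. Let $\mathcal G,\mathcal L^{(1)},\dots,\mathcal L^{(d)}:\overline\Omega\to\mathbb R^{b\times b}$ be measurable, symmetric and bounded entrywise by $\Lambda$, with $\mathcal G\ge g_0I$ and $\sum_j\partial_j\mathcal L^{(j)}=0$ in the sense of distributions, and such that no wave speed exceeds $c$: almost everywhere, if $|\nu|=1$, $\xi\ne0$ and $\sum_j\nu_j\mathcal L^{(j)}\xi=\lambda\,\mathcal G\xi$, then $|\lambda|\le c$. On facets, $\sum_j\nu_j\mathcal L^{(j)}$ denotes the normal trace, i.e. $\int_K\sum_j\mathcal L^{(j)}\partial_j\varphi\,dx=\int_{\partial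 K}\sum_j n_j\mathcal L^{(j)}\varphi\,dS$ for every element $K$ with outward unit normal $n$ and every smooth $\varphi$. *Tent.* Let $\mathrm v$ be a mesh vertex in the interior of $\overline\Omega$ and $\Omega^{\mathrm v}$ its vertex patch (the union of the elements containing $\mathrm v$). Let $\varphi_{\rm bot},\varphi_{\rm top}$ be continuous functions on $\Omega^{\mathrm v}$ that are affine on each element, satisfy the causality condition $|\mathrm{grad}\,\varphi_{\rm bot}|,|\mathrm{grad}\,\varphi_{\rm top}|<1/c_{\max}$ on each element, agree at all vertices of the patch except $\mathrm v$, and satisfy $\varphi_{\rm bot}(\mathrm v)\le\varphi_{\rm top}(\mathrm v)$. Put $\delta=\varphi_{\rm top}-\varphi_{\rm bot}$. *Operators.* Let $V_h$ be the space of functions on $\Omega^{\mathrm v}$ whose restriction to each element is a vector of $b$ polynomials of degree at most $p$, with the $L^2$ inner product $(\cdot,\cdot)$, and define $M_0,M_1,A:V_h\to V_h$ by $$(M_0u,w)=\Big(\mathcal Gu-\sum_j\partial_j\varphi_{\rm bot}\,\mathcal L^{(j)}u,\;w\Big),\qquad (M_1u,w)=\Big(\sum_j\partial_j\delta\,\mathcal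 L^{(j)}u,\;w\Big),$$ $$(Au,w)=\sum_{K}\int_K\delta\sum_j\mathcal L^{(j)}u\cdot\partial_jw\,dx+\sum_F\int_F\delta\,\Big(\sum_j\nu_j\mathcal L^{(j)}\{u\}-S[u]\Big)\cdot[w]\,dS,$$ where $K$ runs over the elements and $F$ over the facets of the patch shared by two elements, $\nu$ is a unit normal of $F$, $[u](x)=\lim_{\varepsilon\to0^+}\big(u(x+\varepsilon\nu)-u(x-\varepsilon\nu)\big)$ and $\{u\}(x)=\tfrac12\lim_{\varepsilon\to0^+}\big(u(x+\varepsilon\nu)+u(x-\varepsilon\nu)\big)$. For $t\in[0,1]$ let $M(t)=M_0-tM_1$. For $0\le t<t+\tau\le1$ the SAT step of order $s$ on the subtent between the pseudotimes $t$ and $t+\tau$ (with $t=0$ for a step from the bottom of the tent) is $$R_s=\sum_{i=0}^{s-1}\frac1{i!}X_i+M(t+\tau)^{-1}M(t)\,\frac1{s!}X_s,\qquad X_0=I,\quad X_i=\tau M(t)^{-1}(A+iM_1)X_{i-1}\ (i\ge1).$$ *Claim.* Whenever $t\ge0$, $0<\tau\le\tau_0$ and $t+\tau\le1$, the operators $M(t)$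 and $M(t+\tau)$ are selfadjoint and positive definite, and $$\|R_sv\|_{M(t+\tau)}\le\left(1+C\tau^{s+1}\right)\|v\|_{M(t)}\qquad\text{for all }v\in V_h,$$ where $\|v\|_B=(Bv,v)^{1/2}$. -/

import Mathlib

open MeasureTheory
open scoped Gradient ContDiff

noncomputable section

namespace SATTent

/-- The space `ℝ^d` with its Euclidean norm. -/
abbrev Space (d : ℕ) : Type := EuclideanSpace ℝ (Fin d)

/-! ### Simplicial meshes and vertex patches -/

/-- A finite conforming simplicial complex in `ℝ^d`; its `d`-dimensional simplices are the
elements of the mesh. A simplex is given by the finite set of its vertices. -/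
structure Mesh (d : ℕ) where
  complex : Geometry.SimplicialComplex ℝ (Space d)
  finite : complex.faces.Finite

/-- The closed simplex with vertex set `K`. -/
abbrev hull {d : ℕ} (K : Finset (Space d)) : Set (Space d) :=
  convexHull ℝ (K : Set (Space d))

/-- The barycenter of the simplex with vertex set `K`. -/
def barycenter {d : ℕ} (K : Finset (Space d)) : Space d :=
  (K.card : ℝ)⁻¹ • ∑ x ∈ K, x

/-- The unit normal to the facet `F` of the simplex `K` that points out of `K`: the normalized
component orthogonal to `F` of the vector from the barycenter of `K` to that of `F`. -/
def outwardNormal {d : ℕ} (K F : Finset (Space d)) : Space d :=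
  let n : Space d :=
    (vectorSpan ℝ (F : Set (Space d)))ᗮ.starProjection (barycenter F - barycenter K)
  ‖n‖⁻¹ • n

namespace Mesh

variable {d : ℕ}

open Classical in
/-- The mesh elements: the simplices with `d + 1` vertices. -/
def elements (T : Mesh d) : Finset (Finset (Space d)) :=
  T.finite.toFinset.filter (fun K => K.card = d + 1)

/-- The closed domain that is meshed. -/
def domain (T : Mesh d) : Set (Space d) :=
  ⋃ K ∈ T.elements, hull K

open Classical in
/-- The vertex patch of `v`: all mesh elements that have `v` as a vertex. -/
def patch (T : Mesh d) (v : Space d) : Finset (Finset (Space d)) :=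
  T.elements.filter (fun K => v ∈ K)

/-- Every element `K` contains a ball of radius `r > 0` with `diam K ≤ σ r`. -/
def ShapeRegular (T : Mesh d) (σ : ℝ) : Prop :=
  ∀ K ∈ T.elements, ∃ x : Space d, ∃ r : ℝ, 0 < r ∧
    Metric.closedBall x r ⊆ hull K ∧ Metric.diam (hull K) ≤ σ * r

/-- `v` is a mesh vertex in the interior of the domain. -/
def IsInteriorVertex (T : Mesh d) (v : Space d) : Prop :=
  v ∈ T.complex.vertices ∧ v ∈ interior T.domain

end Mesh

/-! ### Symmetric linear hyperbolic systems -/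

/-- The matrix `∑_j ν_j L^(j)(x)`. -/
def normalFlux {d b : ℕ} (L : Fin d → Space d → Matrix (Fin b) (Fin b) ℝ) (ν x : Space d) :
    Matrix (Fin b) (Fin b) ℝ :=
  ∑ j, ν j • L j x

/-- The coefficients `G`, `L^(j)` of the system `∂_t (G u) + ∑_j ∂_j (L^(j) u) = 0` with `b`
unknowns on the closed domain `Ω`. The numbers quantify the assumptions: the entries of the
coefficients are bounded by `Λ`, `G ≥ g₀ I`, and no wave speed exceeds `c`. -/
structure HyperbolicSystem (d b : ℕ) (Ω : Set (Space d)) (g₀ Λ c : ℝ) where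
  G : Space d → Matrix (Fin b) (Fin b) ℝ
  L : Fin d → Space d → Matrix (Fin b) (Fin b) ℝ
  measurable_G : ∀ l k, Measurable fun x => G x l k
  measurable_L : ∀ j l k, Measurable fun x => L j x l k
  symm_G : ∀ x ∈ Ω, (G x).IsSymm
  symm_L : ∀ j, ∀ x ∈ Ω, (L j x).IsSymm
  bound_G : ∀ x ∈ Ω, ∀ l k, |G x l k| ≤ Λ
  bound_L : ∀ j, ∀ x ∈ Ω, ∀ l k, |L j x l k| ≤ Λ
  posDef_G : ∀ᵐ x ∂(volume.restrict Ω), ∀ ξ : Fin b → ℝ,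
    g₀ * (ξ ⬝ᵥ ξ) ≤ (G x).mulVec ξ ⬝ᵥ ξ
  /-- The wave speeds at `x` in the direction `ν` are the numbers `|lam|` for which
  `∑_j ν_j L^(j)(x) ξ = lam G(x) ξ` has a nonzero solution `ξ`. -/
  waveSpeed_le : ∀ᵐ x ∂(volume.restrict Ω), ∀ ν : Space d, ‖ν‖ = 1 →
    ∀ (lam : ℝ) (ξ : Fin b → ℝ), ξ ≠ 0 →
      (normalFlux L ν x).mulVec ξ = lam • (G x).mulVec ξ → |lam| ≤ c
  /-- `∑_j ∂_j L^(j) = 0` in the sense of distributions in the interior of the domain. -/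
  divFree : ∀ φ : Space d → ℝ, ContDiff ℝ ∞ φ → HasCompactSupport φ →
    tsupport φ ⊆ interior Ω → ∀ l k, ∫ x in Ω, ∑ j, L j x l k * (∇ φ x) j = 0

open Classical in
/-- On the facets of the mesh elements, which are null sets, the values of the (divergence free)
fields `L^(j)` are their normal traces: on the boundary of each element `K`, with outward unit
normal `n`, the trace of `∑_j n_j L^(j)` is the function `t` that is characterized by
`∫_K ∑_j L^(j) ∂_j φ dx = ∫_{∂K} t φ dS` for all smooth functions `φ`. -/
def HasNormalTraces {d b : ℕ} (T : Mesh d) (L : Fin d → Space d → Matrix (Fin b) (Fin b) ℝ) :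
    Prop :=
  ∀ K ∈ T.elements, ∀ φ : Space d → ℝ, ContDiff ℝ ∞ φ → ∀ l k,
    ∫ x in hull K, ∑ j, L j x l k * (∇ φ x) j =
      ∑ w ∈ K, ∫ x in hull (K.erase w),
        normalFlux L (outwardNormal K (K.erase w)) x l k * φ x ∂μHE[d - 1]

/-! ### Tents -/

/-- The gradient on the element `K` of a function that is affine on `K`. -/
def elementGrad {d : ℕ} (φ : Space d → ℝ) (K : Finset (Space d)) : Space d :=
  ∇ φ (barycenter K)

/-- A tent over the vertex patch of `v`, between two continuous piecewise linear fronts which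
agree at all vertices of the patch other than `v` and satisfy the causality condition. -/
structure Tent {d : ℕ} (T : Mesh d) (v : Space d) (cmax : ℝ) where
  bot : Space d → ℝ
  top : Space d → ℝ
  affine_bot : ∀ K ∈ T.patch v, ∃ a : Space d →ᵃ[ℝ] ℝ, Set.EqOn bot a (hull K)
  affine_top : ∀ K ∈ T.patch v, ∃ a : Space d →ᵃ[ℝ] ℝ, Set.EqOn top a (hull K)
  causal_bot : ∀ K ∈ T.patch v, ‖elementGrad bot K‖ < 1 / cmax
  causal_top : ∀ K ∈ T.patch v, ‖elementGrad top K‖ < 1 / cmax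
  pole : bot v ≤ top v
  eq_of_ne : ∀ K ∈ T.patch v, ∀ w ∈ K, w ≠ v → top w = bot w

/-- The height `δ = φ_top - φ_bot` of the tent. -/
def Tent.height {d : ℕ} {T : Mesh d} {v : Space d} {cmax : ℝ} (Θ : Tent T v cmax)
    (x : Space d) : ℝ :=
  Θ.top x - Θ.bot x

/-! ### The discontinuous Galerkin space -/

/-- The DG space on the vertex patch of `v`: a vector of `b` polynomials of total degree at most
`p` on every element of the patch. -/
abbrev DGSpace {d : ℕ} (T : Mesh d) (v : Space d) (b p : ℕ) : Type :=
  ↥(T.patch v) → Fin b → ↥(MvPolynomial.restrictTotalDegree (Fin d) ℝ p)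

section Forms

variable {d : ℕ} {T : Mesh d} {v : Space d} {b p : ℕ}

/-- The value at `x` of the polynomial vector on the element `K`. For `x` on a facet of `K` this
is the one-sided limit from `K`. -/
def val (K : ↥(T.patch v)) (x : Space d) : DGSpace T v b p →ₗ[ℝ] (Fin b → ℝ) where
  toFun u k := MvPolynomial.eval (fun i => x i) (u K k : MvPolynomial (Fin d) ℝ)
  map_add' u w := by ext k; simp
  map_smul' r u := by ext k; simp [MvPolynomial.smul_eval]

/-- The partial derivative `∂_j` at `x` of the polynomial vector on the element `K`. -/
def pderivVal (K : ↥(T.patch v)) (j : Fin d) (x : Space d) :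
    DGSpace T v b p →ₗ[ℝ] (Fin b → ℝ) where
  toFun u k := MvPolynomial.eval (fun i => x i)
    (MvPolynomial.pderiv j (u K k : MvPolynomial (Fin d) ℝ))
  map_add' u w := by ext k; simp
  map_smul' r u := by ext k; simp [MvPolynomial.smul_eval]

/-! #### Integrability of the integrands below -/

/-- Almost everywhere measurable and bounded on `s`. -/
def BddMeas (μ : Measure (Space d)) (s : Set (Space d)) (f : Space d → ℝ) : Prop :=
  AEStronglyMeasurable f (μ.restrict s) ∧ ∃ C, ∀ x ∈ s, |f x| ≤ C

theorem BddMeas.add {μ : Measure (Space d)} {s : Set (Space d)} {f g : Space d → ℝ}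
    (hf : BddMeas μ s f) (hg : BddMeas μ s g) : BddMeas μ s (fun x => f x + g x) := by
  obtain ⟨hf, C, hC⟩ := hf
  obtain ⟨hg, D, hD⟩ := hg
  exact ⟨hf.add hg, C + D, fun x hx =>
    (abs_add_le _ _).trans (add_le_add (hC x hx) (hD x hx))⟩

theorem BddMeas.mul {μ : Measure (Space d)} {s : Set (Space d)} {f g : Space d → ℝ}
    (hf : BddMeas μ s f) (hg : BddMeas μ s g) : BddMeas μ s (fun x => f x * g x) := by
  obtain ⟨hf, C, hC⟩ := hf
  obtain ⟨hg, D, hD⟩ := hg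
  refine ⟨hf.mul hg, C * D, fun x hx => ?_⟩
  rw [abs_mul]
  exact mul_le_mul (hC x hx) (hD x hx) (abs_nonneg _) ((abs_nonneg _).trans (hC x hx))

theorem BddMeas.const {μ : Measure (Space d)} {s : Set (Space d)} (r : ℝ) :
    BddMeas μ s (fun _ => r) :=
  ⟨aestronglyMeasurable_const, |r|, fun _ _ => le_rfl⟩

theorem BddMeas.sub {μ : Measure (Space d)} {s : Set (Space d)} {f g : Space d → ℝ}
    (hf : BddMeas μ s f) (hg : BddMeas μ s g) : BddMeas μ s (fun x => f x - g x) := by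
  simpa [sub_eq_add_neg] using hf.add ((BddMeas.const (-1)).mul hg)

theorem BddMeas.sum {μ : Measure (Space d)} {s : Set (Space d)} {ι : Type} (t : Finset ι)
    {f : ι → Space d → ℝ} (hf : ∀ i ∈ t, BddMeas μ s (f i)) :
    BddMeas μ s (fun x => ∑ i ∈ t, f i x) := by
  classical
  induction t using Finset.induction_on with
  | empty => simpa using BddMeas.const 0
  | insert a t ha ih =>
    simp only [Finset.sum_insert ha]
    exact (hf a (by simp)).add (ih fun i hi => hf i (by simp [hi]))

theorem BddMeas.of_continuousOn {μ : Measure (Space d)} {s : Set (Space d)} (hs : IsCompact s)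
    {f : Space d → ℝ} (hf : ContinuousOn f s) : BddMeas μ s f := by
  refine ⟨hf.aestronglyMeasurable hs.measurableSet, ?_⟩
  obtain ⟨C, hC⟩ := hs.exists_bound_of_continuousOn hf
  exact ⟨C, hC⟩

theorem BddMeas.integrableOn {μ : Measure (Space d)} {s : Set (Space d)} (hs : MeasurableSet s)
    (hμ : μ s ≠ ⊤) {f : Space d → ℝ} (hf : BddMeas μ s f) : IntegrableOn f s μ := by
  obtain ⟨hf, C, hC⟩ := hf
  have : IsFiniteMeasure (μ.restrict s) := ⟨by simpa using hμ.lt_top⟩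
  refine Integrable.of_bound hf C ?_
  filter_upwards [ae_restrict_mem hs] with x hx
  exact hC x hx

theorem isCompact_hull (K : Finset (Space d)) : IsCompact (hull K) :=
  K.finite_toSet.isCompact_convexHull ℝ

theorem volume_hull_ne_top (K : Finset (Space d)) : volume (hull K) ≠ ⊤ :=
  (isCompact_hull K).measure_lt_top.ne

/-- A simplex with `n + 1` vertices has finite `n`-dimensional measure. -/
theorem hausdorff_hull_ne_top {n : ℕ} (F : Finset (Space d)) (hF : F.card = n + 1) :
    (μHE[n] : Measure (Space d)) (hull F) ≠ ⊤ := by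
  let e : Fin (n + 1) ≃ F := (F.equivFinOfCardEq hF).symm
  let x : Fin (n + 1) → Space d := fun i => (e i : Space d)
  let l : (Fin n → ℝ) →ₗ[ℝ] Space d :=
    Fintype.linearCombination ℝ (fun i : Fin n => x i.succ - x 0)
  let f : (Fin n → ℝ) → Space d := fun t => l t + x 0
  have hsub : hull F ⊆ f '' Set.Icc 0 1 := by
    apply convexHull_min
    · intro y hy
      obtain ⟨i, hi⟩ := e.surjective ⟨y, hy⟩
      have hxi : x i = y := by simp [x, hi]
      refine Fin.cases ?_ (fun i => ?_) i hxi
      · intro h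
        exact ⟨0, by simp, by simp [f, h]⟩
      · intro h
        refine ⟨Pi.single i 1, ⟨?_, ?_⟩, ?_⟩
        · intro j; by_cases hj : j = i <;> simp [hj]
        · intro j; by_cases hj : j = i <;> simp [hj]
        · simp [f, l, Fintype.linearCombination_apply_single, h]
    · have h2 : f '' Set.Icc 0 1 = (fun z => x 0 + z) '' (l '' Set.Icc 0 1) := by
        rw [Set.image_image]
        simp only [f, add_comm]
      rw [h2]
      exact ((convex_Icc (0 : Fin n → ℝ) 1).linear_image l).translate _
  obtain ⟨C, hC⟩ : ∃ C, LipschitzWith C f := by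
    refine ⟨‖l.toContinuousLinearMap‖₊, ?_⟩
    intro a b
    have := l.toContinuousLinearMap.lipschitz a b
    simpa [f] using this
  have h1 : (μH[n] : Measure (Space d)) (f '' Set.Icc 0 1) < ⊤ := by
    refine (hC.hausdorffMeasure_image_le (by positivity) _).trans_lt ?_
    refine ENNReal.mul_lt_top (by simp) ?_
    have : (μH[n] : Measure (Fin n → ℝ)) = volume := by
      simpa using hausdorffMeasure_pi_real (ι := Fin n)
    rw [this]
    exact isCompact_Icc.measure_lt_top
  rw [Measure.euclideanHausdorffMeasure_def, Measure.smul_apply]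
  exact (ENNReal.mul_lt_top (by simp) ((measure_mono hsub).trans_lt h1)).ne

theorem facet_measure_ne_top (F : Finset (Space d)) (hF : F.card = d) :
    (μHE[d - 1] : Measure (Space d)) (hull F) ≠ ⊤ := by
  rcases Nat.eq_zero_or_pos d with hd | hd
  · have : F = ∅ := by rw [← Finset.card_eq_zero, hF, hd]
    simp [this, hull]
  · exact hausdorff_hull_ne_top F (by omega)

theorem subset_domain_of_mem_patch {K : Finset (Space d)} (hK : K ∈ T.patch v) :
    hull K ⊆ T.domain :=
  Set.subset_biUnion_of_mem (u := fun K : Finset (Space d) => hull K)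
    (Finset.mem_filter.1 hK).1

theorem continuous_val (K : ↥(T.patch v)) (u : DGSpace T v b p) (k : Fin b) :
    Continuous fun x => val K x u k :=
  (MvPolynomial.continuous_eval _).comp (by fun_prop)

theorem continuous_pderivVal (K : ↥(T.patch v)) (j : Fin d) (u : DGSpace T v b p) (k : Fin b) :
    Continuous fun x => pderivVal K j x u k :=
  (MvPolynomial.continuous_eval _).comp (by fun_prop)

theorem bddMeas_val (K K' : ↥(T.patch v)) (μ : Measure (Space d)) (u : DGSpace T v b p)
    (k : Fin b) : BddMeas μ (hull K'.1) (fun x => val K x u k) :=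
  .of_continuousOn (isCompact_hull _) (continuous_val K u k).continuousOn

theorem Tent.continuousOn_height {cmax : ℝ} (Θ : Tent T v cmax) {K : Finset (Space d)}
    (hK : K ∈ T.patch v) : ContinuousOn Θ.height (hull K) := by
  obtain ⟨a, ha⟩ := Θ.affine_top K hK
  obtain ⟨a', ha'⟩ := Θ.affine_bot K hK
  have h : ContinuousOn (fun x => a x - a' x) (hull K) :=
    (a.continuous_of_finiteDimensional.sub a'.continuous_of_finiteDimensional).continuousOn
  refine h.congr fun x hx => ?_
  simp [Tent.height, ha hx, ha' hx]

theorem bddMeas_coeff {s Ω : Set (Space d)} (hs : s ⊆ Ω) {f : Space d → ℝ} (hf : Measurable f)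
    {C : ℝ} (hC : ∀ x ∈ Ω, |f x| ≤ C) (μ : Measure (Space d)) : BddMeas μ s f :=
  ⟨hf.aestronglyMeasurable, C, fun x hx => hC x (hs hx)⟩

theorem bddMeas_normalFlux {Ω : Set (Space d)} {g₀ Λ c : ℝ} (Q : HyperbolicSystem d b Ω g₀ Λ c)
    {s : Set (Space d)} (hs : s ⊆ Ω) (μ : Measure (Space d)) (ν : Space d) (l k : Fin b) :
    BddMeas μ s (fun x => normalFlux Q.L ν x l k) := by
  have : (fun x => normalFlux Q.L ν x l k) = fun x => ∑ j, ν j * Q.L j x l k := by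
    ext x
    simp [normalFlux, Matrix.sum_apply]
  rw [this]
  exact .sum _ fun j _ => (BddMeas.const _).mul
    (bddMeas_coeff hs (Q.measurable_L j l k) (fun x hx => Q.bound_L j x hx l k) μ)

theorem bddMeas_bilin {μ : Measure (Space d)} {s : Set (Space d)}
    {B : Space d → Matrix (Fin b) (Fin b) ℝ} {f g : Space d → Fin b → ℝ}
    (hB : ∀ l k, BddMeas μ s (fun x => B x l k)) (hf : ∀ k, BddMeas μ s (fun x => f x k))
    (hg : ∀ k, BddMeas μ s (fun x => g x k)) :
    BddMeas μ s (fun x => (B x).mulVec (f x) ⬝ᵥ g x) := by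
  simp only [dotProduct, Matrix.mulVec]
  exact .sum _ fun l _ => (BddMeas.sum _ fun k _ => (hB l k).mul (hf k)).mul (hg l)

/-- The bilinear form `(u, w) ↦ ∫_s I(u, w) dμ`, for an integrand that is bilinear in `(u, w)`. -/
def integralForm {V : Type} [AddCommGroup V] [Module ℝ V] (μ : Measure (Space d))
    (s : Set (Space d)) (I : V → V → Space d → ℝ) (hI : ∀ u w, IntegrableOn (I u w) s μ)
    (add_left : ∀ u u' w x, I (u + u') w x = I u w x + I u' w x)
    (smul_left : ∀ (r : ℝ) u w x, I (r • u) w x = r * I u w x)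
    (add_right : ∀ u w w' x, I u (w + w') x = I u w x + I u w' x)
    (smul_right : ∀ (r : ℝ) u w x, I u (r • w) x = r * I u w x) :
    LinearMap.BilinForm ℝ V :=
  LinearMap.mk₂ ℝ (fun u w => ∫ x in s, I u w x ∂μ)
    (fun u u' w => by simp only [add_left]; exact integral_add (hI u w) (hI u' w))
    (fun r u w => by simp only [smul_left]; exact integral_const_mul r _)
    (fun u w w' => by simp only [add_right]; exact integral_add (hI u w) (hI u w'))
    (fun r u w => by simp only [smul_right]; exact integral_const_mul r _)

/-! #### The forms -/

/-- The `L²` inner product `(u, w) = ∑_K ∫_K u ⬝ w dx` on the DG space. -/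
def l2Form : LinearMap.BilinForm ℝ (DGSpace T v b p) :=
  ∑ K : ↥(T.patch v), integralForm volume (hull K.1)
    (fun u w x => val K x u ⬝ᵥ val K x w)
    (fun u w => BddMeas.integrableOn (isCompact_hull _).measurableSet (volume_hull_ne_top _)
      (.sum _ fun k _ => (bddMeas_val K K _ u k).mul (bddMeas_val K K _ w k)))
    (by simp) (by simp) (by simp) (by simp)

theorem l2Form_apply (u w : DGSpace T v b p) :
    l2Form u w = ∑ K : ↥(T.patch v), ∫ x in hull K.1, val K x u ⬝ᵥ val K x w := by
  simp [l2Form, integralForm]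

theorem interior_hull_nonempty {K : Finset (Space d)} (hK : K ∈ T.patch v) :
    (interior (hull K)).Nonempty := by
  have h1 := (Finset.mem_filter.1 (Finset.mem_filter.1 hK).1)
  rw [interior_convexHull_nonempty_iff_affineSpan_eq_top]
  have hi := T.complex.indep (T.finite.mem_toFinset.1 h1.1)
  have := hi.affineSpan_eq_top_iff_card_eq_finrank_add_one.2 (by simpa using h1.2)
  simpa using this

theorem l2Form_self_nonneg (u : DGSpace T v b p) : 0 ≤ l2Form u u := by
  rw [l2Form_apply]
  exact Finset.sum_nonneg fun K _ => integral_nonneg fun x =>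
    Finset.sum_nonneg fun k _ => mul_self_nonneg _

theorem eq_zero_of_l2Form_self (u : DGSpace T v b p) (hu : l2Form u u = 0) : u = 0 := by
  rw [l2Form_apply, Finset.sum_eq_zero_iff_of_nonneg (fun K _ => integral_nonneg fun x =>
    Finset.sum_nonneg fun k _ => mul_self_nonneg _)] at hu
  funext K k
  have hK := hu K (Finset.mem_univ _)
  have hc : Continuous fun x => val K x u ⬝ᵥ val K x u :=
    continuous_finsetSum _ fun k _ => (continuous_val K u k).mul (continuous_val K u k)
  have hnn : ∀ x, 0 ≤ val K x u ⬝ᵥ val K x u := fun x =>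
    Finset.sum_nonneg fun k _ => mul_self_nonneg _
  have hzero : ∀ x ∈ interior (hull K.1), val K x u k = 0 := by
    have hint : IntegrableOn (fun x => val K x u ⬝ᵥ val K x u) (hull K.1) volume :=
      hc.continuousOn.integrableOn_compact (isCompact_hull _)
    rw [setIntegral_eq_zero_iff_of_nonneg_ae (ae_of_all _ hnn) hint] at hK
    have hK' := ae_restrict_of_ae_restrict_of_subset (interior_subset (s := hull K.1)) hK
    have := Measure.eqOn_open_of_ae_eq hK' isOpen_interior hc.continuousOn continuousOn_const
    intro x hx
    have h0 : val K x u ⬝ᵥ val K x u = 0 := this hx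
    exact congrFun (dotProduct_self_eq_zero.1 h0) k
  obtain ⟨x₀, hx₀⟩ := interior_hull_nonempty K.2
  have hopen : IsOpen ((WithLp.toLp 2 : (Fin d → ℝ) → Space d) ⁻¹' interior (hull K.1)) :=
    isOpen_interior.preimage (PiLp.continuous_toLp 2 _)
  obtain ⟨ε, hε, hball⟩ := Metric.isOpen_iff.1 hopen x₀.ofLp (by simpa using hx₀)
  apply Subtype.ext
  refine MvPolynomial.funext_set (s := fun i => Metric.ball (x₀ i) ε) (fun i => ?_) ?_
  · rw [Real.ball_eq_Ioo]
    exact Set.Ioo_infinite (by linarith)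
  · intro y hy
    have hy' : y ∈ Metric.ball x₀.ofLp ε := by
      rw [ball_pi _ hε]
      exact hy
    simpa [val] using hzero _ (hball hy')

theorem l2Form_nondegenerate : (l2Form (T := T) (v := v) (b := b) (p := p)).Nondegenerate := by
  constructor
  · intro u hu
    exact eq_zero_of_l2Form_self u (hu u)
  · intro u hu
    exact eq_zero_of_l2Form_self u (hu u)

/-- The operator `B` on the DG space with `(B u, w) = a(u, w)` for all `w`. -/
def opOf (a : LinearMap.BilinForm ℝ (DGSpace T v b p)) : Module.End ℝ (DGSpace T v b p) :=
  LinearMap.BilinForm.symmCompOfNondegenerate a l2Form l2Form_nondegenerate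

theorem l2Form_opOf (a : LinearMap.BilinForm ℝ (DGSpace T v b p)) (u w : DGSpace T v b p) :
    l2Form (opOf a u) w = a u w := by
  simp [opOf]

/-- `(M₀ u, w) = (G u - ∑_j L^(j) u ∂_j φ_bot, w)`. -/
def massForm {g₀ Λ c cmax : ℝ} (Q : HyperbolicSystem d b T.domain g₀ Λ c) (Θ : Tent T v cmax) :
    LinearMap.BilinForm ℝ (DGSpace T v b p) :=
  ∑ K : ↥(T.patch v), integralForm volume (hull K.1)
    (fun u w x =>
      (Q.G x - normalFlux Q.L (elementGrad Θ.bot K) x).mulVec (val K x u) ⬝ᵥ val K x w)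
    (fun u w => BddMeas.integrableOn (isCompact_hull _).measurableSet (volume_hull_ne_top _)
      (bddMeas_bilin
        (fun l k => (bddMeas_coeff (subset_domain_of_mem_patch K.2) (Q.measurable_G l k)
          (fun x hx => Q.bound_G x hx l k) _).sub
            (bddMeas_normalFlux Q (subset_domain_of_mem_patch K.2) _ _ l k))
        (bddMeas_val K K _ u) (bddMeas_val K K _ w)))
    (by simp [Matrix.mulVec_add]) (by simp [Matrix.mulVec_smul]) (by simp) (by simp)

/-- `(M₁ u, w) = (∑_j L^(j) u ∂_j δ, w)`. -/
def massSlopeForm {g₀ Λ c cmax : ℝ} (Q : HyperbolicSystem d b T.domain g₀ Λ c)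
    (Θ : Tent T v cmax) : LinearMap.BilinForm ℝ (DGSpace T v b p) :=
  ∑ K : ↥(T.patch v), integralForm volume (hull K.1)
    (fun u w x => (normalFlux Q.L (elementGrad Θ.height K) x).mulVec (val K x u) ⬝ᵥ val K x w)
    (fun u w => BddMeas.integrableOn (isCompact_hull _).measurableSet (volume_hull_ne_top _)
      (bddMeas_bilin (bddMeas_normalFlux Q (subset_domain_of_mem_patch K.2) _ _)
        (bddMeas_val K K _ u) (bddMeas_val K K _ w)))
    (by simp [Matrix.mulVec_add]) (by simp [Matrix.mulVec_smul]) (by simp) (by simp)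

/-- The volume part `∑_K ∫_K δ ∑_j L^(j) u ⬝ ∂_j w dx` of the DG form. -/
def volumeForm {g₀ Λ c cmax : ℝ} (Q : HyperbolicSystem d b T.domain g₀ Λ c)
    (Θ : Tent T v cmax) : LinearMap.BilinForm ℝ (DGSpace T v b p) :=
  ∑ K : ↥(T.patch v), integralForm volume (hull K.1)
    (fun u w x => Θ.height x * ∑ j, (Q.L j x).mulVec (val K x u) ⬝ᵥ pderivVal K j x w)
    (fun u w => BddMeas.integrableOn (isCompact_hull _).measurableSet (volume_hull_ne_top _)
      (.mul (.of_continuousOn (isCompact_hull _) (Θ.continuousOn_height K.2))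
        (.sum _ fun j _ => bddMeas_bilin
          (fun l k => bddMeas_coeff (subset_domain_of_mem_patch K.2) (Q.measurable_L j l k)
            (fun x hx => Q.bound_L j x hx l k) _)
          (bddMeas_val K K _ u)
          (fun k => .of_continuousOn (isCompact_hull _)
            (continuous_pderivVal K j w k).continuousOn))))
    (by simp [Matrix.mulVec_add, Finset.sum_add_distrib, mul_add])
    (by intros; simp only [map_smul, Matrix.mulVec_smul, smul_dotProduct, smul_eq_mul,
          ← Finset.mul_sum]; ring)
    (by simp [Finset.sum_add_distrib, mul_add])
    (by intros; simp only [map_smul, dotProduct_smul, smul_eq_mul, ← Finset.mul_sum]; ring)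

/-- The facet term `∫_F δ (D {u} - S [u]) ⬝ [w] dS` of the facet `F` between the elements `K` and
`K'`, where the normal `ν` points from `K` to `K'`, `D = ∑_j ν_j L^(j)`, `{u}` is the mean of the
traces of `u` from `K` and `K'`, and `[u]` is the trace from `K'` minus the trace from `K`. -/
def facetForm {g₀ Λ c cmax : ℝ} (Q : HyperbolicSystem d b T.domain g₀ Λ c) (Θ : Tent T v cmax)
    (S : Matrix (Fin b) (Fin b) ℝ) (K K' : ↥(T.patch v)) (F : Finset (Space d))
    (hF : F ⊆ K.1) (hcard : F.card = d) : LinearMap.BilinForm ℝ (DGSpace T v b p) :=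
  integralForm μHE[d - 1] (hull F)
    (fun u w x => Θ.height x *
      (((normalFlux Q.L (outwardNormal K.1 F) x).mulVec ((1 / 2 : ℝ) • (val K' x u + val K x u))
        - S.mulVec (val K' x u - val K x u)) ⬝ᵥ (val K' x w - val K x w)))
    (fun u w => by
      have hsub : hull F ⊆ hull K.1 := convexHull_mono (by exact_mod_cast hF)
      have hval : ∀ (J : ↥(T.patch v)) (u : DGSpace T v b p) (k : Fin b),
          BddMeas μHE[d - 1] (hull F) (fun x => val J x u k) := fun J u k =>
        .of_continuousOn (isCompact_hull _) (continuous_val J u k).continuousOn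
      refine BddMeas.integrableOn (isCompact_hull _).measurableSet (facet_measure_ne_top F hcard)
        (.mul (.of_continuousOn (isCompact_hull _) ((Θ.continuousOn_height K.2).mono hsub)) ?_)
      simp only [sub_dotProduct]
      refine .sub (bddMeas_bilin (bddMeas_normalFlux Q
        (hsub.trans (subset_domain_of_mem_patch K.2)) _ _) (fun k => ?_) (fun k => ?_))
        (bddMeas_bilin (fun l k => .const _) (fun k => ?_) (fun k => ?_))
      · exact (BddMeas.const _).mul ((hval K' u k).add (hval K u k))
      · exact (hval K' w k).sub (hval K w k)
      · exact (hval K' u k).sub (hval K u k)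
      · exact (hval K' w k).sub (hval K w k))
    (by
      intro u u' w x
      simp only [map_add, Matrix.mulVec_add, Matrix.mulVec_sub, Matrix.mulVec_smul, smul_add,
        add_dotProduct, sub_dotProduct, smul_dotProduct, smul_eq_mul]
      ring)
    (by
      intro r u w x
      simp only [map_smul, Matrix.mulVec_add, Matrix.mulVec_sub, Matrix.mulVec_smul, smul_add,
        add_dotProduct, sub_dotProduct, smul_dotProduct, smul_eq_mul]
      ring)
    (by
      intro u w w' x
      simp only [map_add, dotProduct_add, dotProduct_sub]
      ring)
    (by
      intro r u w x
      simp only [map_smul, dotProduct_smul, dotProduct_sub, smul_eq_mul]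
      ring)

open Classical in
/-- The DG form `(A u, w)`: the volume part plus the sum of the facet terms over the interior
facets of the patch (`δ` vanishes on the other facets). The sum runs over all ordered pairs of
elements that share a facet; the facet term does not change when the pair is swapped, hence the
factor `1/2`. -/
def dgForm {g₀ Λ c cmax : ℝ} (Q : HyperbolicSystem d b T.domain g₀ Λ c) (Θ : Tent T v cmax)
    (S : Matrix (Fin b) (Fin b) ℝ) : LinearMap.BilinForm ℝ (DGSpace T v b p) :=
  volumeForm Q Θ + (1 / 2 : ℝ) • ∑ K : ↥(T.patch v), ∑ K' : ↥(T.patch v),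
    if h : K ≠ K' ∧ (K.1 ∩ K'.1).card = d then
      facetForm Q Θ S K K' (K.1 ∩ K'.1) Finset.inter_subset_left h.2
    else 0

end Forms

/-! ### Structure-aware Taylor timestepping -/

section SAT

variable {V : Type} [AddCommGroup V] [Module ℝ V]

/-- `X_0 = I` and `X_i = τ M₀⁻¹ (A + i M₁) X_{i-1}`. -/
def satX (M₀ M₁ A : Module.End ℝ V) (τ : ℝ) : ℕ → Module.End ℝ V
  | 0 => 1
  | i + 1 => τ • (Ring.inverse M₀ * (A + ((i : ℝ) + 1) • M₁) * satX M₀ M₁ A τ i)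

/-- The SAT step of order `s` and size `τ`:
`R_s = ∑_{i < s} X_i / i! + M⁻¹ M₀ X_s / s!` with `M = M₀ - τ M₁`. -/
def satStep (M₀ M₁ A : Module.End ℝ V) (τ : ℝ) (s : ℕ) : Module.End ℝ V :=
  ∑ i ∈ Finset.range s, (i.factorial : ℝ)⁻¹ • satX M₀ M₁ A τ i +
    Ring.inverse (M₀ - τ • M₁) * M₀ * ((s.factorial : ℝ)⁻¹ • satX M₀ M₁ A τ s)

end SAT

section Operators

variable {d : ℕ} {T : Mesh d} {v : Space d} {b : ℕ} {g₀ Λ c cmax : ℝ}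

/-- The operator `M(t) = M₀ - t M₁` at pseudotime `t`. -/
def massOp (Q : HyperbolicSystem d b T.domain g₀ Λ c) (Θ : Tent T v cmax) (p : ℕ) (t : ℝ) :
    Module.End ℝ (DGSpace T v b p) :=
  opOf (massForm Q Θ) - t • opOf (massSlopeForm Q Θ)

/-- The propagator `R_s` of the subtent from pseudotime `t` to `t + τ`. -/
def propagator (Q : HyperbolicSystem d b T.domain g₀ Λ c) (Θ : Tent T v cmax)
    (S : Matrix (Fin b) (Fin b) ℝ) (p s : ℕ) (t τ : ℝ) : Module.End ℝ (DGSpace T v b p) :=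
  satStep (massOp Q Θ p t) (opOf (massSlopeForm Q Θ)) (opOf (dgForm Q Θ S)) τ s

/-- `B` is selfadjoint and positive definite with respect to the `L²` inner product. -/
def IsPosDefOp {p : ℕ} (B : Module.End ℝ (DGSpace T v b p)) : Prop :=
  (∀ u w, l2Form (B u) w = l2Form u (B w)) ∧ ∀ u, u ≠ 0 → 0 < l2Form (B u) u

/-- The norm `‖u‖_B = (B u, u)^{1/2}` for a selfadjoint positive definite operator `B`. -/
def energyNorm {p : ℕ} (B : Module.End ℝ (DGSpace T v b p)) (u : DGSpace T v b p) : ℝ :=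
  √(l2Form (B u) u)

end Operators

end SATTent

end

/-! The step is compared with the Taylor polynomial w of degree s of the solution of ((M - r M₁) u)'
= A u, u(0) = v, where M = M(t). Along the exact flow the energy ((M - r M₁) u, u) has derivative 2
(A u, u) + (M₁ u, u), which is nonpositive for this discretization. The polynomial w solves the
equation up to a residual of order r^s (`residual_taylorPoly`), so its energy grows by at most
O(τ^(s+1)) over the step. The SAT step differs from w(τ) by τ^(s+1) M(t+τ)⁻¹ M₁ a, with a the last
Taylor coefficient (`satStep_apply`), which costs another O(τ^(s+1)). `satStep_stable` combines the
two; its constant depends only on s, a lower bound for M(t) and M(t+τ), and an L² bound for M₁ and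
A. Three facts about tents remain.

Coercivity (`massOp_coercive`): M(t) belongs to the front φ_bot + t δ, whose slope is at most 1/cmax
by convexity. The wave speed bound is a bound for a generalized eigenvalue problem, hence for
quadratic forms, and leaves the fraction 1 - c/cmax of G.

Boundedness (`exists_form_bound`): M₁ only sees the bounded gradient of δ. In A, a derivative or a
facet trace costs a factor 1/h by inverse estimates, and δ = O(h) pays for it.

Dissipation (`dgForm_dissipative`): integration by parts on each element against δ u_k u_l turns 2
(A u, u) + (M₁ u, u) into facet terms. Since δ vanishes on the facet opposite the vertex, and every
facet through an interior vertex has exactly two elements with opposite normals, the central fluxes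
cancel and only the nonpositive contribution of S is left. -/

namespace SATTent

/-! ### Energy estimate for the SAT step with abstract operators -/

section TimeStepping

open scoped InnerProductSpace

variable {V : Type} [NormedAddCommGroup V] [InnerProductSpace ℝ V]

theorem isUnit_of_coercive [FiniteDimensional ℝ V] {M : Module.End ℝ V} {m : ℝ} (hm : 0 < m)
    (hM : ∀ u, m * ‖u‖ ^ 2 ≤ ⟪M u, u⟫_ℝ) : IsUnit M := by
  rw [LinearMap.isUnit_iff_ker_eq_bot, LinearMap.ker_eq_bot']
  intro u hu
  have h := hM u
  rw [hu, inner_zero_left] at h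
  have : ‖u‖ ^ 2 ≤ 0 := by
    by_contra! h'
    exact absurd h (not_le.2 (mul_pos hm h'))
  simpa using this

/-- The Taylor coefficients `u^(i) / i!` of the solution of `((M - t M₁) u)' = A u`. -/
noncomputable def taylorCoeff (M M₁ A : Module.End ℝ V) (v : V) : ℕ → V
  | 0 => v
  | i + 1 => ((i : ℝ) + 1)⁻¹ • Ring.inverse M ((A + ((i : ℝ) + 1) • M₁) (taylorCoeff M M₁ A v i))

theorem satX_apply (M M₁ A : Module.End ℝ V) (τ : ℝ) (v : V) (i : ℕ) :
    satX M M₁ A τ i v = ((i.factorial : ℝ) * τ ^ i) • taylorCoeff M M₁ A v i := by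
  induction i with
  | zero => simp [satX, taylorCoeff]
  | succ i ih =>
    have hi : (i : ℝ) + 1 ≠ 0 := by positivity
    simp only [satX, taylorCoeff, LinearMap.smul_apply, Module.End.mul_apply, ih, map_smul,
      smul_smul, Nat.factorial_succ]
    congr 1
    push_cast
    field_simp
    ring

/-- Comparison of the coefficients of r^i in (M - r M₁) u' = M₁ u + A u: the term r M₁ u'
contributes i copies of M₁ and the right side one more, whence the factor i + 1. -/
theorem apply_taylorCoeff_succ {M M₁ A : Module.End ℝ V} (hM : IsUnit M) (v : V) (i : ℕ) :
    ((i : ℝ) + 1) • M (taylorCoeff M M₁ A v (i + 1)) =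
      (A + ((i : ℝ) + 1) • M₁) (taylorCoeff M M₁ A v i) := by
  have hi : (i : ℝ) + 1 ≠ 0 := by positivity
  simp only [taylorCoeff, map_smul, smul_smul, mul_inv_cancel₀ hi, one_smul]
  rw [← Module.End.mul_apply, Ring.mul_inverse_cancel _ hM, Module.End.one_apply]

/-- Pairing the recurrence with the new coefficient leaves i + 1 on both sides, so it cancels and
the growth ratio 2K/m does not depend on i. The term with `A` lacks this factor, but 1 ≤ i + 1. -/
theorem norm_taylorCoeff_le {M M₁ A : Module.End ℝ V} (hU : IsUnit M) {m K : ℝ} (hm : 0 < m)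
    (hK : 0 ≤ K) (hM : ∀ u, m * ‖u‖ ^ 2 ≤ ⟪M u, u⟫_ℝ)
    (hM₁ : ∀ u w, |⟪M₁ u, w⟫_ℝ| ≤ K * ‖u‖ * ‖w‖) (hA : ∀ u w, |⟪A u, w⟫_ℝ| ≤ K * ‖u‖ * ‖w‖)
    (v : V) (i : ℕ) : ‖taylorCoeff M M₁ A v i‖ ≤ (2 * K / m) ^ i * ‖v‖ := by
  induction i with
  | zero => simp [taylorCoeff]
  | succ i ih =>
    set a := taylorCoeff M M₁ A v i
    set a' := taylorCoeff M M₁ A v (i + 1) with ha'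
    have h0 : ((i : ℝ) + 1) * ⟪M a', a'⟫_ℝ = ⟪A a, a'⟫_ℝ + ((i : ℝ) + 1) * ⟪M₁ a, a'⟫_ℝ := by
      rw [← real_inner_smul_left, apply_taylorCoeff_succ hU, LinearMap.add_apply,
        LinearMap.smul_apply, inner_add_left, real_inner_smul_left]
    have h1 := (le_abs_self _).trans (hA a a')
    have h2 := (le_abs_self _).trans (hM₁ a a')
    have hi : (0 : ℝ) ≤ i := by positivity
    have hn : 0 ≤ K * ‖a‖ * ‖a'‖ := by positivity
    have h3 : ((i : ℝ) + 1) * (m * ‖a'‖ ^ 2) ≤ ((i : ℝ) + 1) * (2 * K * ‖a‖ * ‖a'‖) := by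
      have := mul_le_mul_of_nonneg_left (hM a') (by positivity : (0 : ℝ) ≤ i + 1)
      nlinarith [mul_le_mul_of_nonneg_left h2 (by positivity : (0 : ℝ) ≤ i + 1)]
    have h4 : m * ‖a'‖ ^ 2 ≤ 2 * K * ‖a‖ * ‖a'‖ :=
      le_of_mul_le_mul_left h3 (by positivity)
    have h5 : m * ‖a'‖ ≤ 2 * K * ‖a‖ := by
      rcases (norm_nonneg a').eq_or_lt with h | h
      · rw [← h, mul_zero]; positivity
      · refine le_of_mul_le_mul_right ?_ h
        nlinarith
    calc ‖a'‖ ≤ 2 * K / m * ‖a‖ := by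
          rw [div_mul_eq_mul_div, le_div_iff₀ hm]
          linarith
      _ ≤ 2 * K / m * ((2 * K / m) ^ i * ‖v‖) := by gcongr
      _ = _ := by ring

/-- The Taylor polynomial of degree `s` of the solution. -/
noncomputable def taylorPoly (M M₁ A : Module.End ℝ V) (v : V) (s : ℕ) (r : ℝ) : V :=
  ∑ i ∈ Finset.range (s + 1), r ^ i • taylorCoeff M M₁ A v i

/-- The derivative of `taylorPoly`. -/
noncomputable def taylorPolyDeriv (M M₁ A : Module.End ℝ V) (v : V) (s : ℕ) (r : ℝ) : V :=
  ∑ i ∈ Finset.range (s + 1), ((i : ℝ) * r ^ (i - 1)) • taylorCoeff M M₁ A v i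

theorem hasDerivAt_taylorPoly (M M₁ A : Module.End ℝ V) (v : V) (s : ℕ) (r : ℝ) :
    HasDerivAt (taylorPoly M M₁ A v s) (taylorPolyDeriv M M₁ A v s r) r := by
  unfold taylorPoly taylorPolyDeriv
  exact HasDerivAt.fun_sum fun i _ => (hasDerivAt_pow i r).smul_const _

theorem taylorPoly_zero (M M₁ A : Module.End ℝ V) (v : V) (s : ℕ) :
    taylorPoly M M₁ A v s 0 = v := by
  simp [taylorPoly, Finset.sum_range_succ', taylorCoeff]

/-- The Taylor polynomial solves the evolution equation up to a residual of order `r ^ s`. -/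
theorem residual_taylorPoly {M : Module.End ℝ V} (M₁ A : Module.End ℝ V) (hM : IsUnit M) (v : V)
    (s : ℕ) (r : ℝ) :
    (M - r • M₁) (taylorPolyDeriv M M₁ A v s r) =
      M₁ (taylorPoly M M₁ A v s r) + A (taylorPoly M M₁ A v s r) -
        r ^ s • (A + ((s : ℝ) + 1) • M₁) (taylorCoeff M M₁ A v s) := by
  induction s with
  | zero => simp [taylorPoly, taylorPolyDeriv]; abel
  | succ s ih =>
    have h1 : taylorPoly M M₁ A v (s + 1) r =
      taylorPoly M M₁ A v s r + r ^ (s + 1) • taylorCoeff M M₁ A v (s + 1) := by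
      simp [taylorPoly, Finset.sum_range_succ _ (s + 1)]
    have h2 : taylorPolyDeriv M M₁ A v (s + 1) r =
      taylorPolyDeriv M M₁ A v s r +
        (((s : ℝ) + 1) * r ^ s) • taylorCoeff M M₁ A v (s + 1) := by
      simp [taylorPolyDeriv, Finset.sum_range_succ _ (s + 1)]
    -- By the recurrence, `M` applied to the derivative of the new term cancels the old residual;
    -- its `M₁` part and the new term on the right combine into the next residual.
    rw [h1, h2, map_add, ih, ← apply_taylorCoeff_succ hM]
    simp only [map_smul, LinearMap.sub_apply, LinearMap.smul_apply, map_add, LinearMap.add_apply]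
    push_cast
    module

theorem norm_taylorPoly_le {M M₁ A : Module.End ℝ V} {ρ : ℝ} {v : V}
    (h : ∀ i, ‖taylorCoeff M M₁ A v i‖ ≤ ρ ^ i * ‖v‖) (s : ℕ) {r : ℝ} (hr : 0 ≤ r)
    (hr1 : r ≤ 1) :
    ‖taylorPoly M M₁ A v s r‖ ≤ (∑ i ∈ Finset.range (s + 1), ρ ^ i) * ‖v‖ := by
  rw [Finset.sum_mul]
  refine norm_sum_le_of_le _ fun i _ => ?_
  rw [norm_smul, Real.norm_of_nonneg (by positivity)]
  calc _ ≤ 1 * ‖taylorCoeff M M₁ A v i‖ := by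
        gcongr
        exact pow_le_one₀ hr hr1
    _ ≤ _ := by simpa using h i

/-- Since (M - τ M₁)⁻¹ M = I + τ (M - τ M₁)⁻¹ M₁, the modified last stage is the last Taylor term
plus a correction of the order of the local error. -/
theorem satStep_apply {M M₁ : Module.End ℝ V} (A : Module.End ℝ V) {τ : ℝ}
    (hM : IsUnit (M - τ • M₁)) (s : ℕ) (v : V) :
    satStep M M₁ A τ s v = taylorPoly M M₁ A v s τ +
      τ ^ (s + 1) • Ring.inverse (M - τ • M₁) (M₁ (taylorCoeff M M₁ A v s)) := by
  have hX : ∀ i, ((i.factorial : ℝ)⁻¹ • satX M M₁ A τ i) v = τ ^ i • taylorCoeff M M₁ A v i := by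
    intro i
    have : (i.factorial : ℝ) ≠ 0 := by positivity
    rw [LinearMap.smul_apply, satX_apply, smul_smul, ← mul_assoc, inv_mul_cancel₀ this, one_mul]
  have hinv : ∀ x, Ring.inverse (M - τ • M₁) (M x) =
      x + τ • Ring.inverse (M - τ • M₁) (M₁ x) := by
    intro x
    have h := congrArg (fun B : Module.End ℝ V => B x) (Ring.inverse_mul_cancel _ hM)
    simp only [Module.End.mul_apply, Module.End.one_apply, LinearMap.sub_apply,
      LinearMap.smul_apply, map_sub, map_smul] at h
    rw [← sub_eq_iff_eq_add]
    exact h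
  simp only [satStep, LinearMap.add_apply, LinearMap.sum_apply, Module.End.mul_apply]
  simp only [hX, map_smul, hinv, taylorPoly, Finset.sum_range_succ]
  module

/-- Weak stability of the SAT step for operators that are bounded by `K`, with a mass operator that
is bounded below by `m`. -/
theorem satStep_stable (m K : ℝ) (hm : 0 < m) (hK : 0 ≤ K) (s : ℕ) :
    ∃ C : ℝ, 0 ≤ C ∧ ∀ (V : Type) [NormedAddCommGroup V] [InnerProductSpace ℝ V]
      [FiniteDimensional ℝ V] (M M₁ A : Module.End ℝ V) (τ : ℝ), 0 ≤ τ → τ ≤ 1 →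
      (∀ u w, ⟪M u, w⟫_ℝ = ⟪u, M w⟫_ℝ) → (∀ u w, ⟪M₁ u, w⟫_ℝ = ⟪u, M₁ w⟫_ℝ) →
      (∀ u, m * ‖u‖ ^ 2 ≤ ⟪M u, u⟫_ℝ) → (∀ u, m * ‖u‖ ^ 2 ≤ ⟪(M - τ • M₁) u, u⟫_ℝ) →
      (∀ u w, |⟪M₁ u, w⟫_ℝ| ≤ K * ‖u‖ * ‖w‖) → (∀ u w, |⟪A u, w⟫_ℝ| ≤ K * ‖u‖ * ‖w‖) →
      (∀ u, 2 * ⟪A u, u⟫_ℝ + ⟪M₁ u, u⟫_ℝ ≤ 0) →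
      ∀ v, ⟪(M - τ • M₁) (satStep M M₁ A τ s v), satStep M M₁ A τ s v⟫_ℝ ≤
        (1 + C * τ ^ (s + 1)) * ⟪M v, v⟫_ℝ := by
  set ρ := 2 * K / m with hρ
  have hρ0 : 0 ≤ ρ := by positivity
  set W := ∑ i ∈ Finset.range (s + 1), ρ ^ i with hW
  have hW0 : 0 ≤ W := Finset.sum_nonneg fun i _ => by positivity
  -- `c₁` measures the residual along the Taylor polynomial (s + 2 counts `A` once and `M₁` s + 1
  -- times); `c₂` measures the cross and quadratic terms of the last-stage correction. Division by m
  -- converts ‖v‖² into the energy of v.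
  set c₁ := 2 * (((s : ℝ) + 2) * K * ρ ^ s * W) with hc₁
  set c₂ := 2 * (K * ρ ^ s * W) + K * ρ ^ s * (K / m * ρ ^ s) with hc₂
  refine ⟨(c₁ + c₂) / m, by positivity, ?_⟩
  intro V _ _ _ M M₁ A τ hτ hτ1 hMs hM₁s hMc hMτc hM₁ hA hdiss v
  have hU := isUnit_of_coercive hm hMc
  have hUτ := isUnit_of_coercive hm hMτc
  have hcoef := norm_taylorCoeff_le hU hm hK hMc hM₁ hA v
  set a := taylorCoeff M M₁ A v s
  set w := taylorPoly M M₁ A v s with hw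
  set w' := taylorPolyDeriv M M₁ A v s with hw'
  have hwn : ∀ r, 0 ≤ r → r ≤ 1 → ‖w r‖ ≤ W * ‖v‖ := fun r h0 h1 =>
    norm_taylorPoly_le hcoef s h0 h1
  have han : ‖a‖ ≤ ρ ^ s * ‖v‖ := hcoef s
  -- the energy along the Taylor polynomial
  let E : ℝ → ℝ := fun r => ⟪M (w r), w r⟫_ℝ - r * ⟪M₁ (w r), w r⟫_ℝ
  -- The residual identity contributes 2 (M₁ w, w), and differentiating the weight M - r M₁ takes
  -- away (M₁ w, w); what is left is the dissipation form and the residual.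
  have hE : ∀ r, HasDerivAt E (2 * ⟪A (w r), w r⟫_ℝ + ⟪M₁ (w r), w r⟫_ℝ -
      2 * (r ^ s * ⟪(A + ((s : ℝ) + 1) • M₁) a, w r⟫_ℝ)) r := by
    intro r
    have hd := hasDerivAt_taylorPoly M M₁ A v s r
    have hop : ∀ B : Module.End ℝ V, HasDerivAt (fun r => B (w r)) (B (w' r)) r := fun B =>
      (LinearMap.toContinuousLinearMap B).hasFDerivAt.comp_hasDerivAt r hd
    have h := ((hop M).inner ℝ hd).sub ((hasDerivAt_id r).mul ((hop M₁).inner ℝ hd))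
    refine h.congr_deriv ?_
    have hres := congrArg (fun x => ⟪x, w r⟫_ℝ) (residual_taylorPoly M₁ A hU v s r)
    simp only [LinearMap.sub_apply, LinearMap.smul_apply, inner_sub_left, inner_add_left,
      real_inner_smul_left] at hres
    rw [← hw, ← hw'] at hres
    have e1 : ⟪M (w r), w' r⟫_ℝ = ⟪M (w' r), w r⟫_ℝ := by rw [hMs, real_inner_comm]
    have e2 : ⟪M₁ (w r), w' r⟫_ℝ = ⟪M₁ (w' r), w r⟫_ℝ := by rw [hM₁s, real_inner_comm]
    have e3 : taylorPoly M M₁ A v s r = w r := rfl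
    have e4 : taylorPolyDeriv M M₁ A v s r = w' r := rfl
    simp only [id, e1, e2, e3, e4]
    linarith
  have hE0 : E 0 = ⟪M v, v⟫_ℝ := by simp [E, hw, taylorPoly_zero]
  have hres : ∀ r, 0 ≤ r → r ≤ 1 →
      |⟪(A + ((s : ℝ) + 1) • M₁) a, w r⟫_ℝ| ≤ ((s : ℝ) + 2) * K * ρ ^ s * W * ‖v‖ ^ 2 := by
    intro r h0 h1
    rw [LinearMap.add_apply, LinearMap.smul_apply, inner_add_left, real_inner_smul_left]
    have hs1 : (0 : ℝ) ≤ s + 1 := by positivity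
    calc _ ≤ |⟪A a, w r⟫_ℝ| + ((s : ℝ) + 1) * |⟪M₁ a, w r⟫_ℝ| := by
          refine (abs_add_le _ _).trans ?_
          rw [abs_mul, abs_of_nonneg hs1]
      _ ≤ K * ‖a‖ * ‖w r‖ + ((s : ℝ) + 1) * (K * ‖a‖ * ‖w r‖) := by
          gcongr
          · exact hA _ _
          · exact hM₁ _ _
      _ = ((s : ℝ) + 2) * K * (‖a‖ * ‖w r‖) := by ring
      _ ≤ ((s : ℝ) + 2) * K * ((ρ ^ s * ‖v‖) * (W * ‖v‖)) := by
          gcongr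
          exact hwn r h0 h1
      _ = _ := by ring
  have hEτ : E τ ≤ ⟪M v, v⟫_ℝ + c₁ * τ ^ (s + 1) * ‖v‖ ^ 2 := by
    -- On [0, τ] the dissipation form is dropped and r^s is replaced by τ^s, so integrating the
    -- derivative bound adds the missing power of τ.
    have hmv := (convex_Icc (0 : ℝ) τ).image_sub_le_mul_sub_of_deriv_le
      (f := E) (C := c₁ * τ ^ s * ‖v‖ ^ 2)
      (fun r _ => (hE r).continuousAt.continuousWithinAt)
      (fun r _ => (hE r).differentiableAt.differentiableWithinAt)
      (fun r hr => by
        rw [interior_Icc] at hr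
        rw [(hE r).deriv]
        have h1 := hdiss (w r)
        have h2 := (neg_le_abs _).trans (hres r hr.1.le (hr.2.le.trans hτ1))
        have h3 : r ^ s ≤ τ ^ s := pow_le_pow_left₀ hr.1.le hr.2.le s
        have h4 : 0 ≤ r ^ s := pow_nonneg hr.1.le s
        have h5 := mul_le_mul_of_nonneg_left h2 h4
        have h6 : r ^ s * (((s : ℝ) + 2) * K * ρ ^ s * W * ‖v‖ ^ 2) ≤
          τ ^ s * (((s : ℝ) + 2) * K * ρ ^ s * W * ‖v‖ ^ 2) := by gcongr
        rw [hc₁]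
        nlinarith)
      0 (Set.left_mem_Icc.2 hτ) τ (Set.right_mem_Icc.2 hτ) hτ
    rw [hE0] at hmv
    have : c₁ * τ ^ s * ‖v‖ ^ 2 * (τ - 0) = c₁ * τ ^ (s + 1) * ‖v‖ ^ 2 := by ring
    linarith
  -- the correction in the last stage
  set e := Ring.inverse (M - τ • M₁) (M₁ a) with he
  have hMe : (M - τ • M₁) e = M₁ a := by
    rw [he, ← Module.End.mul_apply, Ring.mul_inverse_cancel _ hUτ, Module.End.one_apply]
  have hen : ‖e‖ ≤ K / m * ‖a‖ := by
    have h := hMτc e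
    rw [hMe] at h
    have h' := h.trans ((le_abs_self _).trans (hM₁ a e))
    rcases (norm_nonneg e).eq_or_lt with h0 | h0
    · rw [← h0]; positivity
    · rw [div_mul_eq_mul_div, le_div_iff₀ hm]
      refine le_of_mul_le_mul_right ?_ h0
      linarith
  -- Selfadjointness moves M - τ M₁ onto `e`, where it cancels the inverse.
  have hsymm : ⟪(M - τ • M₁) (w τ), e⟫_ℝ = ⟪M₁ a, w τ⟫_ℝ := by
    rw [← hMe, LinearMap.sub_apply, LinearMap.sub_apply, LinearMap.smul_apply,
      LinearMap.smul_apply, inner_sub_left, inner_sub_left, real_inner_smul_left,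
      real_inner_smul_left, hMs, hM₁s, real_inner_comm, real_inner_comm (M₁ e)]
  have hstep := satStep_apply A hUτ s v
  have hfull : ⟪(M - τ • M₁) (satStep M M₁ A τ s v), satStep M M₁ A τ s v⟫_ℝ =
      E τ + 2 * τ ^ (s + 1) * ⟪M₁ a, w τ⟫_ℝ + (τ ^ (s + 1)) ^ 2 * ⟪M₁ a, e⟫_ℝ := by
    have hEe : E τ = ⟪(M - τ • M₁) (w τ), w τ⟫_ℝ := by
      simp [E, inner_sub_left, real_inner_smul_left]
    rw [hstep, ← he, map_add, map_smul, hMe, inner_add_left, inner_add_right, inner_add_right,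
      real_inner_smul_left, real_inner_smul_right, real_inner_smul_left, real_inner_smul_right,
      hsymm, hEe]
    ring
  have hτs : 0 ≤ τ ^ (s + 1) := by positivity
  have hτs1 : τ ^ (s + 1) ≤ 1 := pow_le_one₀ hτ hτ1
  have hcross : ⟪M₁ a, w τ⟫_ℝ ≤ K * ρ ^ s * W * ‖v‖ ^ 2 :=
    calc _ ≤ K * ‖a‖ * ‖w τ‖ := (le_abs_self _).trans (hM₁ _ _)
      _ ≤ K * (ρ ^ s * ‖v‖) * (W * ‖v‖) := by
        gcongr
        exact hwn τ hτ hτ1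
      _ = _ := by ring
  have hquad : ⟪M₁ a, e⟫_ℝ ≤ K * ρ ^ s * (K / m * ρ ^ s) * ‖v‖ ^ 2 :=
    calc _ ≤ K * ‖a‖ * ‖e‖ := (le_abs_self _).trans (hM₁ _ _)
      _ ≤ K * (ρ ^ s * ‖v‖) * (K / m * (ρ ^ s * ‖v‖)) := by
        gcongr
        exact hen.trans (by gcongr)
      _ = _ := by ring
  have hvn : ‖v‖ ^ 2 ≤ ⟪M v, v⟫_ℝ / m := by
    rw [le_div_iff₀ hm]
    linarith [hMc v]
  rw [hfull]
  calc _ ≤ (⟪M v, v⟫_ℝ + c₁ * τ ^ (s + 1) * ‖v‖ ^ 2) +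
        2 * τ ^ (s + 1) * (K * ρ ^ s * W * ‖v‖ ^ 2) +
        τ ^ (s + 1) * (K * ρ ^ s * (K / m * ρ ^ s) * ‖v‖ ^ 2) := by
        -- The square of the correction has order 2 (s + 1); because τ ≤ 1 it is absorbed in order s
        -- + 1.
        have hsq : (τ ^ (s + 1)) ^ 2 * (K * ρ ^ s * (K / m * ρ ^ s) * ‖v‖ ^ 2) ≤
            τ ^ (s + 1) * (K * ρ ^ s * (K / m * ρ ^ s) * ‖v‖ ^ 2) := by
          refine mul_le_mul_of_nonneg_right ?_ (by positivity)
          rw [sq]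
          exact mul_le_of_le_one_right hτs hτs1
        have := mul_le_mul_of_nonneg_left hcross (by positivity : 0 ≤ 2 * τ ^ (s + 1))
        have := mul_le_mul_of_nonneg_left hquad (by positivity : 0 ≤ (τ ^ (s + 1)) ^ 2)
        linarith
    _ = ⟪M v, v⟫_ℝ + (c₁ + c₂) * τ ^ (s + 1) * ‖v‖ ^ 2 := by rw [hc₂]; ring
    _ ≤ ⟪M v, v⟫_ℝ + (c₁ + c₂) * τ ^ (s + 1) * (⟪M v, v⟫_ℝ / m) := by gcongr
    _ = _ := by ring

end TimeStepping

/-! ### Quadratic forms and generalized eigenvalues -/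

section Matrices

variable {b : ℕ}

theorem mulVec_dotProduct_comm {B : Matrix (Fin b) (Fin b) ℝ} (hB : B.IsSymm)
    (ξ η : Fin b → ℝ) : B.mulVec ξ ⬝ᵥ η = B.mulVec η ⬝ᵥ ξ := by
  rw [dotProduct_comm, Matrix.dotProduct_mulVec, ← Matrix.mulVec_transpose, hB.eq]

theorem continuous_quadratic (B : Matrix (Fin b) (Fin b) ℝ) :
    Continuous fun ξ : Fin b → ℝ => B.mulVec ξ ⬝ᵥ ξ := by
  simp only [dotProduct, Matrix.mulVec]
  fun_prop

theorem quadratic_smul (B : Matrix (Fin b) (Fin b) ℝ) (r : ℝ) (ξ : Fin b → ℝ) :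
    B.mulVec (r • ξ) ⬝ᵥ (r • ξ) = r ^ 2 * (B.mulVec ξ ⬝ᵥ ξ) := by
  simp only [Matrix.mulVec_smul, smul_dotProduct, dotProduct_smul, smul_eq_mul]
  ring

/-- A bound for the generalized eigenvalues of `B ξ = lam G ξ` bounds the quadratic form of `B` by
that of `G`. -/
theorem quadratic_le_of_eigenvalue_le {G B : Matrix (Fin b) (Fin b) ℝ} (hG : G.IsSymm)
    (hB : B.IsSymm) {g₀ c : ℝ} (hg₀ : 0 < g₀) (hpos : ∀ ξ, g₀ * (ξ ⬝ᵥ ξ) ≤ G.mulVec ξ ⬝ᵥ ξ)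
    (hc : ∀ (lam : ℝ) (ξ : Fin b → ℝ), ξ ≠ 0 → B.mulVec ξ = lam • G.mulVec ξ → lam ≤ c)
    (ξ : Fin b → ℝ) : B.mulVec ξ ⬝ᵥ ξ ≤ c * (G.mulVec ξ ⬝ᵥ ξ) := by
  rcases eq_or_ne ξ 0 with rfl | hξ
  · simp
  have hdot : ∀ η : Fin b → ℝ, η ≠ 0 → 0 < η ⬝ᵥ η := fun η hη =>
    lt_of_le_of_ne (Finset.sum_nonneg fun _ _ => mul_self_nonneg _)
      (fun h => hη (dotProduct_self_eq_zero.1 h.symm))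
  have hGpos : ∀ η : Fin b → ℝ, η ≠ 0 → 0 < G.mulVec η ⬝ᵥ η := fun η hη =>
    (mul_pos hg₀ (hdot η hη)).trans_le (hpos η)
  have hne : ∀ η ∈ Metric.sphere (0 : Fin b → ℝ) 1, η ≠ 0 := by
    rintro η hη rfl
    simp at hη
  have hmem : ∀ η : Fin b → ℝ, η ≠ 0 → ‖η‖⁻¹ • η ∈ Metric.sphere (0 : Fin b → ℝ) 1 := by
    intro η hη
    rw [mem_sphere_zero_iff_norm, norm_smul, norm_inv, norm_norm,
      inv_mul_cancel₀ (norm_ne_zero_iff.2 hη)]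
  -- The Rayleigh quotient attains its maximum `lam` on the compact unit sphere; by homogeneity
  -- `lam` bounds it everywhere.
  obtain ⟨η, hη, hmax⟩ := (isCompact_sphere (0 : Fin b → ℝ) 1).exists_isMaxOn ⟨_, hmem ξ hξ⟩
    (f := fun η => (B.mulVec η ⬝ᵥ η) / (G.mulVec η ⬝ᵥ η))
    ((continuous_quadratic B).continuousOn.div (continuous_quadratic G).continuousOn
      fun η hη => (hGpos η (hne η hη)).ne')
  set lam := (B.mulVec η ⬝ᵥ η) / (G.mulVec η ⬝ᵥ η) with hlam
  have hquot : ∀ ζ : Fin b → ℝ, B.mulVec ζ ⬝ᵥ ζ ≤ lam * (G.mulVec ζ ⬝ᵥ ζ) := by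
    intro ζ
    rcases eq_or_ne ζ 0 with rfl | hζ
    · simp
    have h : B.mulVec (‖ζ‖⁻¹ • ζ) ⬝ᵥ (‖ζ‖⁻¹ • ζ) / (G.mulVec (‖ζ‖⁻¹ • ζ) ⬝ᵥ (‖ζ‖⁻¹ • ζ)) ≤ lam :=
      hmax (hmem ζ hζ)
    have hr : (‖ζ‖⁻¹) ^ 2 ≠ 0 := by
      have := norm_ne_zero_iff.2 hζ
      positivity
    rw [quadratic_smul, quadratic_smul, mul_div_mul_left _ _ hr, div_le_iff₀ (hGpos ζ hζ)] at h
    exact h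
  have hpsd : (lam • G - B).PosSemidef := by
    rw [Matrix.posSemidef_iff_dotProduct_mulVec]
    refine ⟨?_, fun ζ => ?_⟩
    · rw [Matrix.IsHermitian, Matrix.conjTranspose_eq_transpose_of_trivial]
      exact (hG.smul lam).sub hB
    · have := hquot ζ
      rw [dotProduct_comm, star_trivial, Matrix.sub_mulVec, sub_dotProduct, Matrix.smul_mulVec,
        smul_dotProduct, smul_eq_mul]
      linarith
  -- A positive semidefinite matrix annihilates each vector on which its form vanishes. Thus the
  -- maximizer is a generalized eigenvector, and the hypothesis applies to `lam`.
  have hker : (lam • G - B).mulVec η = 0 := by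
    rw [← hpsd.dotProduct_mulVec_zero_iff, dotProduct_comm, star_trivial, Matrix.sub_mulVec,
      sub_dotProduct, Matrix.smul_mulVec, smul_dotProduct, smul_eq_mul, hlam,
      div_mul_cancel₀ _ (hGpos η (hne η hη)).ne', sub_self]
  rw [Matrix.sub_mulVec, sub_eq_zero, Matrix.smul_mulVec] at hker
  exact (hquot ξ).trans (mul_le_mul_of_nonneg_right (hc lam η (hne η hη) hker.symm)
    (hGpos ξ hξ).le)

theorem abs_bilin_le {B : Matrix (Fin b) (Fin b) ℝ} {Λ P R : ℝ} (hB : ∀ l k, |B l k| ≤ Λ)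
    {f g : Fin b → ℝ} (hf : ∀ k, |f k| ≤ P) (hg : ∀ k, |g k| ≤ R) :
    |B.mulVec f ⬝ᵥ g| ≤ (b : ℝ) ^ 2 * Λ * P * R := by
  simp only [dotProduct, Matrix.mulVec, Finset.sum_mul]
  have : ∀ l : Fin b, |∑ k, B l k * f k * g l| ≤ b * (Λ * P * R) := by
    intro l
    refine (Finset.abs_sum_le_sum_abs _ _).trans ?_
    refine (Finset.sum_le_card_nsmul _ _ (Λ * P * R) fun k _ => ?_).trans (by simp)
    rw [abs_mul, abs_mul]
    have hΛ := (abs_nonneg _).trans (hB l k)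
    have hP := (abs_nonneg _).trans (hf k)
    exact mul_le_mul (mul_le_mul (hB l k) (hf k) (abs_nonneg _) hΛ) (hg l) (abs_nonneg _)
      (by positivity)
  refine (Finset.abs_sum_le_sum_abs _ _).trans ?_
  refine (Finset.sum_le_card_nsmul _ _ _ fun l _ => this l).trans (le_of_eq ?_)
  simp
  ring

end Matrices

/-! ### Polynomials: derivatives and affine rescaling -/

section Polynomials

variable {d : ℕ}

theorem hasFDerivAt_eval (q : MvPolynomial (Fin d) ℝ) (x : Space d) :
    HasFDerivAt (fun x : Space d => MvPolynomial.eval (fun i => x i) q)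
      (∑ j, MvPolynomial.eval (fun i => x i) (MvPolynomial.pderiv j q) •
        (EuclideanSpace.proj j : Space d →L[ℝ] ℝ)) x := by
  induction q using MvPolynomial.induction_on with
  | C a => simpa using hasFDerivAt_const a x
  | add p q hp hq => simpa [add_smul, Finset.sum_add_distrib] using hp.fun_add hq
  | mul_X p i hp =>
    have hX : HasFDerivAt (fun x : Space d => x i) (EuclideanSpace.proj i : Space d →L[ℝ] ℝ) x :=
      (EuclideanSpace.proj i : Space d →L[ℝ] ℝ).hasFDerivAt
    have h := hp.mul hX
    simp only [map_mul, MvPolynomial.eval_X]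
    refine h.congr_fderiv ?_
    ext y
    simp [MvPolynomial.pderiv_X, Pi.single_apply, add_mul, Finset.sum_add_distrib,
      Finset.mul_sum, apply_ite]
    congr 1
    funext j
    ring

theorem contDiff_eval (q : MvPolynomial (Fin d) ℝ) :
    ContDiff ℝ ∞ (fun x : Space d => MvPolynomial.eval (fun i => x i) q) := by
  induction q using MvPolynomial.induction_on with
  | C a => simpa using contDiff_const
  | add p q hp hq => simpa using hp.add hq
  | mul_X p i hp =>
    simp only [map_mul, MvPolynomial.eval_X]
    exact hp.mul (EuclideanSpace.proj i : Space d →L[ℝ] ℝ).contDiff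

/-- The polynomial `y ↦ q (x₀ + r y)`. -/
noncomputable def rescale (x₀ : Space d) (r : ℝ) (q : MvPolynomial (Fin d) ℝ) :
    MvPolynomial (Fin d) ℝ :=
  MvPolynomial.bind₁ (fun i => MvPolynomial.C (x₀ i) + MvPolynomial.C r * MvPolynomial.X i) q

theorem eval_rescale (x₀ : Space d) (r : ℝ) (q : MvPolynomial (Fin d) ℝ) (y : Space d) :
    MvPolynomial.eval (fun i => y i) (rescale x₀ r q) =
      MvPolynomial.eval (fun i => (x₀ + r • y) i) q := by
  rw [rescale, ← MvPolynomial.coe_aeval_eq_eval, ← MvPolynomial.coe_aeval_eq_eval]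
  simp only [RingHom.coe_coe, MvPolynomial.aeval_bind₁]
  simp

/-- The chain rule factor r is the one that accompanies the derivative in the inverse estimate. -/
theorem pderiv_rescale (x₀ : Space d) (r : ℝ) (q : MvPolynomial (Fin d) ℝ) (j : Fin d) :
    MvPolynomial.pderiv j (rescale x₀ r q) =
      MvPolynomial.C r * rescale x₀ r (MvPolynomial.pderiv j q) := by
  induction q using MvPolynomial.induction_on with
  | C a => simp [rescale]
  | add p q hp hq =>
    simp only [rescale, map_add] at hp hq ⊢
    rw [hp, hq]; ring
  | mul_X p i hp =>
    simp only [rescale, map_mul, Derivation.leibniz, MvPolynomial.bind₁_X_right, map_add,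
      smul_eq_mul, MvPolynomial.pderiv_X, MvPolynomial.pderiv_C] at hp ⊢
    rw [hp]
    rcases eq_or_ne i j with rfl | h
    · simp; ring
    · simp [h]; ring

/-- Each variable is replaced by a polynomial of degree at most one, so no monomial gains degree. -/
theorem rescale_mem (x₀ : Space d) (r : ℝ) {p : ℕ} {q : MvPolynomial (Fin d) ℝ}
    (hq : q ∈ MvPolynomial.restrictTotalDegree (Fin d) ℝ p) :
    rescale x₀ r q ∈ MvPolynomial.restrictTotalDegree (Fin d) ℝ p := by
  rw [MvPolynomial.mem_restrictTotalDegree] at hq ⊢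
  refine le_trans ?_ hq
  rw [rescale, MvPolynomial.bind₁, MvPolynomial.aeval_def, MvPolynomial.eval₂_eq]
  refine MvPolynomial.totalDegree_finsetSum_le fun e he => ?_
  refine (MvPolynomial.totalDegree_mul _ _).trans ?_
  have h1 : ∀ i : Fin d, (MvPolynomial.C (x₀ i) + MvPolynomial.C r * MvPolynomial.X i :
      MvPolynomial (Fin d) ℝ).totalDegree ≤ 1 := by
    intro i
    refine (MvPolynomial.totalDegree_add _ _).trans (max_le (by simp) ?_)
    refine (MvPolynomial.totalDegree_mul _ _).trans ?_
    simp
  have h2 : (∏ i ∈ e.support, (MvPolynomial.C (x₀ i) + MvPolynomial.C r * MvPolynomial.X i :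
      MvPolynomial (Fin d) ℝ) ^ e i).totalDegree ≤ ∑ i ∈ e.support, e i := by
    refine (MvPolynomial.totalDegree_finsetProd _ _).trans (Finset.sum_le_sum fun i _ => ?_)
    refine (MvPolynomial.totalDegree_pow _ _).trans ?_
    simpa using Nat.mul_le_mul_left (e i) (h1 i)
  have h3 := MvPolynomial.le_totalDegree he
  rw [Finsupp.sum] at h3
  simp only [MvPolynomial.algebraMap_eq, MvPolynomial.totalDegree_C, zero_add]
  omega

end Polynomials

/-! ### Comparison of norms in finite dimension -/

section Forms

variable {V : Type} [AddCommGroup V] [Module ℝ V]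

/-- A symmetric positive definite bilinear form as an inner product. -/
@[reducible]
noncomputable def formCore (Q : LinearMap.BilinForm ℝ V) (hs : ∀ u w, Q u w = Q w u)
    (hnn : ∀ u, 0 ≤ Q u u) (hpos : ∀ u, Q u u = 0 → u = 0) : InnerProductSpace.Core ℝ V where
  inner u w := Q u w
  conj_inner_symm u w := by simpa using hs w u
  re_inner_nonneg u := by simpa using hnn u
  add_left u u' w := by simp
  smul_left u w r := by simp
  definite u hu := hpos u hu

/-- The form is an inner product, and a linear map from a finite-dimensional normed space is
bounded. This is the source of the constants in the inverse estimates. -/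
theorem exists_sq_norm_le_form [FiniteDimensional ℝ V] (Q : LinearMap.BilinForm ℝ V)
    (hs : ∀ u w, Q u w = Q w u) (hnn : ∀ u, 0 ≤ Q u u) (hpos : ∀ u, Q u u = 0 → u = 0)
    {E : Type} [NormedAddCommGroup E] [NormedSpace ℝ E] (f : V →ₗ[ℝ] E) :
    ∃ C : ℝ, 0 ≤ C ∧ ∀ u, ‖f u‖ ^ 2 ≤ C * Q u u := by
  let core := formCore Q hs hnn hpos
  let _ : NormedAddCommGroup V := core.toNormedAddCommGroup
  let _ : InnerProductSpace ℝ V := InnerProductSpace.ofCore core.toCore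
  let F : V →L[ℝ] E := LinearMap.toContinuousLinearMap f
  refine ⟨‖F‖ ^ 2, by positivity, fun u => ?_⟩
  have h1 : Q u u = ‖u‖ ^ 2 := (real_inner_self_eq_norm_sq u)
  rw [h1, ← mul_pow]
  exact pow_le_pow_left₀ (norm_nonneg _) (F.le_opNorm u) 2

end Forms

/-! ### Inverse estimates, and measures of simplices -/

section InverseEstimates

variable {d : ℕ}

theorem continuous_eval_space (q : MvPolynomial (Fin d) ℝ) :
    Continuous fun x : Space d => MvPolynomial.eval (fun i => x i) q :=
  (MvPolynomial.continuous_eval _).comp (by fun_prop)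

theorem eq_zero_of_integral_sq_eq_zero {s : Set (Space d)} (hs : IsCompact s)
    (hne : (interior s).Nonempty) (q : MvPolynomial (Fin d) ℝ)
    (hq : ∫ x in s, MvPolynomial.eval (fun i => x i) q * MvPolynomial.eval (fun i => x i) q = 0) :
    q = 0 := by
  have hc := continuous_eval_space q
  have hzero : ∀ x ∈ interior s, MvPolynomial.eval (fun i => x i) q = 0 := by
    rw [setIntegral_eq_zero_iff_of_nonneg_ae (ae_of_all _ fun x => mul_self_nonneg _)
      ((hc.mul hc).continuousOn.integrableOn_compact hs)] at hq
    have hK' := ae_restrict_of_ae_restrict_of_subset (interior_subset (s := s)) hq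
    have := Measure.eqOn_open_of_ae_eq hK' isOpen_interior (hc.mul hc).continuousOn
      continuousOn_const
    intro x hx
    exact mul_self_eq_zero.1 (this hx)
  obtain ⟨x₀, hx₀⟩ := hne
  have hopen : IsOpen ((WithLp.toLp 2 : (Fin d → ℝ) → Space d) ⁻¹' interior s) :=
    isOpen_interior.preimage (PiLp.continuous_toLp 2 _)
  obtain ⟨ε, hε, hball⟩ := Metric.isOpen_iff.1 hopen x₀.ofLp (by simpa using hx₀)
  refine MvPolynomial.funext_set (s := fun i => Metric.ball (x₀ i) ε) (fun i => ?_) ?_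
  · rw [Real.ball_eq_Ioo]
    exact Set.Ioo_infinite (by linarith)
  · intro y hy
    have hy' : y ∈ Metric.ball x₀.ofLp ε := by
      rw [ball_pi _ hε]
      exact hy
    simpa using hzero _ (hball hy')

/-- On polynomials of degree at most `p`, a family of evaluations of a linear operator at the points
of a ball is controlled by the `L²` norm on the unit ball. -/
theorem exists_sq_eval_le_integral (p : ℕ) (σ : ℝ)
    (D : MvPolynomial (Fin d) ℝ →ₗ[ℝ] MvPolynomial (Fin d) ℝ) :
    ∃ C : ℝ, 0 ≤ C ∧ ∀ q ∈ MvPolynomial.restrictTotalDegree (Fin d) ℝ p,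
      ∀ y ∈ Metric.closedBall (0 : Space d) σ,
        (MvPolynomial.eval (fun i => y i) (D q)) ^ 2 ≤
          C * ∫ x in Metric.closedBall (0 : Space d) 1,
            MvPolynomial.eval (fun i => x i) q * MvPolynomial.eval (fun i => x i) q := by
  let W := MvPolynomial.restrictTotalDegree (Fin d) ℝ p
  let X := Metric.closedBall (0 : Space d) σ
  have : CompactSpace X := isCompact_iff_compactSpace.1 (isCompact_closedBall _ _)
  -- Values in continuous functions with the supremum norm give one constant for all points of the
  -- ball.
  let f : W →ₗ[ℝ] C(X, ℝ) :=
    { toFun := fun q => ⟨fun x => MvPolynomial.eval (fun i => x.1 i) (D q),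
        (continuous_eval_space _).comp continuous_subtype_val⟩
      map_add' := fun q q' => by ext x; simp
      map_smul' := fun r q => by ext x; simp [MvPolynomial.smul_eval] }
  let Q : LinearMap.BilinForm ℝ W := integralForm volume (Metric.closedBall (0 : Space d) 1)
    (fun q q' x => MvPolynomial.eval (fun i => x i) (q : MvPolynomial (Fin d) ℝ) *
      MvPolynomial.eval (fun i => x i) (q' : MvPolynomial (Fin d) ℝ))
    (fun q q' => ((continuous_eval_space _).mul
      (continuous_eval_space _)).continuousOn.integrableOn_compact (isCompact_closedBall _ _))
    (by intros; simp [add_mul]) (by intros; simp [MvPolynomial.smul_eval, mul_assoc])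
    (by intros; simp [mul_add]) (by intros; simp [MvPolynomial.smul_eval, mul_left_comm])
  have hQ : ∀ q q' : W, Q q q' = ∫ x in Metric.closedBall (0 : Space d) 1,
      MvPolynomial.eval (fun i => x i) (q : MvPolynomial (Fin d) ℝ) *
        MvPolynomial.eval (fun i => x i) (q' : MvPolynomial (Fin d) ℝ) := fun _ _ => rfl
  obtain ⟨C, hC, h⟩ := exists_sq_norm_le_form Q
    (fun q q' => by rw [hQ, hQ]; simp only [mul_comm])
    (fun q => by rw [hQ]; exact integral_nonneg fun x => mul_self_nonneg _)
    (fun q hq => Subtype.ext (eq_zero_of_integral_sq_eq_zero (isCompact_closedBall _ _)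
      (by rw [interior_closedBall _ one_ne_zero]; exact ⟨0, Metric.mem_ball_self one_pos⟩) _
      (by rw [← hQ]; exact hq)))
    f
  refine ⟨C, hC, fun q hq y hy => ?_⟩
  refine le_trans ?_ (h ⟨q, hq⟩)
  rw [← sq_abs]
  exact pow_le_pow_left₀ (abs_nonneg _) ((f ⟨q, hq⟩).norm_coe_le_norm ⟨y, hy⟩) 2

theorem setIntegral_closedBall_rescale (x₀ : Space d) {r : ℝ} (hr : 0 < r) (f : Space d → ℝ) :
    ∫ y in Metric.closedBall (0 : Space d) 1, f (x₀ + r • y) =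
      (r ^ d)⁻¹ * ∫ x in Metric.closedBall x₀ r, f x := by
  have h1 := Measure.setIntegral_comp_smul_of_pos volume (fun x => f (x₀ + x))
    (Metric.closedBall (0 : Space d) 1) hr
  rw [h1, smul_closedBall _ _ zero_le_one]
  have h2 : (fun x : Space d => x₀ + x) ⁻¹' Metric.closedBall x₀ r = Metric.closedBall 0 r := by
    ext x; simp
  have h3 := (measurePreserving_add_left (volume : Measure (Space d)) x₀).setIntegral_preimage_emb
    (measurableEmbedding_addLeft x₀) f (Metric.closedBall x₀ r)
  rw [h2] at h3
  simp [h3, abs_of_pos hr]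

/-- Inverse estimates for polynomials on a set between two concentric balls. -/
theorem exists_inverse_estimate (d p : ℕ) (σ : ℝ) :
    ∃ C : ℝ, 0 ≤ C ∧ ∀ q ∈ MvPolynomial.restrictTotalDegree (Fin d) ℝ p,
      ∀ (x₀ : Space d) (r : ℝ), 0 < r → ∀ s : Set (Space d), IsCompact s →
      Metric.closedBall x₀ r ⊆ s → s ⊆ Metric.closedBall x₀ (σ * r) → ∀ x ∈ s,
        (MvPolynomial.eval (fun i => x i) q) ^ 2 ≤ C * (r ^ d)⁻¹ *
          (∫ x in s, MvPolynomial.eval (fun i => x i) q * MvPolynomial.eval (fun i => x i) q) ∧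
        ∀ j, (r * MvPolynomial.eval (fun i => x i) (MvPolynomial.pderiv j q)) ^ 2 ≤
          C * (r ^ d)⁻¹ *
          (∫ x in s, MvPolynomial.eval (fun i => x i) q * MvPolynomial.eval (fun i => x i) q) := by
  obtain ⟨C₀, hC₀, h₀⟩ := exists_sq_eval_le_integral (d := d) p σ LinearMap.id
  choose D hD hd using fun j : Fin d =>
    exists_sq_eval_le_integral (d := d) p σ (MvPolynomial.pderiv j).toLinearMap
  have hDs : 0 ≤ ∑ j, D j := Finset.sum_nonneg fun j _ => hD j
  refine ⟨C₀ + ∑ j, D j, by positivity, ?_⟩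
  intro q hq x₀ r hr s hs hin hout x hx
  set I := ∫ x in s, MvPolynomial.eval (fun i => x i) q * MvPolynomial.eval (fun i => x i) q
    with hI
  have hI0 : 0 ≤ I := integral_nonneg fun x => mul_self_nonneg _
  -- The inner ball is mapped to the unit ball, on which the L² norm is controlled by that on `s`;
  -- points of `s` are mapped into the ball of radius σ. Only two fixed balls enter, so the constant
  -- does not see x₀, r or `s`.
  have hint : ∫ y in Metric.closedBall (0 : Space d) 1,
      MvPolynomial.eval (fun i => y i) (rescale x₀ r q) *
        MvPolynomial.eval (fun i => y i) (rescale x₀ r q) ≤ (r ^ d)⁻¹ * I := by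
    simp only [eval_rescale]
    rw [setIntegral_closedBall_rescale x₀ hr
      (fun x => MvPolynomial.eval (fun i => x i) q * MvPolynomial.eval (fun i => x i) q)]
    refine mul_le_mul_of_nonneg_left ?_ (by positivity)
    exact setIntegral_mono_set (((continuous_eval_space q).mul
      (continuous_eval_space q)).continuousOn.integrableOn_compact hs)
      (ae_of_all _ fun x => mul_self_nonneg _) hin.eventuallyLE
  set y : Space d := r⁻¹ • (x - x₀) with hy
  have hxy : x₀ + r • y = x := by
    rw [hy, smul_smul, mul_inv_cancel₀ hr.ne', one_smul, add_sub_cancel]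
  have hyb : y ∈ Metric.closedBall (0 : Space d) σ := by
    have := hout hx
    rw [mem_closedBall_iff_norm] at this
    rw [mem_closedBall_zero_iff, hy, norm_smul, norm_inv, Real.norm_of_nonneg hr.le,
      inv_mul_le_iff₀ hr]
    linarith
  have hrI : 0 ≤ (r ^ d)⁻¹ * I := by positivity
  constructor
  · have h := h₀ _ (rescale_mem x₀ r hq) y hyb
    rw [LinearMap.id_apply, eval_rescale, hxy] at h
    refine h.trans ((mul_le_mul_of_nonneg_left hint hC₀).trans ?_)
    rw [mul_assoc]
    exact mul_le_mul_of_nonneg_right (by linarith) hrI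
  · intro j
    have h := hd j _ (rescale_mem x₀ r hq) y hyb
    rw [Derivation.coeFn_coe, pderiv_rescale, map_mul,
      MvPolynomial.eval_C, eval_rescale, hxy] at h
    refine h.trans ((mul_le_mul_of_nonneg_left hint (hD j)).trans ?_)
    rw [mul_assoc]
    refine mul_le_mul_of_nonneg_right ?_ hrI
    have := Finset.single_le_sum (f := D) (fun j _ => hD j) (Finset.mem_univ j)
    linarith

/-- A simplex with `n + 1` vertices has `n`-dimensional measure at most a constant times the `n`-th
power of its diameter. -/
theorem exists_hausdorff_hull_le (d n : ℕ) : ∃ C : ℝ, 0 ≤ C ∧ ∀ F : Finset (Space d),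
    F.card = n + 1 → ∀ D : ℝ, (∀ x ∈ F, ∀ y ∈ F, dist x y ≤ D) →
      (μHE[n] : Measure (Space d)).real (hull F) ≤ C * D ^ n := by
  -- κ is the normalization of `μHE` relative to `μH`; the factor n^n comes from the Lipschitz
  -- constant n D below, taken for the supremum norm on the cube.
  set κ : NNReal := Measure.addHaarScalarFactor (volume : Measure (EuclideanSpace ℝ (Fin n))) μH[n]
  refine ⟨κ * (n : ℝ) ^ n, by positivity, ?_⟩
  intro F hF D hD
  let e : Fin (n + 1) ≃ F := (F.equivFinOfCardEq hF).symm
  let x : Fin (n + 1) → Space d := fun i => (e i : Space d)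
  have hD0 : 0 ≤ D := dist_nonneg.trans (hD _ (e 0).2 _ (e 0).2)
  let l : (Fin n → ℝ) →ₗ[ℝ] Space d :=
    Fintype.linearCombination ℝ (fun i : Fin n => x i.succ - x 0)
  let f : (Fin n → ℝ) → Space d := fun t => l t + x 0
  -- The affine map `f` sends the origin and the unit vectors to the vertices of `F`, and the image
  -- of the cube is convex.
  have hsub : hull F ⊆ f '' Set.Icc 0 1 := by
    apply convexHull_min
    · intro y hy
      obtain ⟨i, hi⟩ := e.surjective ⟨y, hy⟩
      have hxi : x i = y := by simp [x, hi]
      refine Fin.cases ?_ (fun i => ?_) i hxi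
      · intro h
        exact ⟨0, by simp, by simp [f, h]⟩
      · intro h
        refine ⟨Pi.single i 1, ⟨?_, ?_⟩, ?_⟩
        · intro j; by_cases hj : j = i <;> simp [hj]
        · intro j; by_cases hj : j = i <;> simp [hj]
        · simp [f, l, Fintype.linearCombination_apply_single, h]
    · have h2 : f '' Set.Icc 0 1 = (fun z => x 0 + z) '' (l '' Set.Icc 0 1) := by
        rw [Set.image_image]
        simp only [f, add_comm]
      rw [h2]
      exact ((convex_Icc (0 : Fin n → ℝ) 1).linear_image l).translate _
  have hC : LipschitzWith (Real.toNNReal (n * D)) f := by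
    refine LipschitzWith.of_dist_le_mul fun a a' => ?_
    rw [Real.coe_toNNReal _ (by positivity)]
    have h1 : dist (f a) (f a') = ‖l (a - a')‖ := by simp [f, dist_eq_norm]
    rw [h1, dist_eq_norm]
    simp only [l, Fintype.linearCombination_apply]
    refine (norm_sum_le _ _).trans ?_
    refine (Finset.sum_le_card_nsmul _ _ (D * ‖a - a'‖) fun i _ => ?_).trans (le_of_eq ?_)
    · rw [norm_smul, mul_comm D]
      refine mul_le_mul (norm_le_pi_norm _ i) ?_ (norm_nonneg _) (norm_nonneg _)
      rw [← dist_eq_norm]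
      exact hD _ (e _).2 _ (e _).2
    · simp; ring
  have h1 : (μH[n] : Measure (Space d)) (hull F) ≤ ENNReal.ofReal ((n * D) ^ n) := by
    refine (measure_mono hsub).trans ?_
    refine (hC.hausdorffMeasure_image_le (by positivity) _).trans ?_
    have : (μH[n] : Measure (Fin n → ℝ)) = volume := by
      simpa using hausdorffMeasure_pi_real (ι := Fin n)
    rw [this, Real.volume_Icc_pi, ENNReal.ofReal_pow (by positivity)]
    simp [ENNReal.ofReal]
  have h2 : (μHE[n] : Measure (Space d)) (hull F) ≤ ENNReal.ofReal (κ * (n : ℝ) ^ n * D ^ n) := by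
    rw [Measure.euclideanHausdorffMeasure_def, Measure.smul_apply, ENNReal.smul_def, smul_eq_mul,
      mul_assoc, ← mul_pow, ENNReal.ofReal_mul (by positivity), ENNReal.ofReal_coe_nnreal]
    gcongr
  rw [Measure.real]
  exact ENNReal.toReal_le_of_le_ofReal (by positivity) h2

theorem exists_facet_measure_le (d : ℕ) (hd : 1 ≤ d) : ∃ C : ℝ, 0 ≤ C ∧ ∀ F : Finset (Space d),
    F.card = d → ∀ D : ℝ, (∀ x ∈ F, ∀ y ∈ F, dist x y ≤ D) →
      (μHE[d - 1] : Measure (Space d)).real (hull F) ≤ C * D ^ (d - 1) := by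
  obtain ⟨C, hC, h⟩ := exists_hausdorff_hull_le d (d - 1)
  exact ⟨C, hC, fun F hF => h F (by omega)⟩

theorem exists_volume_closedBall_le (d : ℕ) : ∃ C : ℝ, 0 ≤ C ∧ ∀ (x : Space d) (R : ℝ), 0 ≤ R →
    ∀ s ⊆ Metric.closedBall x R, (volume : Measure (Space d)).real s ≤ C * R ^ d := by
  refine ⟨volume.real (Metric.closedBall (0 : Space d) 1), measureReal_nonneg, ?_⟩
  intro x R hR s hs
  refine (measureReal_mono hs (isCompact_closedBall x R).measure_lt_top.ne).trans (le_of_eq ?_)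
  rw [Measure.addHaar_real_closedBall' _ _ hR, mul_comm]
  simp

end InverseEstimates

/-! ### Barycentric coordinates and conformity of the mesh -/

section Geometry

open Classical Filter Topology

variable {d : ℕ} {T : Mesh d} {K K' : Finset (Space d)}

theorem Mesh.mem_faces (hK : K ∈ T.elements) : K ∈ T.complex.faces :=
  T.finite.mem_toFinset.1 (Finset.mem_filter.1 hK).1

theorem Mesh.card_element (hK : K ∈ T.elements) : K.card = d + 1 :=
  (Finset.mem_filter.1 hK).2

theorem Mesh.mem_elements_of_mem_patch {v : Space d} (hK : K ∈ T.patch v) : K ∈ T.elements :=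
  (Finset.mem_filter.1 hK).1

theorem Mesh.mem_of_mem_patch {v : Space d} (hK : K ∈ T.patch v) : v ∈ K :=
  (Finset.mem_filter.1 hK).2

theorem Mesh.mem_patch {v : Space d} (hK : K ∈ T.elements) (hv : v ∈ K) : K ∈ T.patch v :=
  Finset.mem_filter.2 ⟨hK, hv⟩

/-- The vertices of a mesh element as an affine basis. -/
noncomputable def elementBasis (hK : K ∈ T.elements) : AffineBasis K ℝ (Space d) :=
  ⟨fun w => w.1, T.complex.indep (Mesh.mem_faces hK),
    ((T.complex.indep (Mesh.mem_faces hK)).affineSpan_eq_top_iff_card_eq_finrank_add_one.2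
      (by simpa using Mesh.card_element hK))⟩

/-- The barycentric coordinate of the vertex `w` of a mesh element. -/
noncomputable def baryCoord (hK : K ∈ T.elements) (w : Space d) : Space d →ᵃ[ℝ] ℝ :=
  -- The default 0 for a point that is not a vertex spares `baryCoord_of_ne` and
  -- `mem_of_baryCoord_pos` the hypothesis `w ∈ K`.
  if h : w ∈ K then (elementBasis hK).coord ⟨w, h⟩ else AffineMap.const ℝ _ 0

theorem baryCoord_self (hK : K ∈ T.elements) {w : Space d} (hw : w ∈ K) :
    baryCoord hK w w = 1 := by
  rw [baryCoord, dif_pos hw]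
  exact (elementBasis hK).coord_apply_eq ⟨w, hw⟩

theorem baryCoord_of_ne (hK : K ∈ T.elements) {w w' : Space d} (hw' : w' ∈ K) (h : w ≠ w') :
    baryCoord hK w w' = 0 := by
  rw [baryCoord]
  split_ifs with hw
  · exact (elementBasis hK).coord_apply_ne (i := ⟨w, hw⟩) (j := ⟨w', hw'⟩) (by simpa using h)
  · simp

theorem sum_baryCoord (hK : K ∈ T.elements) (x : Space d) : ∑ w ∈ K, baryCoord hK w x = 1 := by
  rw [← (elementBasis hK).sum_coord_apply_eq_one x, ← Finset.sum_coe_sort]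
  exact Finset.sum_congr rfl fun w _ => by rw [baryCoord, dif_pos w.2]

theorem sum_baryCoord_smul (hK : K ∈ T.elements) (x : Space d) :
    ∑ w ∈ K, baryCoord hK w x • w = x := by
  conv_rhs => rw [← (elementBasis hK).linear_combination_coord_eq_self x]
  rw [← Finset.sum_coe_sort]
  exact Finset.sum_congr rfl fun w _ => by rw [baryCoord, dif_pos w.2]; rfl

theorem range_elementBasis (hK : K ∈ T.elements) :
    Set.range (elementBasis hK) = (K : Set (Space d)) :=
  Subtype.range_coe

theorem mem_hull_iff (hK : K ∈ T.elements) (x : Space d) :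
    x ∈ hull K ↔ ∀ w ∈ K, 0 ≤ baryCoord hK w x := by
  rw [hull, ← range_elementBasis hK, AffineBasis.convexHull_eq_nonneg_coord, Set.mem_ofPred_eq,
    Subtype.forall]
  exact forall₂_congr fun w hw => by rw [baryCoord, dif_pos hw]

theorem mem_interior_hull_iff (hK : K ∈ T.elements) (x : Space d) :
    x ∈ interior (hull K) ↔ ∀ w ∈ K, 0 < baryCoord hK w x := by
  rw [hull, ← range_elementBasis hK, AffineBasis.interior_convexHull, Set.mem_ofPred_eq,
    Subtype.forall]
  exact forall₂_congr fun w hw => by rw [baryCoord, dif_pos hw]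

theorem affineMap_eq_sum_baryCoord (hK : K ∈ T.elements) (g : Space d →ᵃ[ℝ] ℝ) (x : Space d) :
    g x = ∑ w ∈ K, baryCoord hK w x * g w := by
  have hg : ∀ y, g y = g.linear y + g 0 := fun y => by
    rw [g.decomp']; simp
  rw [hg x]
  conv_lhs => rw [← sum_baryCoord_smul hK x]
  rw [map_sum, ← one_mul (g 0), ← sum_baryCoord hK x, Finset.sum_mul, ← Finset.sum_add_distrib]
  refine Finset.sum_congr rfl fun w _ => ?_
  rw [hg w, map_smul, smul_eq_mul, mul_add]

/-- An affine function that vanishes on a facet is a multiple of the barycentric coordinate of the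
opposite vertex. -/
theorem affineMap_eq_mul_baryCoord (hK : K ∈ T.elements) {w : Space d} (hw : w ∈ K)
    {g : Space d →ᵃ[ℝ] ℝ} (hg : ∀ w' ∈ K.erase w, g w' = 0) (x : Space d) :
    g x = g w * baryCoord hK w x := by
  rw [affineMap_eq_sum_baryCoord hK g x, Finset.sum_eq_single w, mul_comm]
  · intro w' hw' hne
    rw [hg w' (Finset.mem_erase.2 ⟨hne, hw'⟩), mul_zero]
  · exact fun h => absurd hw h

theorem affineMap_barycenter {F : Finset (Space d)} (hF : F.Nonempty) (g : Space d →ᵃ[ℝ] ℝ) :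
    g (barycenter F) = (F.card : ℝ)⁻¹ * ∑ w ∈ F, g w := by
  have hc : (F.card : ℝ) ≠ 0 := by exact_mod_cast hF.card_pos.ne'
  have hg : ∀ y, g y = g.linear y + g 0 := fun y => by
    rw [g.decomp']; simp
  have hsum : ∑ w ∈ F, g w = g.linear (∑ w ∈ F, w) + F.card * g 0 := by
    rw [Finset.sum_congr rfl fun w _ => hg w, Finset.sum_add_distrib, Finset.sum_const,
      nsmul_eq_mul, map_sum]
  rw [hsum, hg, barycenter, map_smul, smul_eq_mul, mul_add, inv_mul_cancel_left₀ hc]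

theorem baryCoord_barycenter_subset (hK : K ∈ T.elements) {F : Finset (Space d)} (hF : F ⊆ K)
    {w : Space d} (hw : w ∈ F) : baryCoord hK w (barycenter F) = (F.card : ℝ)⁻¹ := by
  rw [affineMap_barycenter ⟨w, hw⟩, Finset.sum_eq_single w, baryCoord_self hK (hF hw), mul_one]
  · exact fun w' hw' hne => baryCoord_of_ne hK (hF hw') hne.symm
  · exact fun h => absurd hw h

theorem barycenter_mem_interior_hull (hK : K ∈ T.elements) :
    barycenter K ∈ interior (hull K) := by
  rw [mem_interior_hull_iff hK]
  intro w hw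
  rw [baryCoord_barycenter_subset hK subset_rfl hw, Mesh.card_element hK]
  positivity

theorem affineMap_eq_zero_of_mem_hull {F : Finset (Space d)} {g : Space d →ᵃ[ℝ] ℝ}
    (hg : ∀ w ∈ F, g w = 0) {x : Space d} (hx : x ∈ hull F) : g x = 0 := by
  have hconv : Convex ℝ (g ⁻¹' {0}) := (convex_singleton (0 : ℝ)).affine_preimage g
  exact convexHull_min (fun w hw => hg w hw) hconv hx

theorem affineMap_nonneg_of_mem_hull {F : Finset (Space d)} {g : Space d →ᵃ[ℝ] ℝ}
    (hg : ∀ w ∈ F, 0 ≤ g w) {x : Space d} (hx : x ∈ hull F) : 0 ≤ g x := by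
  have hconv : Convex ℝ (g ⁻¹' Set.Ici 0) := (convex_Ici (0 : ℝ)).affine_preimage g
  exact convexHull_min (fun w hw => hg w hw) hconv hx

theorem hull_inter_subset (hK : K ∈ T.elements) (hK' : K' ∈ T.elements) :
    hull K ∩ hull K' ⊆ hull (K ∩ K') := by
  have := T.complex.inter_subset_convexHull (Mesh.mem_faces hK) (Mesh.mem_faces hK')
  rwa [← Finset.coe_inter] at this

/-- Conformity in coordinates: x lies in the hull of the common vertices, where the coordinate of a
vertex outside K' vanishes. -/
theorem mem_of_baryCoord_pos (hK : K ∈ T.elements) (hK' : K' ∈ T.elements) {x : Space d}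
    (hx : x ∈ hull K) (hx' : x ∈ hull K') {w : Space d} (hpos : 0 < baryCoord hK w x) :
    w ∈ K' := by
  by_contra hw
  refine hpos.ne' (affineMap_eq_zero_of_mem_hull (fun w' hw' => ?_)
    (hull_inter_subset hK hK' ⟨hx, hx'⟩))
  rw [Finset.mem_inter] at hw'
  exact baryCoord_of_ne hK hw'.1 (by rintro rfl; exact hw hw'.2)

/-- Two elements with a common facet lie on different sides of it. -/
theorem baryCoord_neg (hd : 1 ≤ d) (hK : K ∈ T.elements) (hK' : K' ∈ T.elements) {w : Space d}
    (hw : w ∈ K) (hF : K.erase w ⊆ K') (hwK' : w ∉ K') {y : Space d} (hy : y ∈ K')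
    (hyF : y ∉ K.erase w) : baryCoord hK w y < 0 := by
  have hcard : (K.erase w).card = d := by rw [Finset.card_erase_of_mem hw, Mesh.card_element hK]; rfl
  have hFne : (K.erase w).Nonempty := Finset.card_pos.1 (by omega)
  have hd0 : (0 : ℝ) < (d : ℝ)⁻¹ := by positivity
  -- The coordinate of y in K' vanishes on the facet, so it is a multiple of that of w in K; it
  -- equals 1 at y.
  have hne : baryCoord hK w y ≠ 0 := by
    intro h0
    have h1 := affineMap_eq_mul_baryCoord hK hw (g := baryCoord hK' y) (fun w' hw' =>
      baryCoord_of_ne hK' (hF hw') (by rintro rfl; exact hyF hw')) y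
    rw [h0, mul_zero, baryCoord_self hK' hy] at h1
    exact one_ne_zero h1
  refine lt_of_le_of_ne ?_ hne
  by_contra! hpos
  -- If y were on the side of w, a short move from the facet barycenter towards y would stay in both
  -- elements and have positive w-coordinate, forcing w into K' by conformity.
  let β := barycenter (K.erase w)
  have hβ : ∀ w' ∈ K.erase w, baryCoord hK w' β = (d : ℝ)⁻¹ := fun w' hw' => by
    rw [baryCoord_barycenter_subset hK (Finset.erase_subset _ _) hw', hcard]
  have hβw : baryCoord hK w β = 0 := by
    rw [affineMap_barycenter hFne, Finset.sum_eq_zero, mul_zero]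
    exact fun w' hw' => baryCoord_of_ne hK (Finset.mem_of_mem_erase hw')
      (Finset.ne_of_mem_erase hw').symm
  have hβK' : β ∈ hull K' := by
    rw [mem_hull_iff hK']
    intro z hz
    rw [affineMap_barycenter hFne]
    refine mul_nonneg (by positivity) (Finset.sum_nonneg fun w' hw' => ?_)
    rcases eq_or_ne z w' with rfl | h
    · rw [baryCoord_self hK' hz]; exact zero_le_one
    · rw [baryCoord_of_ne hK' (hF hw') h]
  have hev : ∀ᶠ ε in 𝓝[>] (0 : ℝ), ∀ w' ∈ K.erase w,
      0 < baryCoord hK w' (AffineMap.lineMap β y ε) := by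
    rw [Filter.eventually_all_finset]
    intro w' hw'
    have hcont : Continuous fun ε : ℝ => baryCoord hK w' (AffineMap.lineMap β y ε) :=
      (baryCoord hK w').continuous_of_finiteDimensional.comp
        AffineMap.lineMap_continuous
    refine (hcont.tendsto 0).eventually_const_lt ?_ |>.filter_mono nhdsWithin_le_nhds
    rw [AffineMap.lineMap_apply_zero, hβ w' hw']
    exact hd0
  have hev1 : ∀ᶠ ε in 𝓝[>] (0 : ℝ), ε ∈ Set.Ioc (0 : ℝ) 1 := by
    filter_upwards [Ioo_mem_nhdsGT (zero_lt_one (α := ℝ))] with ε hε using ⟨hε.1, hε.2.le⟩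
  obtain ⟨ε, hε, hε1⟩ := (hev.and hev1).exists
  have hzw : baryCoord hK w (AffineMap.lineMap β y ε) = ε * baryCoord hK w y := by
    rw [AffineMap.apply_lineMap, AffineMap.lineMap_apply, hβw]
    simp
  have hzw0 : 0 < baryCoord hK w (AffineMap.lineMap β y ε) := by
    rw [hzw]; exact mul_pos hε1.1 hpos
  refine hwK' (mem_of_baryCoord_pos hK hK' ?_ ?_ hzw0)
  · rw [mem_hull_iff hK]
    intro w' hw'
    rcases eq_or_ne w' w with rfl | h
    · exact hzw0.le
    · exact (hε w' (Finset.mem_erase.2 ⟨h, hw'⟩)).le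
  · exact (convex_convexHull ℝ _).lineMap_mem hβK' (subset_convexHull ℝ _ hy) ⟨hε1.1.le, hε1.2⟩

theorem inter_eq_erase (hK : K ∈ T.elements) (hK' : K' ∈ T.elements) (hne : K ≠ K')
    {w : Space d} (hw : w ∈ K) (hF : K.erase w ⊆ K') : K ∩ K' = K.erase w := by
  have hcard : (K.erase w).card = d := by rw [Finset.card_erase_of_mem hw, Mesh.card_element hK]; rfl
  have hsub : K.erase w ⊆ K ∩ K' := Finset.subset_inter (Finset.erase_subset _ _) hF
  refine (Finset.eq_of_subset_of_card_le hsub ?_).symm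
  rw [hcard]
  by_contra! hlt
  have h1 : K ∩ K' = K := Finset.eq_of_subset_of_card_le Finset.inter_subset_left
    (by rw [Mesh.card_element hK]; omega)
  exact hne (Finset.eq_of_subset_of_card_le (Finset.inter_eq_left.1 h1)
    (by rw [Mesh.card_element hK, Mesh.card_element hK']))

theorem notMem_of_erase_subset (hK : K ∈ T.elements) (hK' : K' ∈ T.elements) (hne : K ≠ K')
    {w : Space d} (hF : K.erase w ⊆ K') : w ∉ K' := by
  intro hw'
  refine hne (Finset.eq_of_subset_of_card_le (fun z hz => ?_)
    (by rw [Mesh.card_element hK, Mesh.card_element hK']))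
  rcases eq_or_ne z w with rfl | h
  · exact hw'
  · exact hF (Finset.mem_erase.2 ⟨h, hz⟩)

theorem exists_erase_eq (hK : K ∈ T.elements) (hK' : K' ∈ T.elements)
    {w : Space d} (hw : w ∈ K) (hF : K.erase w ⊆ K') : ∃ y ∈ K', K'.erase y = K.erase w := by
  have hcard : (K.erase w).card = d := by rw [Finset.card_erase_of_mem hw, Mesh.card_element hK]; rfl
  obtain ⟨y, hy, hyF⟩ : ∃ y ∈ K', y ∉ K.erase w := by
    by_contra! h
    have := Finset.card_le_card (show K' ⊆ K.erase w from h)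
    rw [hcard, Mesh.card_element hK'] at this
    omega
  refine ⟨y, hy, (Finset.eq_of_subset_of_card_le (fun z hz => ?_) ?_).symm⟩
  · exact Finset.mem_erase.2 ⟨by rintro rfl; exact hyF hz, hF hz⟩
  · rw [hcard, Finset.card_erase_of_mem hy, Mesh.card_element hK']; rfl

/-- A facet of an element belongs to at most one other element. -/
theorem eq_of_common_facet (hd : 1 ≤ d) {K'' : Finset (Space d)} (hK : K ∈ T.elements)
    (hK' : K' ∈ T.elements) (hK'' : K'' ∈ T.elements) {w : Space d} (hw : w ∈ K)
    (hne : K ≠ K') (hne' : K ≠ K'') (hF : K.erase w ⊆ K') (hF' : K.erase w ⊆ K'') :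
    K' = K'' := by
  by_contra h
  obtain ⟨y, hy, hyF⟩ := exists_erase_eq hK hK' hw hF
  obtain ⟨z, hz, hzF⟩ := exists_erase_eq hK hK'' hw hF'
  have hy' : y ∉ K.erase w := by rw [← hyF]; exact Finset.notMem_erase _ _
  have hz' : z ∉ K.erase w := by rw [← hzF]; exact Finset.notMem_erase _ _
  have h1 := baryCoord_neg hd hK hK' hw hF (notMem_of_erase_subset hK hK' hne hF) hy hy'
  have h2 := baryCoord_neg hd hK hK'' hw hF' (notMem_of_erase_subset hK hK'' hne' hF') hz hz'
  have hFy : K'.erase y ⊆ K'' := by rw [hyF]; exact hF'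
  have h3 := baryCoord_neg hd hK' hK'' hy hFy (notMem_of_erase_subset hK' hK'' h hFy) hz
    (by rw [hyF]; exact hz')
  -- The vertices w, y and z opposite the facet would lie pairwise on different sides of one
  -- hyperplane. Since the coordinates of w and y are proportional, this is a contradiction of
  -- signs.
  have hprop := affineMap_eq_mul_baryCoord hK hw (g := baryCoord hK' y) (fun w' hw' =>
      baryCoord_of_ne hK' (hF hw') (by rintro rfl; exact hy' hw'))
  have h4 := hprop y
  rw [baryCoord_self hK' hy] at h4
  rw [hprop z] at h3
  have h5 : baryCoord hK' y w < 0 := by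
    by_contra! h5
    nlinarith
  nlinarith

/-- A facet at an interior vertex belongs to a second element. -/
theorem exists_neighbour {v : Space d} (hv : v ∈ interior T.domain) (hK : K ∈ T.patch v)
    {w : Space d} (hw : w ∈ K) (hwv : w ≠ v) :
    ∃ K' ∈ T.patch v, K ≠ K' ∧ K.erase w ⊆ K' := by
  have hKe := Mesh.mem_elements_of_mem_patch hK
  have hvK := Mesh.mem_of_mem_patch hK
  have hvF : v ∈ K.erase w := Finset.mem_erase.2 ⟨hwv.symm, hvK⟩
  let β := barycenter (K.erase w)
  have hβw : baryCoord hKe w β = 0 := by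
    rw [affineMap_barycenter ⟨v, hvF⟩, Finset.sum_eq_zero, mul_zero]
    exact fun w' hw' => baryCoord_of_ne hKe (Finset.mem_of_mem_erase hw')
      (Finset.ne_of_mem_erase hw').symm
  have hβ : ∀ w' ∈ K.erase w, 0 < baryCoord hKe w' β := fun w' hw' => by
    rw [baryCoord_barycenter_subset hKe (Finset.erase_subset _ _) hw']
    have : 0 < (K.erase w).card := Finset.card_pos.2 ⟨v, hvF⟩
    positivity
  have hcont : ∀ a b : Space d, Continuous fun ε : ℝ => AffineMap.lineMap a b ε := fun a b =>
    AffineMap.lineMap_continuous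
  -- a point in the relative interior of the facet, in the interior of the domain
  obtain ⟨x, hxdom, hxw, hxF⟩ : ∃ x ∈ interior T.domain, baryCoord hKe w x = 0 ∧
      ∀ w' ∈ K.erase w, 0 < baryCoord hKe w' x := by
    have hev : ∀ᶠ ε in 𝓝[>] (0 : ℝ), AffineMap.lineMap v β ε ∈ interior T.domain := by
      refine ((hcont v β).tendsto 0).eventually (isOpen_interior.eventually_mem ?_)
        |>.filter_mono nhdsWithin_le_nhds
      rwa [AffineMap.lineMap_apply_zero]
    obtain ⟨ε, hε, hε0, hε1⟩ := (hev.and (Ioo_mem_nhdsGT (zero_lt_one (α := ℝ)))).exists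
    refine ⟨_, hε, ?_, fun w' hw' => ?_⟩
    · rw [AffineMap.apply_lineMap, hβw, baryCoord_of_ne hKe hvK hwv, AffineMap.lineMap_same]
      rfl
    · have h1 : 0 ≤ baryCoord hKe w' v := by
        rcases eq_or_ne w' v with rfl | h
        · rw [baryCoord_self hKe hvK]; exact zero_le_one
        · rw [baryCoord_of_ne hKe hvK h]
      rw [AffineMap.apply_lineMap, AffineMap.lineMap_apply_module, smul_eq_mul, smul_eq_mul]
      have := mul_pos hε0 (hβ w' hw')
      have := mul_nonneg (sub_nonneg.2 hε1.le) h1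
      linarith
  have hxK : x ∈ hull K := by
    rw [mem_hull_iff hKe]
    intro w' hw'
    rcases eq_or_ne w' w with rfl | h
    · exact hxw.ge
    · exact (hxF w' (Finset.mem_erase.2 ⟨h, hw'⟩)).le
  -- leave `K` through this point
  have hev1 : ∀ᶠ ε in 𝓝[<] (0 : ℝ), AffineMap.lineMap x w ε ∈ T.domain := by
    refine ((hcont x w).tendsto 0).eventually (mem_interior_iff_mem_nhds.1 ?_)
      |>.filter_mono nhdsWithin_le_nhds
    rwa [AffineMap.lineMap_apply_zero]
  -- Elements are closed and finite in number, so those that miss x also miss a neighbourhood of x.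
  have hev2 : ∀ᶠ ε in 𝓝[<] (0 : ℝ), ∀ K' ∈ T.elements,
      AffineMap.lineMap x w ε ∈ hull K' → x ∈ hull K' := by
    rw [Filter.eventually_all_finset]
    intro K' _
    by_cases hx : x ∈ hull K'
    · exact Eventually.of_forall fun _ _ => hx
    · have : ∀ᶠ ε in 𝓝 (0 : ℝ), AffineMap.lineMap x w ε ∈ (hull K')ᶜ :=
        ((hcont x w).tendsto 0).eventually ((isCompact_hull K').isClosed.isOpen_compl.eventually_mem
          (by rwa [AffineMap.lineMap_apply_zero]))
      filter_upwards [this.filter_mono nhdsWithin_le_nhds] with ε hε h using absurd h hε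
  obtain ⟨ε, ⟨h1, h2⟩, hε⟩ := ((hev1.and hev2).and self_mem_nhdsWithin).exists
  obtain ⟨K', hK', hεK'⟩ := Set.mem_iUnion₂.1 h1
  -- All vertices of the facet have positive coordinates at x, so conformity places them in K'.
  have hsub : K.erase w ⊆ K' := fun w' hw' =>
    mem_of_baryCoord_pos hKe hK' hxK (h2 K' hK' hεK') (hxF w' hw')
  refine ⟨K', Mesh.mem_patch hK' (hsub hvF), ?_, hsub⟩
  rintro rfl
  -- The point lies outside K because its w-coordinate is ε < 0; hence K' is another element.
  have h3 := (mem_hull_iff hKe _).1 hεK' w hw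
  rw [AffineMap.apply_lineMap, hxw, baryCoord_self hKe hw, AffineMap.lineMap_apply_module] at h3
  have : ε < 0 := hε
  simp at h3
  linarith

theorem vertex_sub_barycenter_mem {F : Finset (Space d)} {w : Space d} (hw : w ∈ F) :
    w - barycenter F ∈ vectorSpan ℝ (F : Set (Space d)) := by
  have hc : (F.card : ℝ) ≠ 0 := by exact_mod_cast (Finset.card_pos.2 ⟨w, hw⟩).ne'
  have h : w - barycenter F = (F.card : ℝ)⁻¹ • ∑ x ∈ F, (w - x) := by
    rw [Finset.sum_sub_distrib, Finset.sum_const, smul_sub, barycenter, ← Nat.cast_smul_eq_nsmul ℝ,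
      smul_smul, inv_mul_cancel₀ hc, one_smul]
  rw [h]
  exact Submodule.smul_mem _ _ (Submodule.sum_mem _ fun x hx => vsub_mem_vectorSpan ℝ hw hx)

/-- Expresses the vector that defines the normal through the vertex opposite the facet, which is
where two neighbours can be compared. -/
theorem barycenter_sub_barycenter (hK : K ∈ T.elements) (hd : 1 ≤ d) {w : Space d} (hw : w ∈ K) :
    barycenter (K.erase w) - barycenter K =
      (((d : ℝ) + 1)⁻¹) • (barycenter (K.erase w) - w) := by
  have hcard : (K.erase w).card = d := by rw [Finset.card_erase_of_mem hw, Mesh.card_element hK]; rfl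
  have hd0 : (d : ℝ) ≠ 0 := by positivity
  have hd1 : (d : ℝ) + 1 ≠ 0 := by positivity
  have hK' : barycenter K = ((d : ℝ) + 1)⁻¹ • ((d : ℝ) • barycenter (K.erase w) + w) := by
    rw [barycenter, barycenter, hcard, Mesh.card_element hK, smul_smul, mul_inv_cancel₀ hd0,
      one_smul, Finset.sum_erase_add _ _ hw]
    push_cast
    rfl
  rw [hK']
  match_scalars
  · field_simp
    ring
  · ring

/-- The outward normals of two elements on their common facet are opposite. -/
theorem outwardNormal_neg (hd : 1 ≤ d) (hK : K ∈ T.elements) (hK' : K' ∈ T.elements)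
    (hne : K ≠ K') {w : Space d} (hw : w ∈ K) (hF : K.erase w ⊆ K') :
    outwardNormal K' (K.erase w) = -outwardNormal K (K.erase w) := by
  obtain ⟨y, hy, hyF⟩ := exists_erase_eq hK hK' hw hF
  have hy' : y ∉ K.erase w := by rw [← hyF]; exact Finset.notMem_erase _ _
  set c := baryCoord hK w y with hc
  have hcneg : c < 0 :=
    baryCoord_neg hd hK hK' hw hF (notMem_of_erase_subset hK hK' hne hF) hy hy'
  set F := K.erase w with hFdef
  set P := (vectorSpan ℝ (F : Set (Space d)))ᗮ.starProjection with hP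
  -- Modulo the directions of the facet, y is c times w as seen from the facet. Orthogonal
  -- projection keeps the factor c < 0, and normalization leaves its sign.
  have hmem : (y - barycenter F) - c • (w - barycenter F) ∈ vectorSpan ℝ (F : Set (Space d)) := by
    have h1 : y - barycenter F = ∑ w' ∈ K, baryCoord hK w' y • (w' - barycenter F) := by
      simp only [smul_sub, Finset.sum_sub_distrib]
      rw [← Finset.sum_smul, sum_baryCoord, one_smul, sum_baryCoord_smul]
    rw [h1, ← Finset.sum_erase_add _ _ hw, add_sub_assoc, sub_self, add_zero]
    exact Submodule.sum_mem _ fun w' hw' => Submodule.smul_mem _ _ (vertex_sub_barycenter_mem hw')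
  have hproj : P (barycenter F - y) = c • P (barycenter F - w) := by
    have h2 : P ((y - barycenter F) - c • (w - barycenter F)) = 0 :=
      Submodule.starProjection_apply_eq_zero_iff _ |>.2 (Submodule.le_orthogonal_orthogonal _ hmem)
    rw [map_sub, map_smul, sub_eq_zero] at h2
    rw [← neg_sub y, ← neg_sub w, map_neg, map_neg, h2, smul_neg]
  have hd1 : (0 : ℝ) < ((d : ℝ) + 1)⁻¹ := by positivity
  have hn : P (barycenter F - barycenter K') = c • P (barycenter F - barycenter K) := by
    have h3 := barycenter_sub_barycenter hK' hd hy
    rw [hyF] at h3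
    rw [h3, barycenter_sub_barycenter hK hd hw, map_smul, map_smul, hproj, smul_comm]
  simp only [outwardNormal]
  rw [← hP, hn, norm_smul, Real.norm_of_nonpos hcneg.le, smul_smul, mul_inv, mul_comm, ← mul_assoc,
    ← neg_smul]
  congr 1
  rw [inv_neg]
  field_simp
  rw [← div_div, div_self hcneg.ne]

end Geometry

/-! ### Facets at an interior vertex and neighbouring elements -/

section Neighbours

open Classical

variable {d : ℕ} {T : Mesh d} {v : Space d}

/-- The facets that an element of the vertex patch of an interior vertex `v` shares with other
elements of the patch are its facets that contain `v`. -/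
theorem sum_neighbours (hd : 1 ≤ d) (hv : v ∈ interior T.domain) (K : ↥(T.patch v))
    (f : Finset (Space d) → ℝ) :
    (∑ K' : ↥(T.patch v), if K ≠ K' ∧ (K.1 ∩ K'.1).card = d then f (K.1 ∩ K'.1) else 0) =
      ∑ w ∈ K.1.erase v, f (K.1.erase w) := by
  have hKe := Mesh.mem_elements_of_mem_patch K.2
  rw [← Finset.sum_filter]
  have hsub : ∀ K' : ↥(T.patch v), (K.1 ∩ K'.1).card = d →
      ∃ w ∈ K.1, K.1 ∩ K'.1 = K.1.erase w := by
    intro K' hcard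
    obtain ⟨w, hw, hw'⟩ : ∃ w ∈ K.1, w ∉ K.1 ∩ K'.1 := by
      by_contra! h
      have := Finset.card_le_card (show K.1 ⊆ K.1 ∩ K'.1 from h)
      rw [Mesh.card_element hKe] at this
      omega
    refine ⟨w, hw, Finset.eq_of_subset_of_card_le (fun z hz => ?_) ?_⟩
    · exact Finset.mem_erase.2 ⟨by rintro rfl; exact hw' hz, Finset.inter_subset_left hz⟩
    · rw [Finset.card_erase_of_mem hw, Mesh.card_element hKe, hcard]; rfl
  symm
  -- A vertex w ≠ v is sent to the neighbour across the facet opposite w. The inverse picks the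
  -- vertex missing from the intersection, which is not v because both elements contain v;
  -- uniqueness of the neighbour makes the two maps inverse.
  refine Finset.sum_bij' (ι := Space d) (κ := ↥(T.patch v))
    (fun w hw => ⟨(exists_neighbour hv K.2 (Finset.mem_of_mem_erase hw)
      (Finset.ne_of_mem_erase hw)).choose, (exists_neighbour hv K.2 (Finset.mem_of_mem_erase hw)
      (Finset.ne_of_mem_erase hw)).choose_spec.1⟩)
    (fun K' hK' => (hsub K' (Finset.mem_filter.1 hK').2.2).choose) ?_ ?_ ?_ ?_ ?_
  · intro w hw
    obtain ⟨h1, h2, h3⟩ := (exists_neighbour hv K.2 (Finset.mem_of_mem_erase hw)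
      (Finset.ne_of_mem_erase hw)).choose_spec
    refine Finset.mem_filter.2 ⟨Finset.mem_univ _, fun h => h2 (congrArg Subtype.val h), ?_⟩
    rw [inter_eq_erase hKe (Mesh.mem_elements_of_mem_patch h1) h2 (Finset.mem_of_mem_erase hw) h3,
      Finset.card_erase_of_mem (Finset.mem_of_mem_erase hw), Mesh.card_element hKe]
    rfl
  · intro K' hK'
    obtain ⟨h1, h2⟩ := (hsub K' (Finset.mem_filter.1 hK').2.2).choose_spec
    refine Finset.mem_erase.2 ⟨fun h => ?_, h1⟩
    have hmem : v ∈ K.1 ∩ K'.1 :=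
      Finset.mem_inter.2 ⟨Mesh.mem_of_mem_patch K.2, Mesh.mem_of_mem_patch K'.2⟩
    rw [h2, h] at hmem
    exact Finset.notMem_erase _ _ hmem
  · intro w hw
    obtain ⟨h1, h2, h3⟩ := (exists_neighbour hv K.2 (Finset.mem_of_mem_erase hw)
      (Finset.ne_of_mem_erase hw)).choose_spec
    have h4 := inter_eq_erase hKe (Mesh.mem_elements_of_mem_patch h1) h2
      (Finset.mem_of_mem_erase hw) h3
    have hcard : (K.1.erase w).card = d := by
      rw [Finset.card_erase_of_mem (Finset.mem_of_mem_erase hw), Mesh.card_element hKe]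
      rfl
    obtain ⟨h5, h6⟩ := (hsub ⟨_, h1⟩ (by rw [h4, hcard])).choose_spec
    replace h6 := h4.symm.trans h6
    by_contra hne
    have : w ∈ K.1.erase ((hsub ⟨_, h1⟩ (by rw [h4, hcard])).choose) :=
      Finset.mem_erase.2 ⟨fun h => hne h.symm, Finset.mem_of_mem_erase hw⟩
    rw [← h6] at this
    exact Finset.notMem_erase _ _ this
  · intro K' hK'
    obtain ⟨h1, h2⟩ := (hsub K' (Finset.mem_filter.1 hK').2.2).choose_spec
    have hne : (hsub K' (Finset.mem_filter.1 hK').2.2).choose ≠ v := by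
      intro h
      have hmem : v ∈ K.1 ∩ K'.1 :=
        Finset.mem_inter.2 ⟨Mesh.mem_of_mem_patch K.2, Mesh.mem_of_mem_patch K'.2⟩
      rw [h2, h] at hmem
      exact Finset.notMem_erase _ _ hmem
    obtain ⟨h3, h4, h5⟩ := (exists_neighbour hv K.2 h1 hne).choose_spec
    refine Subtype.ext (eq_of_common_facet hd hKe (Mesh.mem_elements_of_mem_patch h3)
      (Mesh.mem_elements_of_mem_patch K'.2) h1 h4 ?_ h5 ?_)
    · exact fun h => (Finset.mem_filter.1 hK').2.1 (Subtype.ext h)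
    · rw [← h2]
      exact Finset.inter_subset_right
  · intro w hw
    obtain ⟨h1, h2, h3⟩ := (exists_neighbour hv K.2 (Finset.mem_of_mem_erase hw)
      (Finset.ne_of_mem_erase hw)).choose_spec
    rw [inter_eq_erase hKe (Mesh.mem_elements_of_mem_patch h1) h2 (Finset.mem_of_mem_erase hw) h3]

end Neighbours

/-! ### Slope and height of a tent -/

section Tents

open Filter Topology

variable {d : ℕ} {T : Mesh d} {v : Space d} {cmax : ℝ}

theorem gradient_apply {f : Space d → ℝ} {f' : Space d →L[ℝ] ℝ} {x : Space d}
    (hf : HasFDerivAt f f' x) (j : Fin d) : (∇ f x) j = f' (EuclideanSpace.single j 1) := by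
  have h := hf.hasGradientAt.gradient
  rw [h]
  have := InnerProductSpace.toDual_symm_apply (𝕜 := ℝ) (x := EuclideanSpace.single j 1) (y := f')
  rw [← this, EuclideanSpace.inner_single_right]
  simp

/-- The barycenter is interior to the element, so the gradient there sees only the affine piece. -/
theorem inner_elementGrad {K : Finset (Space d)} (hK : K ∈ T.elements) {φ : Space d → ℝ}
    {a : Space d →ᵃ[ℝ] ℝ} (ha : Set.EqOn φ a (hull K)) (y : Space d) :
    inner ℝ (elementGrad φ K) y = a.linear y := by
  have hev : φ =ᶠ[𝓝 (barycenter K)] a := by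
    filter_upwards [mem_interior_iff_mem_nhds.1 (barycenter_mem_interior_hull hK)] with x hx
      using ha hx
  have hd : HasFDerivAt φ (LinearMap.toContinuousLinearMap a.linear) (barycenter K) := by
    refine HasFDerivAt.congr_of_eventuallyEq ?_ hev
    have h : (a : Space d → ℝ) = fun x => LinearMap.toContinuousLinearMap a.linear x + a 0 := by
      ext x
      exact congrFun a.decomp x
    rw [h]
    exact (LinearMap.toContinuousLinearMap a.linear).hasFDerivAt.add_const _
  rw [elementGrad, hd.hasGradientAt.gradient, InnerProductSpace.toDual_symm_apply]
  rfl

theorem Tent.elementGrad_height (Θ : Tent T v cmax) {K : Finset (Space d)} (hK : K ∈ T.patch v) :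
    elementGrad Θ.height K = elementGrad Θ.top K - elementGrad Θ.bot K := by
  obtain ⟨a, ha⟩ := Θ.affine_top K hK
  obtain ⟨a', ha'⟩ := Θ.affine_bot K hK
  have hKe := Mesh.mem_elements_of_mem_patch hK
  have hh : Set.EqOn Θ.height (a - a' : Space d →ᵃ[ℝ] ℝ) (hull K) := fun x hx => by
    simp [Tent.height, ha hx, ha' hx]
  refine ext_inner_right ℝ fun y => ?_
  rw [inner_sub_left, inner_elementGrad hKe hh, inner_elementGrad hKe ha,
    inner_elementGrad hKe ha']
  rfl

/-- The intermediate front is a convex combination of bottom and top, and causality passes to convex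
combinations. -/
theorem Tent.norm_elementGrad_le (Θ : Tent T v cmax) {K : Finset (Space d)} (hK : K ∈ T.patch v)
    {t : ℝ} (h0 : 0 ≤ t) (h1 : t ≤ 1) :
    ‖elementGrad Θ.bot K + t • elementGrad Θ.height K‖ ≤ 1 / cmax := by
  have h : elementGrad Θ.bot K + t • elementGrad Θ.height K =
      (1 - t) • elementGrad Θ.bot K + t • elementGrad Θ.top K := by
    rw [Θ.elementGrad_height hK]; module
  rw [h]
  refine (norm_add_le _ _).trans ?_
  rw [norm_smul, norm_smul, Real.norm_of_nonneg h0, Real.norm_of_nonneg (sub_nonneg.2 h1)]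
  have := mul_le_mul_of_nonneg_left (Θ.causal_bot K hK).le (sub_nonneg.2 h1)
  have := mul_le_mul_of_nonneg_left (Θ.causal_top K hK).le h0
  linarith

theorem Tent.norm_elementGrad_height_le (Θ : Tent T v cmax) {K : Finset (Space d)}
    (hK : K ∈ T.patch v) : ‖elementGrad Θ.height K‖ ≤ 2 / cmax := by
  rw [Θ.elementGrad_height hK]
  refine (norm_sub_le _ _).trans ?_
  have := (Θ.causal_bot K hK).le
  have := (Θ.causal_top K hK).le
  calc _ ≤ 1 / cmax + 1 / cmax := by linarith
    _ = _ := by ring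

theorem Tent.exists_affine_height (Θ : Tent T v cmax) {K : Finset (Space d)}
    (hK : K ∈ T.patch v) : ∃ a : Space d →ᵃ[ℝ] ℝ, Set.EqOn Θ.height a (hull K) := by
  obtain ⟨a, ha⟩ := Θ.affine_top K hK
  obtain ⟨a', ha'⟩ := Θ.affine_bot K hK
  exact ⟨a - a', fun x hx => by simp [Tent.height, ha hx, ha' hx]⟩

theorem Tent.exists_height_eq (Θ : Tent T v cmax) {K : Finset (Space d)} (hK : K ∈ T.patch v) :
    ∃ a₀ : ℝ, ∀ x ∈ hull K, Θ.height x = inner ℝ (elementGrad Θ.height K) x + a₀ := by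
  obtain ⟨a, ha⟩ := Θ.exists_affine_height hK
  refine ⟨a 0, fun x hx => ?_⟩
  rw [inner_elementGrad (Mesh.mem_elements_of_mem_patch hK) ha, ha hx, a.decomp']
  simp

theorem Tent.height_nonneg (Θ : Tent T v cmax) {K : Finset (Space d)} (hK : K ∈ T.patch v)
    {x : Space d} (hx : x ∈ hull K) : 0 ≤ Θ.height x := by
  obtain ⟨a, ha⟩ := Θ.exists_affine_height hK
  rw [ha hx]
  refine affineMap_nonneg_of_mem_hull (fun w hw => ?_) hx
  rw [← ha (subset_convexHull ℝ _ hw), Tent.height, sub_nonneg]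
  rcases eq_or_ne w v with rfl | h
  · exact Θ.pole
  · exact (Θ.eq_of_ne K hK w hw h).ge

open Classical in
-- Removes the facets opposite the pole, which have no neighbour in the patch, from the integration
-- by parts.
theorem Tent.height_eq_zero (Θ : Tent T v cmax) {K : Finset (Space d)} (hK : K ∈ T.patch v)
    {x : Space d} (hx : x ∈ hull (K.erase v)) : Θ.height x = 0 := by
  obtain ⟨a, ha⟩ := Θ.exists_affine_height hK
  have hsub : hull (K.erase v) ⊆ hull K :=
    convexHull_mono (by exact_mod_cast Finset.erase_subset _ _)
  rw [ha (hsub hx)]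
  refine affineMap_eq_zero_of_mem_hull (fun w hw => ?_) hx
  rw [← ha (subset_convexHull ℝ _ (Finset.mem_of_mem_erase hw)), Tent.height, sub_eq_zero]
  exact Θ.eq_of_ne K hK w (Finset.mem_of_mem_erase hw) (Finset.ne_of_mem_erase hw)

/-- The height of a tent is bounded by the diameter of the elements. -/
theorem Tent.height_le (hd : 1 ≤ d) (Θ : Tent T v cmax) {K : Finset (Space d)}
    (hK : K ∈ T.patch v) {D : ℝ} (hD : ∀ x ∈ hull K, ∀ y ∈ hull K, dist x y ≤ D) {x : Space d}
    (hx : x ∈ hull K) : Θ.height x ≤ 2 / cmax * D := by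
  classical
  have hcard := Mesh.card_element (Mesh.mem_elements_of_mem_patch hK)
  -- As d ≥ 1, there is a vertex other than the pole. The height is zero there, so its gradient
  -- bound gives a bound for the height.
  obtain ⟨w, hw, hwv⟩ := Finset.exists_mem_ne (s := K) (by omega) v
  have hwh : w ∈ hull K := subset_convexHull ℝ _ hw
  have h0 : Θ.height w = 0 := by
    rw [Tent.height, sub_eq_zero]
    exact Θ.eq_of_ne K hK w hw hwv
  obtain ⟨a₀, ha⟩ := Θ.exists_height_eq hK
  have h1 : Θ.height x = inner ℝ (elementGrad Θ.height K) (x - w) := by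
    rw [← sub_zero (Θ.height x), ← h0, ha x hx, ha w hwh, inner_sub_right]
    ring
  rw [h1]
  refine (real_inner_le_norm _ _).trans ?_
  have hg := Θ.norm_elementGrad_height_le hK
  refine mul_le_mul hg ?_ (norm_nonneg _) ((norm_nonneg _).trans hg)
  rw [← dist_eq_norm]
  exact hD x hx w hwh

end Tents

/-! ### Normal fluxes and spacelike surfaces -/

section Fluxes

variable {d b : ℕ} {L : Fin d → Space d → Matrix (Fin b) (Fin b) ℝ}

theorem normalFlux_smul (r : ℝ) (ν x : Space d) :
    normalFlux L (r • ν) x = r • normalFlux L ν x := by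
  simp [normalFlux, Finset.smul_sum, smul_smul]

theorem normalFlux_add (ν ν' x : Space d) :
    normalFlux L (ν + ν') x = normalFlux L ν x + normalFlux L ν' x := by
  simp [normalFlux, add_smul, Finset.sum_add_distrib]

theorem normalFlux_neg (ν x : Space d) : normalFlux L (-ν) x = -normalFlux L ν x := by
  simp [normalFlux]

theorem normalFlux_isSymm {x : Space d} (h : ∀ j, (L j x).IsSymm) (ν : Space d) :
    (normalFlux L ν x).IsSymm := by
  rw [Matrix.IsSymm, normalFlux, Matrix.transpose_sum]
  exact Finset.sum_congr rfl fun j _ => by rw [Matrix.transpose_smul, (h j).eq]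

theorem abs_normalFlux_le {x : Space d} {Λ : ℝ} (h : ∀ j l k, |L j x l k| ≤ Λ) (ν : Space d)
    (l k : Fin b) : |normalFlux L ν x l k| ≤ d * ‖ν‖ * Λ := by
  simp only [normalFlux, Matrix.sum_apply, Matrix.smul_apply, smul_eq_mul]
  refine (Finset.abs_sum_le_sum_abs _ _).trans ?_
  refine (Finset.sum_le_card_nsmul _ _ (‖ν‖ * Λ) fun j _ => ?_).trans (le_of_eq ?_)
  · rw [abs_mul]
    exact mul_le_mul (PiLp.norm_apply_le ν j) (h j l k) (abs_nonneg _) (norm_nonneg _)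
  · simp; ring

theorem norm_outwardNormal_le (K F : Finset (Space d)) : ‖outwardNormal K F‖ ≤ 1 := by
  simp only [outwardNormal]
  rw [norm_smul, norm_inv, norm_norm]
  exact inv_mul_le_one

theorem measurableSet_domain (T : Mesh d) : MeasurableSet T.domain :=
  Finset.measurableSet_biUnion _ fun K _ => (isCompact_hull K).measurableSet

/-- The mass density is bounded below on spacelike surfaces. -/
theorem HyperbolicSystem.ae_coercive {T : Mesh d} {g₀ Λ c cmax : ℝ}
    (Q : HyperbolicSystem d b T.domain g₀ Λ c) (hg₀ : 0 < g₀) (hc : 0 ≤ c) (hcmax : c < cmax) :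
    ∀ᵐ x ∂(volume.restrict T.domain), ∀ g : Space d, ‖g‖ ≤ 1 / cmax → ∀ ξ : Fin b → ℝ,
      (1 - c / cmax) * g₀ * (ξ ⬝ᵥ ξ) ≤ (Q.G x - normalFlux Q.L g x).mulVec ξ ⬝ᵥ ξ := by
  have hcm : 0 < cmax := hc.trans_lt hcmax
  have hratio : 0 < 1 - c / cmax := by rw [sub_pos, div_lt_one hcm]; exact hcmax
  filter_upwards [Q.posDef_G, Q.waveSpeed_le, ae_restrict_mem (measurableSet_domain T)]
    with x hpos hwave hx g hg ξ
  have hGξ := hpos ξ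
  have hξ : 0 ≤ ξ ⬝ᵥ ξ := Finset.sum_nonneg fun _ _ => mul_self_nonneg _
  have hG0 : 0 ≤ (Q.G x).mulVec ξ ⬝ᵥ ξ := (mul_nonneg hg₀.le hξ).trans hGξ
  have hflux : (normalFlux Q.L g x).mulVec ξ ⬝ᵥ ξ ≤ c / cmax * ((Q.G x).mulVec ξ ⬝ᵥ ξ) := by
    rcases eq_or_ne g 0 with rfl | hg0
    · have : normalFlux Q.L 0 x = 0 := by simp [normalFlux]
      rw [this, Matrix.zero_mulVec, zero_dotProduct]
      positivity
    · have hgn : 0 < ‖g‖ := norm_pos_iff.2 hg0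
      set ν := ‖g‖⁻¹ • g with hν
      have hν1 : ‖ν‖ = 1 := by
        rw [hν, norm_smul, norm_inv, norm_norm, inv_mul_cancel₀ hgn.ne']
      have hgν : g = ‖g‖ • ν := by rw [hν, smul_smul, mul_inv_cancel₀ hgn.ne', one_smul]
      -- The wave speed bound is for unit normals; linearity of the flux in the normal reinserts the
      -- length of g, at most 1/cmax.
      have h := quadratic_le_of_eigenvalue_le (Q.symm_G x hx)
        (normalFlux_isSymm (fun j => Q.symm_L j x hx) ν) hg₀ hpos
        (fun lam η hη he => (le_abs_self lam).trans (hwave ν hν1 lam η hη he)) ξ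
      rw [hgν, normalFlux_smul, Matrix.smul_mulVec, smul_dotProduct, smul_eq_mul]
      calc _ ≤ ‖g‖ * (c * ((Q.G x).mulVec ξ ⬝ᵥ ξ)) := mul_le_mul_of_nonneg_left h hgn.le
        _ ≤ 1 / cmax * (c * ((Q.G x).mulVec ξ ⬝ᵥ ξ)) := by gcongr
        _ = _ := by ring
  rw [Matrix.sub_mulVec, sub_dotProduct]
  have := mul_le_mul_of_nonneg_left hGξ hratio.le
  linarith

end Fluxes

/-! ### The mass operator at a pseudotime -/

section MassOperator

variable {d : ℕ} {T : Mesh d} {v : Space d} {b p : ℕ} {g₀ Λ c cmax : ℝ}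

theorem massForm_apply (Q : HyperbolicSystem d b T.domain g₀ Λ c) (Θ : Tent T v cmax)
    (u w : DGSpace T v b p) : massForm Q Θ u w = ∑ K : ↥(T.patch v), ∫ x in hull K.1,
      (Q.G x - normalFlux Q.L (elementGrad Θ.bot K) x).mulVec (val K x u) ⬝ᵥ val K x w := by
  simp [massForm, integralForm]

theorem massSlopeForm_apply (Q : HyperbolicSystem d b T.domain g₀ Λ c) (Θ : Tent T v cmax)
    (u w : DGSpace T v b p) : massSlopeForm Q Θ u w = ∑ K : ↥(T.patch v), ∫ x in hull K.1,
      (normalFlux Q.L (elementGrad Θ.height K) x).mulVec (val K x u) ⬝ᵥ val K x w := by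
  simp [massSlopeForm, integralForm]

theorem l2Form_symm (u w : DGSpace T v b p) : l2Form u w = l2Form w u := by
  rw [l2Form_apply, l2Form_apply]
  simp only [dotProduct_comm]

theorem massForm_symm (Q : HyperbolicSystem d b T.domain g₀ Λ c) (Θ : Tent T v cmax)
    (u w : DGSpace T v b p) : massForm Q Θ u w = massForm Q Θ w u := by
  rw [massForm_apply, massForm_apply]
  refine Finset.sum_congr rfl fun K _ => setIntegral_congr_fun (isCompact_hull _).measurableSet
    fun x hx => ?_
  have hx' := subset_domain_of_mem_patch K.2 hx
  exact mulVec_dotProduct_comm ((Q.symm_G x hx').sub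
    (normalFlux_isSymm (fun j => Q.symm_L j x hx') _)) _ _

theorem massSlopeForm_symm (Q : HyperbolicSystem d b T.domain g₀ Λ c) (Θ : Tent T v cmax)
    (u w : DGSpace T v b p) : massSlopeForm Q Θ u w = massSlopeForm Q Θ w u := by
  rw [massSlopeForm_apply, massSlopeForm_apply]
  refine Finset.sum_congr rfl fun K _ => setIntegral_congr_fun (isCompact_hull _).measurableSet
    fun x hx => ?_
  have hx' := subset_domain_of_mem_patch K.2 hx
  exact mulVec_dotProduct_comm (normalFlux_isSymm (fun j => Q.symm_L j x hx') _) _ _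

theorem l2Form_massOp (Q : HyperbolicSystem d b T.domain g₀ Λ c) (Θ : Tent T v cmax) (t : ℝ)
    (u w : DGSpace T v b p) :
    l2Form (massOp Q Θ p t u) w = massForm Q Θ u w - t * massSlopeForm Q Θ u w := by
  simp [massOp, l2Form_opOf]

theorem l2Form_massOp_symm (Q : HyperbolicSystem d b T.domain g₀ Λ c) (Θ : Tent T v cmax)
    (t : ℝ) (u w : DGSpace T v b p) :
    l2Form (massOp Q Θ p t u) w = l2Form u (massOp Q Θ p t w) := by
  rw [l2Form_symm u, l2Form_massOp, l2Form_massOp, massForm_symm, massSlopeForm_symm]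

/-- The integrand of M(t) is G minus the flux in the direction of the gradient of the front at
pseudotime t, so the pointwise bound on spacelike surfaces is integrated. -/
theorem massOp_coercive (Q : HyperbolicSystem d b T.domain g₀ Λ c) (Θ : Tent T v cmax)
    (hg₀ : 0 < g₀) (hc : 0 ≤ c) (hcmax : c < cmax) {t : ℝ} (h0 : 0 ≤ t) (h1 : t ≤ 1)
    (u : DGSpace T v b p) :
    (1 - c / cmax) * g₀ * l2Form u u ≤ l2Form (massOp Q Θ p t u) u := by
  rw [l2Form_massOp, massForm_apply, massSlopeForm_apply, l2Form_apply, Finset.mul_sum,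
    Finset.mul_sum, ← Finset.sum_sub_distrib]
  refine Finset.sum_le_sum fun K _ => ?_
  have hsub := subset_domain_of_mem_patch K.2
  have hflux : ∀ g : Space d, IntegrableOn
      (fun x => (normalFlux Q.L g x).mulVec (val K x u) ⬝ᵥ val K x u) (hull K.1) := fun g =>
    BddMeas.integrableOn (isCompact_hull _).measurableSet (volume_hull_ne_top _)
      (bddMeas_bilin (bddMeas_normalFlux Q hsub _ _) (bddMeas_val K K _ u) (bddMeas_val K K _ u))
  have hG : IntegrableOn (fun x => (Q.G x).mulVec (val K x u) ⬝ᵥ val K x u) (hull K.1) :=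
    BddMeas.integrableOn (isCompact_hull _).measurableSet (volume_hull_ne_top _)
      (bddMeas_bilin (fun l k => bddMeas_coeff hsub (Q.measurable_G l k)
        (fun x hx => Q.bound_G x hx l k) _) (bddMeas_val K K _ u) (bddMeas_val K K _ u))
  have hu : IntegrableOn (fun x => val K x u ⬝ᵥ val K x u) (hull K.1) :=
    BddMeas.integrableOn (isCompact_hull _).measurableSet (volume_hull_ne_top _)
      (.sum _ fun k _ => (bddMeas_val K K _ u k).mul (bddMeas_val K K _ u k))
  have hM : IntegrableOn (fun x => (Q.G x).mulVec (val K x u) ⬝ᵥ val K x u -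
      (normalFlux Q.L (elementGrad Θ.bot K) x).mulVec (val K x u) ⬝ᵥ val K x u) (hull K.1) :=
    hG.sub (hflux _)
  simp only [Matrix.sub_mulVec, sub_dotProduct]
  rw [← integral_const_mul, ← integral_const_mul, ← integral_sub hM ((hflux _).const_mul t)]
  refine integral_mono_ae (hu.const_mul _) (hM.sub ((hflux _).const_mul t)) ?_
  filter_upwards [ae_restrict_of_ae_restrict_of_subset hsub (Q.ae_coercive hg₀ hc hcmax)]
    with x hx
  have h := hx _ (Θ.norm_elementGrad_le K.2 h0 h1) (val K x u)
  rw [normalFlux_add, normalFlux_smul, Matrix.sub_mulVec, Matrix.add_mulVec, Matrix.smul_mulVec,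
    sub_dotProduct, add_dotProduct, smul_dotProduct, smul_eq_mul] at h
  linarith

theorem massOp_isPosDefOp (Q : HyperbolicSystem d b T.domain g₀ Λ c) (Θ : Tent T v cmax)
    (hg₀ : 0 < g₀) (hc : 0 ≤ c) (hcmax : c < cmax) {t : ℝ} (h0 : 0 ≤ t) (h1 : t ≤ 1) :
    IsPosDefOp (massOp Q Θ p t) := by
  refine ⟨l2Form_massOp_symm Q Θ t, fun u hu => ?_⟩
  have hratio : 0 < 1 - c / cmax := by
    rw [sub_pos, div_lt_one (hc.trans_lt hcmax)]; exact hcmax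
  have hpos : 0 < l2Form u u := lt_of_le_of_ne (l2Form_self_nonneg u)
    fun h => hu (eq_zero_of_l2Form_self u h.symm)
  exact (mul_pos (mul_pos hratio hg₀) hpos).trans_le (massOp_coercive Q Θ hg₀ hc hcmax h0 h1 u)

end MassOperator

/-! ### Mesh-independent bounds for the forms -/

section Bounds

variable {d : ℕ} {T : Mesh d} {v : Space d} {b p : ℕ}

/-- The square of the `L²` norm on an element. -/
noncomputable def elementSq (K : ↥(T.patch v)) (u : DGSpace T v b p) : ℝ :=
  ∫ x in hull K.1, val K x u ⬝ᵥ val K x u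

theorem elementSq_nonneg (K : ↥(T.patch v)) (u : DGSpace T v b p) : 0 ≤ elementSq K u :=
  integral_nonneg fun _ => Finset.sum_nonneg fun _ _ => mul_self_nonneg _

theorem l2Form_self (u : DGSpace T v b p) : l2Form u u = ∑ K : ↥(T.patch v), elementSq K u :=
  l2Form_apply u u

theorem integral_component_le_elementSq (K : ↥(T.patch v)) (u : DGSpace T v b p) (k : Fin b) :
    ∫ x in hull K.1, val K x u k * val K x u k ≤ elementSq K u := by
  have hc : ∀ k, Continuous fun x => val K x u k * val K x u k := fun k =>
    (continuous_val K u k).mul (continuous_val K u k)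
  refine integral_mono ((hc k).continuousOn.integrableOn_compact (isCompact_hull _))
    ((continuous_finsetSum _ fun k _ => hc k).continuousOn.integrableOn_compact
      (isCompact_hull _)) fun x => ?_
  exact Finset.single_le_sum (f := fun k => val K x u k * val K x u k)
    (fun _ _ => mul_self_nonneg _) (Finset.mem_univ k)

/-- The geometric quantities of an element of size `r`, and the inverse estimates on it. -/
structure ElementBounds (C r : ℝ) (b p : ℕ) (K : ↥(T.patch v)) : Prop where
  r_pos : 0 < r
  dist_le : ∀ x ∈ hull K.1, ∀ y ∈ hull K.1, dist x y ≤ C * r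
  volume_le : volume.real (hull K.1) ≤ C * r ^ d
  facet_le : ∀ F ⊆ K.1, F.card = d →
    (μHE[d - 1] : Measure (Space d)).real (hull F) ≤ C * r ^ (d - 1)
  val_sq_le : ∀ (u : DGSpace T v b p), ∀ x ∈ hull K.1, ∀ k,
    |val K x u k| ≤ √(C * (r ^ d)⁻¹ * elementSq K u)
  pderiv_sq_le : ∀ (u : DGSpace T v b p), ∀ x ∈ hull K.1, ∀ j k,
    r * |pderivVal K j x u k| ≤ √(C * (r ^ d)⁻¹ * elementSq K u)

/-- Shape regularity encloses each element between concentric balls of radii r and σ r, which makes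
the inverse and measure estimates uniform. -/
theorem exists_elementBounds (d b p : ℕ) (hd : 1 ≤ d) (σ : ℝ) : ∃ C : ℝ, 0 ≤ C ∧
    ∀ (T : Mesh d), T.ShapeRegular σ → ∀ (v : Space d) (K : ↥(T.patch v)),
      ∃ r, ElementBounds C r b p K := by
  obtain ⟨C₁, hC₁, h₁⟩ := exists_volume_closedBall_le d
  obtain ⟨C₂, hC₂, h₂⟩ := exists_facet_measure_le d hd
  obtain ⟨C₃, hC₃, h₃⟩ := exists_inverse_estimate d p σ
  have hA : 0 ≤ C₁ * |σ| ^ d := by positivity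
  have hB : 0 ≤ C₂ * |σ| ^ (d - 1) := by positivity
  -- The absolute value keeps the constant nonnegative for every σ; once an element exists, σ ≥ 0
  -- and |σ| = σ.
  refine ⟨|σ| + C₁ * |σ| ^ d + C₂ * |σ| ^ (d - 1) + C₃, by positivity, ?_⟩
  set C := |σ| + C₁ * |σ| ^ d + C₂ * |σ| ^ (d - 1) + C₃
  have hσ0 := abs_nonneg σ
  intro T hT v K
  obtain ⟨x₀, r, hr, hball, hdiam⟩ := hT K.1 (Mesh.mem_elements_of_mem_patch K.2)
  have hdist : ∀ x ∈ hull K.1, ∀ y ∈ hull K.1, dist x y ≤ σ * r := fun x hx y hy =>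
    (Metric.dist_le_diam_of_mem (isCompact_hull _).isBounded hx hy).trans hdiam
  have hσr : 0 ≤ σ * r := Metric.diam_nonneg.trans hdiam
  have hσ : |σ| = σ := abs_of_nonneg (nonneg_of_mul_nonneg_left hσr hr)
  have hx₀ : x₀ ∈ hull K.1 := hball (Metric.mem_closedBall_self hr.le)
  have hout : hull K.1 ⊆ Metric.closedBall x₀ (σ * r) := fun x hx =>
    Metric.mem_closedBall.2 (hdist x hx x₀ hx₀)
  have hinv : ∀ (u : DGSpace T v b p) (k : Fin b) {y : ℝ},
      y ^ 2 ≤ C₃ * (r ^ d)⁻¹ * (∫ x in hull K.1, val K x u k * val K x u k) →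
      |y| ≤ √(C * (r ^ d)⁻¹ * elementSq K u) := by
    intro u k y hy
    refine Real.abs_le_sqrt (hy.trans ?_)
    have h := integral_component_le_elementSq K u k
    have h0 : 0 ≤ elementSq K u := elementSq_nonneg K u
    have hCC : C₃ ≤ C := by simp only [C]; linarith
    have hI : 0 ≤ ∫ x in hull K.1, val K x u k * val K x u k :=
      integral_nonneg fun _ => mul_self_nonneg _
    gcongr
  refine ⟨r, hr, fun x hx y hy => (hdist x hx y hy).trans ?_, ?_, fun F hF hcard => ?_,
    fun u x hx k => ?_, fun u x hx j k => ?_⟩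
  · refine mul_le_mul_of_nonneg_right ?_ hr.le
    rw [← hσ]
    simp only [C]
    linarith
  · refine (h₁ x₀ (σ * r) hσr _ hout).trans ?_
    rw [mul_pow, ← mul_assoc]
    refine mul_le_mul_of_nonneg_right ?_ (by positivity)
    rw [← hσ]
    simp only [C]
    linarith
  · refine (h₂ F hcard (σ * r) fun x hx y hy => hdist x (subset_convexHull ℝ _ (hF hx)) y
      (subset_convexHull ℝ _ (hF hy))).trans ?_
    rw [mul_pow, ← mul_assoc]
    refine mul_le_mul_of_nonneg_right ?_ (by positivity)
    rw [← hσ]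
    simp only [C]
    linarith
  · exact hinv u k (h₃ _ (u K k).2 x₀ r hr _ (isCompact_hull _) hball hout x hx).1
  · have h := hinv u k ((h₃ _ (u K k).2 x₀ r hr _ (isCompact_hull _) hball hout x hx).2 j)
    rwa [abs_mul, abs_of_pos hr] at h

theorem abs_setIntegral_le {μ : Measure (Space d)} {s : Set (Space d)}
    (hμ : μ s ≠ ⊤) {f : Space d → ℝ} {B m : ℝ} (hB : 0 ≤ B) (hf : ∀ x ∈ s, |f x| ≤ B)
    (hm : μ.real s ≤ m) : |∫ x in s, f x ∂μ| ≤ B * m := by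
  have h := norm_setIntegral_le_of_norm_le_const (μ := μ) (s := s) (f := f) (C := B)
    hμ.lt_top (fun x hx => hf x hx)
  exact h.trans (mul_le_mul_of_nonneg_left hm hB)

theorem sqrt_mul_sqrt_le {a b : ℝ} (ha : 0 ≤ a) (hb : 0 ≤ b) : √a * √b ≤ a + b := by
  nlinarith [Real.sq_sqrt ha, Real.sq_sqrt hb, sq_nonneg (√a - √b), sq_nonneg (√a), sq_nonneg (√b)]

variable {g₀ Λ c cmax : ℝ}

/-- Two pointwise bounds of order r^(-d/2) meet a volume of order r^d, so no power of r remains. -/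
theorem abs_massSlope_element_le (Q : HyperbolicSystem d b T.domain g₀ Λ c) (Θ : Tent T v cmax)
    (hcmax : 0 < cmax) {C r : ℝ} (hC : 0 ≤ C) {K : ↥(T.patch v)} (hK : ElementBounds C r b p K)
    (u w : DGSpace T v b p) :
    |∫ x in hull K.1,
      (normalFlux Q.L (elementGrad Θ.height K) x).mulVec (val K x u) ⬝ᵥ val K x w| ≤
      (b : ℝ) ^ 2 * (d * (2 / cmax) * |Λ|) * C ^ 2 * (elementSq K u + elementSq K w) := by
  have hr := hK.r_pos
  have hu := elementSq_nonneg K u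
  have hw := elementSq_nonneg K w
  set P := √(C * (r ^ d)⁻¹ * elementSq K u)
  set R := √(C * (r ^ d)⁻¹ * elementSq K w)
  have hPR : P * R ≤ C * (r ^ d)⁻¹ * elementSq K u + C * (r ^ d)⁻¹ * elementSq K w :=
    sqrt_mul_sqrt_le (by positivity) (by positivity)
  have hpt : ∀ x ∈ hull K.1,
      |(normalFlux Q.L (elementGrad Θ.height K) x).mulVec (val K x u) ⬝ᵥ val K x w| ≤
      (b : ℝ) ^ 2 * (d * (2 / cmax) * |Λ|) * P * R := fun x hx =>
    abs_bilin_le (fun l k => (abs_normalFlux_le (fun j l k => (Q.bound_L j x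
      (subset_domain_of_mem_patch K.2 hx) l k).trans (le_abs_self Λ)) _ l k).trans (by
        gcongr
        exact Θ.norm_elementGrad_height_le K.2))
      (hK.val_sq_le u x hx) (hK.val_sq_le w x hx)
  refine (abs_setIntegral_le (volume_hull_ne_top _)
    (by positivity) hpt hK.volume_le).trans ?_
  calc _ = (b : ℝ) ^ 2 * (d * (2 / cmax) * |Λ|) * (C * r ^ d) * (P * R) := by ring
    _ ≤ (b : ℝ) ^ 2 * (d * (2 / cmax) * |Λ|) * (C * r ^ d) *
        (C * (r ^ d)⁻¹ * elementSq K u + C * (r ^ d)⁻¹ * elementSq K w) := by gcongr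
    _ = _ := by field_simp

/-- The height, of order r, cancels the r⁻¹ of the inverse estimate for the derivative. -/
theorem abs_volume_element_le (hd : 1 ≤ d) (Q : HyperbolicSystem d b T.domain g₀ Λ c)
    (Θ : Tent T v cmax) (hcmax : 0 < cmax) {C r : ℝ} (hC : 0 ≤ C) {K : ↥(T.patch v)}
    (hK : ElementBounds C r b p K) (u w : DGSpace T v b p) :
    |∫ x in hull K.1,
      Θ.height x * ∑ j, (Q.L j x).mulVec (val K x u) ⬝ᵥ pderivVal K j x w| ≤
      (2 / cmax) * d * (b : ℝ) ^ 2 * |Λ| * C ^ 3 * (elementSq K u + elementSq K w) := by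
  have hr := hK.r_pos
  have hu := elementSq_nonneg K u
  have hw := elementSq_nonneg K w
  set P := √(C * (r ^ d)⁻¹ * elementSq K u)
  set R := √(C * (r ^ d)⁻¹ * elementSq K w)
  have hPR : P * R ≤ C * (r ^ d)⁻¹ * elementSq K u + C * (r ^ d)⁻¹ * elementSq K w :=
    sqrt_mul_sqrt_le (by positivity) (by positivity)
  have hpt : ∀ x ∈ hull K.1,
      |Θ.height x * ∑ j, (Q.L j x).mulVec (val K x u) ⬝ᵥ pderivVal K j x w| ≤
      (2 / cmax * (C * r)) * (d * ((b : ℝ) ^ 2 * |Λ| * P * (R / r))) := by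
    intro x hx
    rw [abs_mul, abs_of_nonneg (Θ.height_nonneg K.2 hx)]
    refine mul_le_mul (Θ.height_le hd K.2 hK.dist_le hx) ?_ (abs_nonneg _) (by positivity)
    refine (Finset.abs_sum_le_sum_abs _ _).trans ?_
    refine (Finset.sum_le_card_nsmul _ _ ((b : ℝ) ^ 2 * |Λ| * P * (R / r)) fun j _ => ?_).trans
      (by simp)
    refine abs_bilin_le (fun l k => (Q.bound_L j x
      (subset_domain_of_mem_patch K.2 hx) l k).trans (le_abs_self Λ)) (hK.val_sq_le u x hx)
      fun k => ?_
    rw [le_div_iff₀ hr, mul_comm]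
    exact hK.pderiv_sq_le w x hx j k
  refine (abs_setIntegral_le (volume_hull_ne_top _)
    (by positivity) hpt hK.volume_le).trans ?_
  calc _ = (2 / cmax) * d * (b : ℝ) ^ 2 * |Λ| * C ^ 2 * r ^ d * (P * R) := by
        field_simp
    _ ≤ (2 / cmax) * d * (b : ℝ) ^ 2 * |Λ| * C ^ 2 * r ^ d *
        (C * (r ^ d)⁻¹ * elementSq K u + C * (r ^ d)⁻¹ * elementSq K w) := by gcongr
    _ = _ := by field_simp

theorem facetForm_apply (Q : HyperbolicSystem d b T.domain g₀ Λ c) (Θ : Tent T v cmax)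
    (S : Matrix (Fin b) (Fin b) ℝ) (K K' : ↥(T.patch v)) (F : Finset (Space d))
    (hF : F ⊆ K.1) (hcard : F.card = d) (u w : DGSpace T v b p) :
    facetForm Q Θ S K K' F hF hcard u w = ∫ x in hull F, Θ.height x *
      (((normalFlux Q.L (outwardNormal K.1 F) x).mulVec ((1 / 2 : ℝ) • (val K' x u + val K x u))
        - S.mulVec (val K' x u - val K x u)) ⬝ᵥ (val K' x w - val K x w)) ∂μHE[d - 1] :=
  rfl

/-- A weight of the size of the mesh compensates the inverse estimate on a facet. -/
theorem facet_weight_le (hd : 1 ≤ d) {C r h m N : ℝ} (hr : 0 < r) (hC : 0 ≤ C) (hN : 0 ≤ N)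
    (hm0 : 0 ≤ m) {κ : ℝ} (hh : h ≤ κ * (C * r)) (hκ : 0 ≤ κ) (hm : m ≤ C * r ^ (d - 1)) :
    h * (C * (r ^ d)⁻¹ * N) * m ≤ κ * C ^ 3 * N := by
  have hrd : r ^ d = r * r ^ (d - 1) := by
    rw [← pow_succ']; congr 1; omega
  calc _ ≤ κ * (C * r) * (C * (r ^ d)⁻¹ * N) * (C * r ^ (d - 1)) := by gcongr
    _ = _ := by rw [hrd]; field_simp

/-- The sizes r and r' of the two elements are not compared. The height and the facet measure are
bounded in terms of either size, so each squared trace is paired with the size of its own element.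
-/
theorem abs_facetForm_le (hd : 1 ≤ d) (Q : HyperbolicSystem d b T.domain g₀ Λ c)
    (Θ : Tent T v cmax) (hcmax : 0 < cmax) (S : Matrix (Fin b) (Fin b) ℝ) {κS : ℝ} (hS0 : 0 ≤ κS)
    (hSb : ∀ l k, |S l k| ≤ κS) {C r r' : ℝ} (hC : 0 ≤ C) {K K' : ↥(T.patch v)}
    (hK : ElementBounds C r b p K) (hK' : ElementBounds C r' b p K') (F : Finset (Space d))
    (hF : F ⊆ K.1) (hF' : F ⊆ K'.1) (hcard : F.card = d) (u w : DGSpace T v b p) :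
    |facetForm Q Θ S K K' F hF hcard u w| ≤ (b : ℝ) ^ 2 * (d * |Λ| + κS) * (2 / cmax) * C ^ 3 *
      ((elementSq K u + elementSq K w) + (elementSq K' u + elementSq K' w)) := by
  have hr := hK.r_pos
  have hr' := hK'.r_pos
  have hu := elementSq_nonneg K u
  have hw := elementSq_nonneg K w
  have hu' := elementSq_nonneg K' u
  have hw' := elementSq_nonneg K' w
  have hsub : hull F ⊆ hull K.1 := convexHull_mono (by exact_mod_cast hF)
  have hsub' : hull F ⊆ hull K'.1 := convexHull_mono (by exact_mod_cast hF')
  set N := C * (r ^ d)⁻¹ * elementSq K u with hN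
  set M := C * (r ^ d)⁻¹ * elementSq K w with hM
  set N' := C * (r' ^ d)⁻¹ * elementSq K' u with hN'
  set M' := C * (r' ^ d)⁻¹ * elementSq K' w with hM'
  have hN0 : 0 ≤ N := by positivity
  have hM0 : 0 ≤ M := by positivity
  have hN'0 : 0 ≤ N' := by positivity
  have hM'0 : 0 ≤ M' := by positivity
  set m := (μHE[d - 1] : Measure (Space d)).real (hull F)
  have hm0 : 0 ≤ m := measureReal_nonneg
  -- the height on the facet
  obtain ⟨h, hh0, hheight, hh1, hh2⟩ : ∃ h, 0 ≤ h ∧ (∀ x ∈ hull F, Θ.height x ≤ h) ∧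
      h ≤ 2 / cmax * (C * r) ∧ h ≤ 2 / cmax * (C * r') :=
    ⟨min (2 / cmax * (C * r)) (2 / cmax * (C * r')), by positivity, fun x hx => le_min
      (Θ.height_le hd K.2 hK.dist_le (hsub hx)) (Θ.height_le hd K'.2 hK'.dist_le (hsub' hx)),
      min_le_left _ _, min_le_right _ _⟩
  have hpt : ∀ x ∈ hull F, |Θ.height x *
      (((normalFlux Q.L (outwardNormal K.1 F) x).mulVec ((1 / 2 : ℝ) • (val K' x u + val K x u))
        - S.mulVec (val K' x u - val K x u)) ⬝ᵥ (val K' x w - val K x w))| ≤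
      h * ((b : ℝ) ^ 2 * (d * |Λ| + κS) * ((N + M) + (N' + M'))) := by
    intro x hx
    have hb : ∀ u : DGSpace T v b p, ∀ k, |val K x u k| ≤ √(C * (r ^ d)⁻¹ * elementSq K u) :=
      fun u => hK.val_sq_le u x (hsub hx)
    have hb' : ∀ u : DGSpace T v b p, ∀ k, |val K' x u k| ≤ √(C * (r' ^ d)⁻¹ * elementSq K' u) :=
      fun u => hK'.val_sq_le u x (hsub' hx)
    have hmean : ∀ k, |((1 / 2 : ℝ) • (val K' x u + val K x u)) k| ≤ √N' + √N := by
      intro k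
      rw [Pi.smul_apply, Pi.add_apply, smul_eq_mul, abs_mul, abs_of_pos (by norm_num)]
      have := (abs_add_le (val K' x u k) (val K x u k)).trans (add_le_add (hb' u k) (hb u k))
      have h1 := abs_nonneg (val K' x u k + val K x u k)
      linarith
    have hjump : ∀ (u : DGSpace T v b p) k, |(val K' x u - val K x u) k| ≤
        √(C * (r' ^ d)⁻¹ * elementSq K' u) + √(C * (r ^ d)⁻¹ * elementSq K u) := fun u k =>
      (abs_sub (val K' x u k) (val K x u k)).trans (add_le_add (hb' u k) (hb u k))
    rw [abs_mul, abs_of_nonneg (Θ.height_nonneg K.2 (hsub hx))]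
    refine mul_le_mul (hheight x hx) ?_ (abs_nonneg _) hh0
    rw [sub_dotProduct]
    refine (abs_sub _ _).trans ?_
    have h1 := abs_bilin_le (fun l k => (abs_normalFlux_le (fun j l k => (Q.bound_L j x
      (subset_domain_of_mem_patch K.2 (hsub hx)) l k).trans (le_abs_self Λ))
      (outwardNormal K.1 F) l k).trans (show _ ≤ (d : ℝ) * 1 * |Λ| by
        gcongr
        exact norm_outwardNormal_le _ _)) hmean (hjump w)
    have h2 := abs_bilin_le hSb (hjump u) (hjump w)
    rw [← hN, ← hN', ← hM, ← hM'] at *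
    have h3 : (√N' + √N) * (√M' + √M) ≤ (N + M) + (N' + M') := by
      have e1 := Real.sq_sqrt hN0
      have e2 := Real.sq_sqrt hM0
      have e3 := Real.sq_sqrt hN'0
      have e4 := Real.sq_sqrt hM'0
      nlinarith [sq_nonneg (√N' + √N - (√M' + √M)), sq_nonneg (√N' - √N), sq_nonneg (√M' - √M)]
    calc _ ≤ (b : ℝ) ^ 2 * (d * 1 * |Λ|) * (√N' + √N) * (√M' + √M) +
          (b : ℝ) ^ 2 * κS * (√N' + √N) * (√M' + √M) := add_le_add h1 h2
      _ = (b : ℝ) ^ 2 * (d * |Λ| + κS) * ((√N' + √N) * (√M' + √M)) := by ring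
      _ ≤ _ := by gcongr
  rw [facetForm_apply]
  refine (abs_setIntegral_le (facet_measure_ne_top F hcard)
    (by positivity) hpt le_rfl).trans ?_
  have hκ : (0 : ℝ) ≤ 2 / cmax := by positivity
  have k1 := facet_weight_le hd hr hC hu hm0 hh1 hκ (hK.facet_le F hF hcard)
  have k2 := facet_weight_le hd hr hC hw hm0 hh1 hκ (hK.facet_le F hF hcard)
  have k3 := facet_weight_le hd hr' hC hu' hm0 hh2 hκ (hK'.facet_le F hF' hcard)
  have k4 := facet_weight_le hd hr' hC hw' hm0 hh2 hκ (hK'.facet_le F hF' hcard)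
  calc _ = (b : ℝ) ^ 2 * (d * |Λ| + κS) * (h * N * m + h * M * m + h * N' * m + h * M' * m) := by
        ring
    _ ≤ (b : ℝ) ^ 2 * (d * |Λ| + κS) * (2 / cmax * C ^ 3 * elementSq K u +
        2 / cmax * C ^ 3 * elementSq K w + 2 / cmax * C ^ 3 * elementSq K' u +
        2 / cmax * C ^ 3 * elementSq K' w) := by gcongr
    _ = _ := by ring

theorem volumeForm_apply (Q : HyperbolicSystem d b T.domain g₀ Λ c) (Θ : Tent T v cmax)
    (u w : DGSpace T v b p) : volumeForm Q Θ u w = ∑ K : ↥(T.patch v), ∫ x in hull K.1,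
      Θ.height x * ∑ j, (Q.L j x).mulVec (val K x u) ⬝ᵥ pderivVal K j x w := by
  simp [volumeForm, integralForm]

open Classical in
theorem dgForm_apply (Q : HyperbolicSystem d b T.domain g₀ Λ c) (Θ : Tent T v cmax)
    (S : Matrix (Fin b) (Fin b) ℝ) (u w : DGSpace T v b p) :
    dgForm Q Θ S u w = volumeForm Q Θ u w + 1 / 2 * ∑ K : ↥(T.patch v), ∑ K' : ↥(T.patch v),
      if h : K ≠ K' ∧ (K.1 ∩ K'.1).card = d then
        facetForm Q Θ S K K' (K.1 ∩ K'.1) Finset.inter_subset_left h.2 u w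
      else 0 := by
  simp only [dgForm, LinearMap.add_apply, LinearMap.smul_apply, LinearMap.sum_apply, smul_eq_mul]
  congr 2
  refine Finset.sum_congr rfl fun K _ => Finset.sum_congr rfl fun K' _ => ?_
  split_ifs <;> rfl

open Classical in
/-- The sum over the pairs of neighbours is symmetric. -/
theorem sum_neighbours_swap (f : ↥(T.patch v) → Finset (Space d) → ℝ) :
    (∑ K : ↥(T.patch v), ∑ K' : ↥(T.patch v),
      if K ≠ K' ∧ (K.1 ∩ K'.1).card = d then f K' (K.1 ∩ K'.1) else 0) =
    ∑ K : ↥(T.patch v), ∑ K' : ↥(T.patch v),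
      if K ≠ K' ∧ (K.1 ∩ K'.1).card = d then f K (K.1 ∩ K'.1) else 0 := by
  rw [Finset.sum_comm]
  refine Finset.sum_congr rfl fun K _ => Finset.sum_congr rfl fun K' _ => ?_
  simp only [Finset.inter_comm K'.1 K.1, ne_comm (a := K')]

/-- The slope form and the DG form are bounded in `L²`, uniformly in the mesh and the tent. -/
theorem exists_form_bound (d b p : ℕ) (hd : 1 ≤ d) (S : Matrix (Fin b) (Fin b) ℝ)
    (Λ cmax σ : ℝ) (hcmax : 0 < cmax) : ∃ C : ℝ, 0 ≤ C ∧
    ∀ (g₀ c : ℝ) (T : Mesh d), T.ShapeRegular σ →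
    ∀ (Q : HyperbolicSystem d b T.domain g₀ Λ c) (v : Space d), v ∈ interior T.domain →
    ∀ (Θ : Tent T v cmax) (u w : DGSpace T v b p),
      |massSlopeForm Q Θ u w| ≤ C * (l2Form u u + l2Form w w) ∧
      |dgForm Q Θ S u w| ≤ C * (l2Form u u + l2Form w w) := by
  classical
  obtain ⟨C, hC, hbounds⟩ := exists_elementBounds d b p hd σ
  set κS := ∑ l, ∑ k, |S l k|
  have hS0 : 0 ≤ κS := Finset.sum_nonneg fun _ _ => Finset.sum_nonneg fun _ _ => abs_nonneg _
  have hSb : ∀ l k, |S l k| ≤ κS := fun l k =>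
    (Finset.single_le_sum (f := fun k => |S l k|) (fun _ _ => abs_nonneg _)
      (Finset.mem_univ k)).trans
    (Finset.single_le_sum (f := fun l => ∑ k, |S l k|)
      (fun _ _ => Finset.sum_nonneg fun _ _ => abs_nonneg _) (Finset.mem_univ l))
  set C₁ := (b : ℝ) ^ 2 * (d * (2 / cmax) * |Λ|) * C ^ 2
  set C₂ := (2 / cmax) * d * (b : ℝ) ^ 2 * |Λ| * C ^ 3
  set C₃ := (b : ℝ) ^ 2 * (d * |Λ| + κS) * (2 / cmax) * C ^ 3
  have hC₁ : 0 ≤ C₁ := by positivity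
  have hC₂ : 0 ≤ C₂ := by positivity
  have hC₃ : 0 ≤ C₃ := by positivity
  -- The factor d counts the facets through v of one element. Each facet pair is charged to both
  -- elements, and this 2 cancels the 1/2 in `dgForm`.
  refine ⟨C₁ + C₂ + d * C₃, by positivity, ?_⟩
  intro g₀ c T hT Q v hv Θ u w
  choose r hr using hbounds T hT v
  have hu := l2Form_self_nonneg u
  have hw := l2Form_self_nonneg w
  have hsum : l2Form u u + l2Form w w =
      ∑ K : ↥(T.patch v), (elementSq K u + elementSq K w) := by
    rw [l2Form_self, l2Form_self, Finset.sum_add_distrib]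
  have hbound : ∀ (f : ↥(T.patch v) → ℝ) (A : ℝ),
      (∀ K, |f K| ≤ A * (elementSq K u + elementSq K w)) →
      |∑ K, f K| ≤ A * (l2Form u u + l2Form w w) := by
    intro f A hf
    rw [hsum, Finset.mul_sum]
    exact (Finset.abs_sum_le_sum_abs _ _).trans (Finset.sum_le_sum fun K _ => hf K)
  have hslope : |massSlopeForm Q Θ u w| ≤ C₁ * (l2Form u u + l2Form w w) := by
    rw [massSlopeForm_apply]
    exact hbound _ _ fun K => abs_massSlope_element_le Q Θ hcmax hC (hr K) u w
  have hvol : |volumeForm Q Θ u w| ≤ C₂ * (l2Form u u + l2Form w w) := by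
    rw [volumeForm_apply]
    exact hbound _ _ fun K => abs_volume_element_le hd Q Θ hcmax hC (hr K) u w
  have hfacet : |∑ K : ↥(T.patch v), ∑ K' : ↥(T.patch v),
      if h : K ≠ K' ∧ (K.1 ∩ K'.1).card = d then
        facetForm Q Θ S K K' (K.1 ∩ K'.1) Finset.inter_subset_left h.2 u w
      else 0| ≤ 2 * (d * C₃) * (l2Form u u + l2Form w w) := by
    let e : ↥(T.patch v) → Finset (Space d) → ℝ := fun K _ =>
      C₃ * (elementSq K u + elementSq K w)
    have hself : (∑ K : ↥(T.patch v), ∑ K' : ↥(T.patch v),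
        if K ≠ K' ∧ (K.1 ∩ K'.1).card = d then e K (K.1 ∩ K'.1) else 0) =
        d * C₃ * (l2Form u u + l2Form w w) := by
      rw [hsum, Finset.mul_sum]
      refine Finset.sum_congr rfl fun K _ => ?_
      rw [sum_neighbours hd hv K (e K), Finset.sum_const,
        Finset.card_erase_of_mem (Mesh.mem_of_mem_patch K.2),
        Mesh.card_element (Mesh.mem_elements_of_mem_patch K.2)]
      simp [mul_assoc]
    calc _ ≤ ∑ K : ↥(T.patch v), ∑ K' : ↥(T.patch v),
          ((if K ≠ K' ∧ (K.1 ∩ K'.1).card = d then e K (K.1 ∩ K'.1) else 0) +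
          if K ≠ K' ∧ (K.1 ∩ K'.1).card = d then e K' (K.1 ∩ K'.1) else 0) := by
          refine (Finset.abs_sum_le_sum_abs _ _).trans (Finset.sum_le_sum fun K _ => ?_)
          refine (Finset.abs_sum_le_sum_abs _ _).trans (Finset.sum_le_sum fun K' _ => ?_)
          split_ifs with h
          · refine (abs_facetForm_le hd Q Θ hcmax S hS0 hSb hC (hr K) (hr K') _ _
              Finset.inter_subset_right _ u w).trans (le_of_eq ?_)
            simp only [e, C₃]
            ring
          · simp
      _ = _ := by
        simp only [Finset.sum_add_distrib]
        rw [sum_neighbours_swap e, hself]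
        ring
  have hl : 0 ≤ l2Form u u + l2Form w w := by positivity
  constructor
  · refine hslope.trans (mul_le_mul_of_nonneg_right ?_ hl)
    have : 0 ≤ d * C₃ := by positivity
    linarith
  · rw [dgForm_apply]
    refine (abs_add_le _ _).trans ?_
    rw [abs_mul, abs_of_pos (by norm_num : (0 : ℝ) < 1 / 2)]
    have := mul_nonneg hC₁ hl
    linarith

end Bounds

/-! ### Integration by parts and dissipation -/

section Dissipation

variable {d : ℕ} {T : Mesh d} {v : Space d} {b p : ℕ} {g₀ Λ c cmax : ℝ}

/-- The weighted flux of the element `K` through its facet `F`. -/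
noncomputable def facetFlux (Q : HyperbolicSystem d b T.domain g₀ Λ c) (Θ : Tent T v cmax)
    (u : DGSpace T v b p) (K : ↥(T.patch v)) (F : Finset (Space d)) : ℝ :=
  ∫ x in hull F, Θ.height x *
    ((normalFlux Q.L (outwardNormal K.1 F) x).mulVec (val K x u) ⬝ᵥ val K x u) ∂μHE[d - 1]

theorem mulVec_dotProduct_eq_sum (B : Matrix (Fin b) (Fin b) ℝ) (f g : Fin b → ℝ) :
    B.mulVec f ⬝ᵥ g = ∑ l, ∑ k, B l k * (f k * g l) := by
  simp only [dotProduct, Matrix.mulVec, Finset.sum_mul, mul_assoc]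

open Classical in
/-- Integration by parts on an element, in quadratic form. -/
theorem element_green (Q : HyperbolicSystem d b T.domain g₀ Λ c)
    (hT : HasNormalTraces T Q.L) (Θ : Tent T v cmax) (u : DGSpace T v b p) (K : ↥(T.patch v)) :
    2 * (∫ x in hull K.1, Θ.height x *
        ∑ j, (Q.L j x).mulVec (val K x u) ⬝ᵥ pderivVal K j x u) +
      (∫ x in hull K.1,
        (normalFlux Q.L (elementGrad Θ.height K) x).mulVec (val K x u) ⬝ᵥ val K x u) =
      ∑ w ∈ K.1.erase v, facetFlux Q Θ u K (K.1.erase w) := by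
  have hKe := Mesh.mem_elements_of_mem_patch K.2
  have hsub := subset_domain_of_mem_patch K.2
  obtain ⟨a₀, ha⟩ := Θ.exists_height_eq K.2
  set g := elementGrad Θ.height K.1 with hg
  let a : Space d → ℝ := fun x => inner ℝ g x + a₀
  have hac : Continuous a := by fun_prop
  -- The normal trace identity holds entry by entry with scalar test functions. Testing the entry
  -- (l, k) with δ u_k u_l and summing produces the quadratic form; `a` is the smooth affine
  -- extension of δ from the element.
  let φ : Fin b → Fin b → Space d → ℝ := fun l k x => a x * (val K x u k * val K x u l)
  have hφ : ∀ l k, ContDiff ℝ ∞ (φ l k) := fun l k =>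
    (((innerSL ℝ g).contDiff).add contDiff_const).mul
      ((contDiff_eval (u K k).1).mul (contDiff_eval (u K l).1))
  have hgrad : ∀ l k x j, (∇ (φ l k) x) j = g j * (val K x u k * val K x u l) +
      a x * (pderivVal K j x u k * val K x u l + val K x u k * pderivVal K j x u l) := by
    intro l k x j
    have h1 : HasFDerivAt a (innerSL ℝ g) x := (innerSL ℝ g).hasFDerivAt.add_const a₀
    have h2 : ∀ k, HasFDerivAt (fun x => val K x u k)
      (∑ j, pderivVal K j x u k • (EuclideanSpace.proj j : Space d →L[ℝ] ℝ)) x := fun k =>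
      hasFDerivAt_eval (u K k).1 x
    refine (gradient_apply (f := φ l k) (h1.mul ((h2 k).mul (h2 l))) j).trans ?_
    simp [EuclideanSpace.inner_single_right]
    ring
  have hbval : ∀ (μ : Measure (Space d)) (s : Set (Space d)), IsCompact s → ∀ k,
      BddMeas μ s (fun x => val K x u k) := fun μ s hs k =>
    .of_continuousOn hs (continuous_val K u k).continuousOn
  have hbpd : ∀ j k, BddMeas volume (hull K.1) (fun x => pderivVal K j x u k) := fun j k =>
    .of_continuousOn (isCompact_hull _) (continuous_pderivVal K j u k).continuousOn
  have hba : ∀ (μ : Measure (Space d)) (s : Set (Space d)), IsCompact s → BddMeas μ s a :=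
    fun μ s hs => .of_continuousOn hs hac.continuousOn
  -- the volume integrals
  have hint : ∀ l k, IntegrableOn (fun x => ∑ j, Q.L j x l k * (∇ (φ l k) x) j) (hull K.1) := by
    intro l k
    refine BddMeas.integrableOn (isCompact_hull _).measurableSet (volume_hull_ne_top _)
      (.sum _ fun j _ => .mul (bddMeas_coeff hsub (Q.measurable_L j l k)
        (fun x hx => Q.bound_L j x hx l k) _) ?_)
    simp only [hgrad]
    have hv := hbval volume _ (isCompact_hull K.1)
    exact ((BddMeas.const _).mul ((hv k).mul (hv l))).add ((hba _ _ (isCompact_hull _)).mul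
      (((hbpd j k).mul (hv l)).add ((hv k).mul (hbpd j l))))
  have hvol : ∑ l, ∑ k, ∫ x in hull K.1, ∑ j, Q.L j x l k * (∇ (φ l k) x) j =
      2 * (∫ x in hull K.1, Θ.height x *
        ∑ j, (Q.L j x).mulVec (val K x u) ⬝ᵥ pderivVal K j x u) +
      (∫ x in hull K.1, (normalFlux Q.L g x).mulVec (val K x u) ⬝ᵥ val K x u) := by
    have i1 : IntegrableOn (fun x => Θ.height x *
        ∑ j, (Q.L j x).mulVec (val K x u) ⬝ᵥ pderivVal K j x u) (hull K.1) :=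
      BddMeas.integrableOn (isCompact_hull _).measurableSet (volume_hull_ne_top _)
        (.mul (.of_continuousOn (isCompact_hull _) (Θ.continuousOn_height K.2))
          (.sum _ fun j _ => bddMeas_bilin (fun l k => bddMeas_coeff hsub (Q.measurable_L j l k)
            (fun x hx => Q.bound_L j x hx l k) _) (bddMeas_val K K _ u) (hbpd j)))
    have i2 : IntegrableOn (fun x =>
        (normalFlux Q.L g x).mulVec (val K x u) ⬝ᵥ val K x u) (hull K.1) :=
      BddMeas.integrableOn (isCompact_hull _).measurableSet (volume_hull_ne_top _)
        (bddMeas_bilin (bddMeas_normalFlux Q hsub _ _) (bddMeas_val K K _ u)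
          (bddMeas_val K K _ u))
    rw [← integral_const_mul, ← integral_add (i1.const_mul 2) i2]
    rw [Finset.sum_congr rfl fun l _ => (integral_finsetSum _ fun k _ => hint l k).symm,
      ← integral_finsetSum _ fun l _ => integrable_finsetSum _ fun k _ => hint l k]
    refine setIntegral_congr_fun (isCompact_hull _).measurableSet fun x hx => ?_
    have hx' := hsub hx
    have hax : Θ.height x = a x := ha x hx
    have e1 : ∑ l, ∑ k, ∑ j, Q.L j x l k * (∇ (φ l k) x) j =
        ∑ j, (g j * ((Q.L j x).mulVec (val K x u) ⬝ᵥ val K x u) +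
          a x * ((Q.L j x).mulVec (pderivVal K j x u) ⬝ᵥ val K x u +
            (Q.L j x).mulVec (val K x u) ⬝ᵥ pderivVal K j x u)) := by
      simp only [hgrad, mulVec_dotProduct_eq_sum]
      rw [Finset.sum_congr rfl fun l _ => Finset.sum_comm, Finset.sum_comm]
      refine Finset.sum_congr rfl fun j _ => ?_
      rw [← Finset.sum_add_distrib, Finset.mul_sum, Finset.mul_sum, ← Finset.sum_add_distrib]
      refine Finset.sum_congr rfl fun l _ => ?_
      rw [← Finset.sum_add_distrib, Finset.mul_sum, Finset.mul_sum, ← Finset.sum_add_distrib]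
      exact Finset.sum_congr rfl fun k _ => by ring
    have e2 : (normalFlux Q.L g x).mulVec (val K x u) ⬝ᵥ val K x u =
        ∑ j, g j * ((Q.L j x).mulVec (val K x u) ⬝ᵥ val K x u) := by
      simp [normalFlux, Matrix.sum_mulVec, Matrix.smul_mulVec, sum_dotProduct]
    simp only
    rw [e1, e2, hax, Finset.sum_add_distrib, add_comm, ← mul_assoc, Finset.mul_sum]
    congr 1
    -- Symmetry of L^(j) makes the two product-rule terms equal, which gives the factor 2.
    refine Finset.sum_congr rfl fun j _ => ?_
    rw [mulVec_dotProduct_comm (Q.symm_L j x hx') (pderivVal K j x u)]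
    ring
  -- the facet integrals
  have hcard : ∀ w ∈ K.1, (K.1.erase w).card = d := fun w hw => by
    rw [Finset.card_erase_of_mem hw, Mesh.card_element hKe]; rfl
  have hFsub : ∀ w, hull (K.1.erase w) ⊆ hull K.1 := fun w =>
    convexHull_mono (by exact_mod_cast Finset.erase_subset _ _)
  have hfacet : ∀ w ∈ K.1, ∑ l, ∑ k, ∫ x in hull (K.1.erase w),
      normalFlux Q.L (outwardNormal K.1 (K.1.erase w)) x l k * φ l k x ∂μHE[d - 1] =
      facetFlux Q Θ u K (K.1.erase w) := by
    intro w hw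
    have hi : ∀ l k, IntegrableOn (fun x =>
        normalFlux Q.L (outwardNormal K.1 (K.1.erase w)) x l k * φ l k x)
        (hull (K.1.erase w)) μHE[d - 1] := fun l k =>
      BddMeas.integrableOn (isCompact_hull _).measurableSet
        (facet_measure_ne_top _ (hcard w hw))
        ((bddMeas_normalFlux Q ((hFsub w).trans hsub) _ _ l k).mul
          ((hba _ _ (isCompact_hull _)).mul ((hbval _ _ (isCompact_hull _) k).mul
            (hbval _ _ (isCompact_hull _) l))))
    rw [Finset.sum_congr rfl fun l _ => (integral_finsetSum _ fun k _ => hi l k).symm,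
      ← integral_finsetSum _ fun l _ => integrable_finsetSum _ fun k _ => hi l k, facetFlux]
    refine setIntegral_congr_fun (isCompact_hull _).measurableSet fun x hx => ?_
    have hax : Θ.height x = a x := ha x (hFsub w hx)
    simp only [hax, mulVec_dotProduct_eq_sum, Finset.mul_sum, φ]
    exact Finset.sum_congr rfl fun l _ => Finset.sum_congr rfl fun k _ => by ring
  have hzero : facetFlux Q Θ u K (K.1.erase v) = 0 := by
    rw [facetFlux]
    refine setIntegral_eq_zero_of_forall_eq_zero fun x hx => ?_
    rw [Θ.height_eq_zero K.2 hx, zero_mul]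
  rw [← hvol, Finset.sum_congr rfl fun l _ => Finset.sum_congr rfl fun k _ =>
    hT K.1 hKe (φ l k) (hφ l k) l k, Finset.sum_congr rfl fun l _ => Finset.sum_comm,
    Finset.sum_comm, Finset.sum_congr rfl hfacet,
    ← Finset.sum_erase_add _ _ (Mesh.mem_of_mem_patch K.2), hzero, add_zero]

/-- The facet term dissipates energy up to the mean of the two element fluxes. -/
theorem facetForm_self_le (hd : 1 ≤ d) (Q : HyperbolicSystem d b T.domain g₀ Λ c)
    (Θ : Tent T v cmax) {S : Matrix (Fin b) (Fin b) ℝ} (hS : S.PosSemidef)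
    (u : DGSpace T v b p) {K K' : ↥(T.patch v)} (hne : K ≠ K') (F : Finset (Space d))
    (hF : F ⊆ K.1) (hF' : F ⊆ K'.1) (hcard : F.card = d) :
    facetForm Q Θ S K K' F hF hcard u u ≤
      -(1 / 2) * (facetFlux Q Θ u K F + facetFlux Q Θ u K' F) := by
  classical
  have hKe := Mesh.mem_elements_of_mem_patch K.2
  have hKe' := Mesh.mem_elements_of_mem_patch K'.2
  have hsub : hull F ⊆ hull K.1 := convexHull_mono (by exact_mod_cast hF)
  obtain ⟨w, hw, hFw⟩ : ∃ w ∈ K.1, F = K.1.erase w := by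
    obtain ⟨w, hw, hwF⟩ : ∃ w ∈ K.1, w ∉ F := by
      by_contra! h
      have := Finset.card_le_card (show K.1 ⊆ F from h)
      rw [Mesh.card_element hKe] at this
      omega
    refine ⟨w, hw, Finset.eq_of_subset_of_card_le (fun z hz => ?_) ?_⟩
    · exact Finset.mem_erase.2 ⟨by rintro rfl; exact hwF hz, hF hz⟩
    · rw [Finset.card_erase_of_mem hw, Mesh.card_element hKe, hcard]; rfl
  have hnormal : outwardNormal K'.1 F = -outwardNormal K.1 F := by
    rw [hFw]
    exact outwardNormal_neg hd hKe hKe' (fun h => hne (Subtype.ext h)) hw (hFw ▸ hF')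
  have hbh : BddMeas μHE[d - 1] (hull F) Θ.height :=
    .of_continuousOn (isCompact_hull _) ((Θ.continuousOn_height K.2).mono hsub)
  have hbv : ∀ (J : ↥(T.patch v)) k, BddMeas μHE[d - 1] (hull F) (fun x => val J x u k) :=
    fun J k => .of_continuousOn (isCompact_hull _) (continuous_val J u k).continuousOn
  have hflux : ∀ (J : ↥(T.patch v)) (ν : Space d), BddMeas μHE[d - 1] (hull F) (fun x =>
      Θ.height x * ((normalFlux Q.L ν x).mulVec (val J x u) ⬝ᵥ val J x u)) := fun J ν =>
    hbh.mul (bddMeas_bilin (bddMeas_normalFlux Q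
      (hsub.trans (subset_domain_of_mem_patch K.2)) _ _) (hbv J) (hbv J))
  have hint : ∀ {f : Space d → ℝ}, BddMeas μHE[d - 1] (hull F) f →
      IntegrableOn f (hull F) μHE[d - 1] := fun hf =>
    BddMeas.integrableOn (isCompact_hull _).measurableSet (facet_measure_ne_top F hcard) hf
  have hbS : BddMeas μHE[d - 1] (hull F) (fun x => Θ.height x *
      (S.mulVec (val K' x u - val K x u) ⬝ᵥ (val K' x u - val K x u))) :=
    hbh.mul (bddMeas_bilin (B := fun _ => S) (fun _ _ => .const _)
      (fun k => (hbv K' k).sub (hbv K k)) (fun k => (hbv K' k).sub (hbv K k)))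
  have hSnn : 0 ≤ ∫ x in hull F, Θ.height x *
      (S.mulVec (val K' x u - val K x u) ⬝ᵥ (val K' x u - val K x u)) ∂μHE[d - 1] := by
    refine setIntegral_nonneg (isCompact_hull _).measurableSet fun x hx => ?_
    refine mul_nonneg (Θ.height_nonneg K.2 (hsub hx)) ?_
    rw [dotProduct_comm]
    simpa using hS.dotProduct_mulVec_nonneg (val K' x u - val K x u)
  -- With D symmetric, D{u}·[u] is half the difference of the quadratic terms of the two traces: the
  -- mixed terms cancel. Reversing the normal on K' turns the difference into minus half the sum of
  -- the outward fluxes.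
  have hmain : facetForm Q Θ S K K' F hF hcard u u =
      -(1 / 2) * (facetFlux Q Θ u K F + facetFlux Q Θ u K' F) -
      ∫ x in hull F, Θ.height x *
        (S.mulVec (val K' x u - val K x u) ⬝ᵥ (val K' x u - val K x u)) ∂μHE[d - 1] := by
    rw [facetForm_apply, facetFlux, facetFlux,
      ← integral_add (hint (hflux K _)) (hint (hflux K' _)), ← integral_const_mul,
      ← integral_sub ((hint ((hflux K _).add (hflux K' _))).const_mul _) (hint hbS)]
    refine setIntegral_congr_fun (isCompact_hull _).measurableSet fun x hx => ?_
    have hsymm := normalFlux_isSymm (fun j => Q.symm_L j x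
      (subset_domain_of_mem_patch K.2 (hsub hx))) (outwardNormal K.1 F)
    have hcomm := mulVec_dotProduct_comm hsymm (val K x u) (val K' x u)
    simp only [hnormal, normalFlux_neg, Matrix.neg_mulVec, neg_dotProduct, sub_dotProduct,
      dotProduct_sub, Matrix.mulVec_smul, Matrix.mulVec_add, smul_dotProduct, add_dotProduct,
      smul_eq_mul]
    rw [hcomm]
    ring
  rw [hmain]
  linarith

/-- The semidiscrete evolution dissipates energy. -/
theorem dgForm_dissipative (hd : 1 ≤ d) (Q : HyperbolicSystem d b T.domain g₀ Λ c)
    (hT : HasNormalTraces T Q.L) (hv : v ∈ interior T.domain) (Θ : Tent T v cmax)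
    {S : Matrix (Fin b) (Fin b) ℝ} (hS : S.PosSemidef) (u : DGSpace T v b p) :
    2 * dgForm Q Θ S u u + massSlopeForm Q Θ u u ≤ 0 := by
  classical
  have hgreen : 2 * volumeForm Q Θ u u + massSlopeForm Q Θ u u =
      ∑ K : ↥(T.patch v), ∑ K' : ↥(T.patch v),
        if K ≠ K' ∧ (K.1 ∩ K'.1).card = d then facetFlux Q Θ u K (K.1 ∩ K'.1) else 0 := by
    rw [volumeForm_apply, massSlopeForm_apply, Finset.mul_sum, ← Finset.sum_add_distrib]
    refine Finset.sum_congr rfl fun K _ => ?_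
    rw [element_green Q hT Θ u K, sum_neighbours hd hv K (facetFlux Q Θ u K)]
  have hfacets : (∑ K : ↥(T.patch v), ∑ K' : ↥(T.patch v),
      if h : K ≠ K' ∧ (K.1 ∩ K'.1).card = d then
        facetForm Q Θ S K K' (K.1 ∩ K'.1) Finset.inter_subset_left h.2 u u
      else 0) ≤ -∑ K : ↥(T.patch v), ∑ K' : ↥(T.patch v),
        if K ≠ K' ∧ (K.1 ∩ K'.1).card = d then facetFlux Q Θ u K (K.1 ∩ K'.1) else 0 := by
    calc _ ≤ ∑ K : ↥(T.patch v), ∑ K' : ↥(T.patch v), -(1 / 2) *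
          ((if K ≠ K' ∧ (K.1 ∩ K'.1).card = d then facetFlux Q Θ u K (K.1 ∩ K'.1) else 0) +
          if K ≠ K' ∧ (K.1 ∩ K'.1).card = d then facetFlux Q Θ u K' (K.1 ∩ K'.1) else 0) := by
          refine Finset.sum_le_sum fun K _ => Finset.sum_le_sum fun K' _ => ?_
          split_ifs with h
          · exact facetForm_self_le hd Q Θ hS u h.1 _ _ Finset.inter_subset_right _
          · simp
      _ = _ := by
        simp only [← Finset.mul_sum, Finset.sum_add_distrib]
        -- Relabelling the ordered pairs makes the sums of own and neighbouring fluxes equal, so the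
        -- half-sum is the full flux sum of the Green identity.
        rw [sum_neighbours_swap (facetFlux Q Θ u)]
        ring
  rw [dgForm_apply]
  linarith

end Dissipation

/-- By homogeneity it suffices to take unit vectors, for which the sum of squares is 2. -/
theorem abs_le_of_sq_bound {V : Type} [NormedAddCommGroup V] [InnerProductSpace ℝ V]
    (a : LinearMap.BilinForm ℝ V) {C : ℝ}
    (h : ∀ u w, |a u w| ≤ C * (‖u‖ ^ 2 + ‖w‖ ^ 2)) (u w : V) :
    |a u w| ≤ 2 * C * ‖u‖ * ‖w‖ := by
  rcases eq_or_ne u 0 with rfl | hu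
  · simp
  rcases eq_or_ne w 0 with rfl | hw
  · simp
  have hu' := norm_ne_zero_iff.2 hu
  have hw' := norm_ne_zero_iff.2 hw
  have h1 := h (‖u‖⁻¹ • u) (‖w‖⁻¹ • w)
  rw [norm_smul, norm_smul, norm_inv, norm_inv, norm_norm, norm_norm, inv_mul_cancel₀ hu',
    inv_mul_cancel₀ hw', map_smul, map_smul, LinearMap.smul_apply, smul_eq_mul, smul_eq_mul,
    abs_mul, abs_mul, abs_inv, abs_inv, abs_norm, abs_norm] at h1
  have h2 : |a u w| = ‖u‖ * ‖w‖ * (‖w‖⁻¹ * (‖u‖⁻¹ * |a u w|)) := by field_simp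
  rw [h2]
  calc _ ≤ ‖u‖ * ‖w‖ * (C * (1 ^ 2 + 1 ^ 2)) := by gcongr
    _ = _ := by ring

end SATTent

/-! ### Stability on a subtent -/

theorem mainTheorem1 (d b p s : ℕ) (hd : 1 ≤ d) (hs : 1 ≤ s)
    (S : Matrix (Fin b) (Fin b) ℝ) (hS : S.PosSemidef)
    (g₀ Λ c cmax σ : ℝ) (hg₀ : 0 < g₀) (hc : 0 ≤ c) (hcmax : c < cmax) :
    ∃ τ₀ C : ℝ, 0 < τ₀ ∧ τ₀ ≤ 1 ∧ 0 ≤ C ∧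
      ∀ (T : SATTent.Mesh d), T.ShapeRegular σ →
      ∀ (Q : SATTent.HyperbolicSystem d b T.domain g₀ Λ c), SATTent.HasNormalTraces T Q.L →
      ∀ (v : SATTent.Space d), T.IsInteriorVertex v →
      ∀ (Θ : SATTent.Tent T v cmax) (t τ : ℝ), 0 ≤ t → 0 < τ → τ ≤ τ₀ → t + τ ≤ 1 →
        SATTent.IsPosDefOp (SATTent.massOp Q Θ p t) ∧
        SATTent.IsPosDefOp (SATTent.massOp Q Θ p (t + τ)) ∧
        ∀ u : SATTent.DGSpace T v b p,
          SATTent.energyNorm (SATTent.massOp Q Θ p (t + τ))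
              (SATTent.propagator Q Θ S p s t τ u) ≤
            (1 + C * τ ^ (s + 1)) * SATTent.energyNorm (SATTent.massOp Q Θ p t) u := by
  have hcm : 0 < cmax := hc.trans_lt hcmax
  have hm : 0 < (1 - c / cmax) * g₀ := mul_pos (by rw [sub_pos, div_lt_one hcm]; exact hcmax) hg₀
  obtain ⟨K, hK, hbound⟩ := SATTent.exists_form_bound d b p hd S Λ cmax σ hcm
  obtain ⟨C, hC, hstep⟩ := SATTent.satStep_stable _ (2 * K) hm (by positivity) s
  -- No smallness of τ is needed: M is uniformly coercive at all pseudotimes in [0, 1], and the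
  -- energy estimate only uses τ ≤ 1.
  refine ⟨1, C, one_pos, le_rfl, hC, ?_⟩
  intro T hT Q hQ v hv Θ t τ ht hτ hτ1 htτ
  have ht1 : t ≤ 1 := by linarith
  have htτ0 : 0 ≤ t + τ := by linarith
  refine ⟨SATTent.massOp_isPosDefOp Q Θ hg₀ hc hcmax ht ht1,
    SATTent.massOp_isPosDefOp Q Θ hg₀ hc hcmax htτ0 htτ, fun u => ?_⟩
  let core := SATTent.formCore (SATTent.l2Form (T := T) (v := v) (b := b) (p := p))
    SATTent.l2Form_symm SATTent.l2Form_self_nonneg SATTent.eq_zero_of_l2Form_self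
  let _ : NormedAddCommGroup (SATTent.DGSpace T v b p) := core.toNormedAddCommGroup
  let _ : InnerProductSpace ℝ (SATTent.DGSpace T v b p) := InnerProductSpace.ofCore core.toCore
  have hinner : ∀ u w : SATTent.DGSpace T v b p, inner ℝ u w = SATTent.l2Form u w :=
    fun _ _ => rfl
  have hnorm : ∀ u : SATTent.DGSpace T v b p, ‖u‖ ^ 2 = SATTent.l2Form u u := fun u =>
    (real_inner_self_eq_norm_sq u).symm
  -- M is affine in pseudotime, so a subtent is treated as a tent with initial mass operator M(t)
  -- and unchanged M₁ and A.
  have hM : SATTent.massOp Q Θ p (t + τ) =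
      SATTent.massOp Q Θ p t - τ • SATTent.opOf (SATTent.massSlopeForm Q Θ) := by
    simp only [SATTent.massOp]
    module
  have key := hstep (SATTent.DGSpace T v b p) (SATTent.massOp Q Θ p t)
    (SATTent.opOf (SATTent.massSlopeForm Q Θ)) (SATTent.opOf (SATTent.dgForm Q Θ S)) τ hτ.le hτ1
    (fun u w => SATTent.l2Form_massOp_symm Q Θ t u w)
    (fun u w => by
      rw [hinner, hinner, SATTent.l2Form_symm u, SATTent.l2Form_opOf, SATTent.l2Form_opOf,
        SATTent.massSlopeForm_symm])
    (fun u => by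
      rw [hinner, hnorm]
      exact SATTent.massOp_coercive Q Θ hg₀ hc hcmax ht ht1 u)
    (fun u => by
      rw [hinner, hnorm, ← hM]
      exact SATTent.massOp_coercive Q Θ hg₀ hc hcmax htτ0 htτ u)
    (fun u w => by
      rw [hinner, SATTent.l2Form_opOf]
      refine SATTent.abs_le_of_sq_bound _ (fun u w => ?_) u w
      rw [hnorm, hnorm]
      exact (hbound g₀ c T hT Q v hv.2 Θ u w).1)
    (fun u w => by
      rw [hinner, SATTent.l2Form_opOf]
      refine SATTent.abs_le_of_sq_bound _ (fun u w => ?_) u w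
      rw [hnorm, hnorm]
      exact (hbound g₀ c T hT Q v hv.2 Θ u w).2)
    (fun u => by
      rw [hinner, hinner, SATTent.l2Form_opOf, SATTent.l2Form_opOf]
      exact SATTent.dgForm_dissipative hd Q hQ hv.2 Θ hS u) u
  rw [hinner, hinner, ← hM] at key
  have hτs : 0 ≤ C * τ ^ (s + 1) := by positivity
  have hE : 0 ≤ SATTent.l2Form (SATTent.massOp Q Θ p t u) u :=
    le_trans (mul_nonneg hm.le (SATTent.l2Form_self_nonneg u))
      (SATTent.massOp_coercive Q Θ hg₀ hc hcmax ht ht1 u)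
  rw [SATTent.energyNorm, SATTent.energyNorm]
  refine Real.sqrt_le_iff.2 ⟨by positivity, ?_⟩
  rw [mul_pow, Real.sq_sqrt hE]
  refine key.trans (mul_le_mul_of_nonneg_right ?_ hE)
  -- The estimate is for squared norms; 1 + x ≤ (1 + x)² for x ≥ 0 allows the same constant after
  -- taking roots.
  exact le_self_pow₀ (by linarith) two_ne_zero
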